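/- **Setting.** Consider decoy-state BB84 with advantage distillation (AD). Let $N$ be the number of pulses, $b\ge 2$ the block size, $\mu_1>\mu_2+\mu_3$, $\mu_2>\mu_3\ge 0$ the intensities with probabilities $p_{\mu_i}>0$ summing to $1$, $p_{\mathsf Z},q_T\in[0,1]$, and $0<\bar\epsilon\le 1/23$. *Preparation.* For each pulse, independently, an intensity label $\mu_i$ (with probability $p_{\mu_i}$), a Poisson($\mu_i$) photon number, a uniform bit of Alice, and a basis for each party ($\mathsf Z$ with probability $p_{\mathsf Z}$, else $\mathsf X$) are drawn. *Attack.* An attack is an arbitrary joint conditional law, over all pulses, of Bob's detections and of the error classes $I,X,Z,Y$ (no error, bit flip, phase flip, both) given all photon numbers, all of Alice's bits, and the bases of the pulses that are not single-photon. It depends neither on the intensity labels nor on the bases of single-photon pulses. A bit flip is an error in a $\mathsf Z$-measurement, a phase flip an error in an $\mathsf X$-measurement. *Sets.* Among the detected positions in which both bases are $\mathsf Z$, a uniformly random fraction of size $\lceil q_T\cdot\rceil$ forms $T$ and the rest forms $Z$. The detected positions in which both bases are $\mathsf X$ form $X$. $K\subseteq Z$ consists of the positions with label $\mu_1$ or $\mu_2$.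 $K$ is put in a uniformly random order and cut into $\lfloor n_K/b\rfloor$ blocks of length $b$, where $n_K=|K|$. A block is accepted if the parities of adjacent bits of Alice and Bob agree. *Counts.* $S_{\bar K}$ is the number of accepted blocks made of single-photon positions only, $R_{\bar{\mathsf X}}$ the number of those with an odd number of phase flips, and $\Phi_{\bar{\mathsf X}}=R_{\bar{\mathsf X}}/S_{\bar K}$. Let $s_K$ be the number of single-photon positions of $K$, and $m_I,m_X,m_Z,m_Y$ the numbers of those of each class. Put $r_{\mathsf Z}=m_X+m_Y$, $r_{\neg\mathsf Z}=m_I+m_Z$, $r_{\mathsf X}=m_Z+m_Y$, $\phi_{\mathsf Z}=r_{\mathsf Z}/s_K$, $\phi_{\mathsf X}=r_{\mathsf X}/s_K$. **Estimators.** Let $\delta_H(M,\epsilon)=\sqrt{\tfrac M2\ln\tfrac1\epsilon}$, $\delta_C^+(n,\epsilon)=\ln\tfrac1\epsilon+\sqrt{2n\ln\tfrac1\epsilon+\ln^2\tfrac1\epsilon}$, $\delta_C^-(n,\epsilon)=\tfrac12\ln\tfrac1\epsilon+\sqrt{2n\ln\tfrac1\epsilon+\tfrac14\ln^2\tfrac1\epsilon}$,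 $\delta^\pm(M,n,\epsilon)=\min(\delta_H(M,\epsilon),\delta_C^\pm(n,\epsilon))$, $\nu(n,k,\epsilon)=\sqrt{\tfrac{(n+k)(k+1)}{2nk^2}\ln\tfrac1\epsilon}$, $\tau_k=\sum_{i=1}^3p_{\mu_i}e^{-\mu_i}\mu_i^k/k!$ and $\tau_1'=\sum_{i=1}^2p_{\mu_i}\mu_ie^{-\mu_i}$. For a set $f\in\{Z,X,T\}$, let $n_{f,\mu}$ and $m_{f,\mu}$ be the numbers of positions and of errors in $f$ with label $\mu$, $n_f=\sum_\mu n_{f,\mu}$, $m_f=\sum_\mu m_{f,\mu}$, $n_{f,\mu}^\pm=n_{f,\mu}\pm\delta^\pm(n_f,n_{f,\mu},\bar\epsilon)$, $m_{f,\mu}^\pm=m_{f,\mu}\pm\delta^\pm(m_f,m_{f,\mu},\bar\epsilon)$, and $$o_f^-=\tfrac{\tau_0}{\mu_2-\mu_3}\Big(\tfrac{\mu_2e^{\mu_3}n_{f,\mu_3}^-}{p_{\mu_3}}-\tfrac{\mu_3e^{\mu_2}n_{f,\mu_2}^+}{p_{\mu_2}}\Big),\qquad e_f^+=\tfrac{\tau_1}{\mu_2-\mu_3}\Big(\tfrac{e^{\mu_2}m_{f,\mu_2}^+}{p_{\mu_2}}-\tfrac{e^{\mu_3}m_{f,\mu_3}^-}{p_{\mu_3}}\Big),$$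 $$s_f^-=\tfrac{\tau_1\mu_1}{\mu_1(\mu_2-\mu_3)-(\mu_2^2-\mu_3^2)}\Big(\tfrac{e^{\mu_2}n_{f,\mu_2}^-}{p_{\mu_2}}-\tfrac{e^{\mu_3}n_{f,\mu_3}^+}{p_{\mu_3}}+\tfrac{\mu_2^2-\mu_3^2}{\mu_1^2}\Big(\tfrac{o_f^-}{\tau_0}-\tfrac{e^{\mu_1}n_{f,\mu_1}^+}{p_{\mu_1}}\Big)\Big),$$ $s_K^-=\tfrac{\tau_1'}{\tau_1}s_Z^-$, $\phi_{\mathsf Z}^+=\tfrac{e_T^+}{s_T^-}+\nu(s_K^-,s_T^-,\bar\epsilon)$, $\phi_{\mathsf X}^+=\tfrac{e_X^+}{s_X^-}+\nu(s_K^-,s_X^-,\bar\epsilon)$. For real $s,z,x$ put $$L(s,z)=\Big\lfloor\tfrac{n_K}b\Big\rfloor\Big(\tfrac s{n_K}\Big)^b\Big[(1-z)^b+z^b-\tfrac{b(b-1)}s\Big]-3\delta_H(n_K,\bar\epsilon),\qquad \Delta(s)=\Big(\tfrac{n_K}s\Big)^b\frac{3\delta_H(n_K,\bar\epsilon)}{\lfloor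 n_K/b\rfloor},$$ $$D(s,z)=(1-z)^b+z^b-\tfrac{b(b-1)}s-\Delta(s),\qquad U(s,z,x)=\frac{\frac12[(1-z)^b-(1-z-2x)^b]+\Delta(s)}{D(s,z)},$$ and $S_{\bar K}^-=L(s_K^-,\phi_{\mathsf Z}^+)$, $\Phi_{\bar{\mathsf X}}^+=U(s_K^-,\phi_{\mathsf Z}^+,\phi_{\mathsf X}^+)$. **Claims.** (A) Fix everything except the random order of $K$. Write $(n)_b=n(n-1)\cdots(n-b+1)$ and $$B(y)=\tfrac12\Big\lfloor\tfrac{n_K}b\Big\rfloor\Big[\big(\tfrac{r_{\neg\mathsf Z}}{n_K}\big)^b-\big(\tfrac{r_{\neg\mathsf Z}-2(r_{\mathsf X}-y)}{n_K}\big)^b+\big(\tfrac{r_{\mathsf Z}}{n_K}\big)^b-\big(\tfrac{r_{\mathsf Z}-2y}{n_K}\big)^b\Big].$$ (If $n_K<b$ there are no blocks and the expressions below that contain $\lfloor n_K/b\rfloor$, except the terms $3\delta_H$, are read as $0$.) 1. $\mathbb E[S_{\bar K}]=\lfloor\frac{n_K}b\rfloor\frac{(r_{\neg\mathsf Z})_b+(r_{\mathsf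 Z})_b}{(n_K)_b}$; if $s_K>0$, then $\mathbb E[S_{\bar K}]\ge L(s_K,\phi_{\mathsf Z})+3\delta_H(n_K,\bar\epsilon)$ and $\Pr[S_{\bar K}<L(s_K,\phi_{\mathsf Z})]\le\bar\epsilon$. 2. $\mathbb E[R_{\bar{\mathsf X}}]=\lfloor\frac{n_K}b\rfloor\frac1{(n_K)_b}\sum_{k\le b,\ k\text{ odd}}\binom bk[(m_Z)_k(m_I)_{b-k}+(m_Y)_k(m_X)_{b-k}]\le\frac{n_K^b}{(n_K)_b}B(m_Y)$. 3. If $r_{\mathsf Z}+2r_{\mathsf X}<r_{\neg\mathsf Z}$, then $B$ is decreasing on $[0,\min(r_{\mathsf X},r_{\mathsf Z})]$, so it is maximised at $y=0$, with $B(0)=\frac12\lfloor\frac{n_K}b\rfloor(\frac{s_K}{n_K})^b[(1-\phi_{\mathsf Z})^b-(1-\phi_{\mathsf Z}-2\phi_{\mathsf X})^b]$. Hence $\mathbb E[R_{\bar{\mathsf X}}]\le\frac{n_K^b}{(n_K)_b}B(0)$. Moreover $\Pr[R_{\bar{\mathsf X}}>B(0)+3\delta_H(n_K,\bar\epsilon)]\le\bar\epsilon$,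 and if also $n_K\ge b$ and $D(s_K,\phi_{\mathsf Z})>0$, then $S_{\bar K}>0$ and $\Phi_{\bar{\mathsf X}}\le U(s_K,\phi_{\mathsf Z},\phi_{\mathsf X})$ except with probability at most $2\bar\epsilon$. (B) For the whole protocol under an arbitrary attack, consider the following two failure events. - $F_S$: $s_K^->0$, $s_T^->0$, $\phi_{\mathsf Z}^+<\frac12$, but $S_{\bar K}<S_{\bar K}^-$. - $F_\Phi$: $n_K\ge b$, $s_K^-,s_T^-,s_X^->0$, $D(s_K^-,\phi_{\mathsf Z}^+)>0$ and $\phi_{\mathsf Z}^+<1-\phi_{\mathsf X}^+-\sqrt{\phi_{\mathsf X}^+(1-\phi_{\mathsf X}^+)+\frac12}$, but it is not the case that $S_{\bar K}>0$ and $\Phi_{\bar{\mathsf X}}\le\Phi_{\bar{\mathsf X}}^+$. Then $\Pr[F_S]\le14\bar\epsilon$ and $\Pr[F_S\cup F_\Phi]\le23\bar\epsilon$. -/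

import Mathlib

open scoped ENNReal

namespace ADQKD

/-! ### Protocol parameters -/

/-- Parameters of three-intensity decoy-state BB84 with advantage distillation (AD).
The intensities `μ₁, μ₂, μ₃` are `mu 0, mu 1, mu 2`, chosen with probabilities `p 0, p 1, p 2`. -/
structure Params where
  /-- number of pulses sent -/
  N : ℕ
  /-- AD block size -/
  b : ℕ
  /-- intensities -/
  mu : Fin 3 → ℝ
  /-- probabilities of the intensities -/
  p : Fin 3 → ℝ
  /-- probability of the Z basis, for each party -/
  pZ : ℝ
  /-- fraction of the sifted Z-basis bits used for testing -/
  qT : ℝ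
  two_le_b : 2 ≤ b
  mu_one_gt : mu 1 + mu 2 < mu 0
  mu_two_gt : mu 2 < mu 1
  mu_three_nonneg : 0 ≤ mu 2
  p_pos : ∀ l, 0 < p l
  p_sum : ∑ l, p l = 1
  pZ_nonneg : 0 ≤ pZ
  pZ_le_one : pZ ≤ 1
  qT_nonneg : 0 ≤ qT
  qT_le_one : qT ≤ 1

/-- The two measurement bases. -/
inductive Basis
  | Z
  | X
  deriving DecidableEq

instance : Fintype Basis := ⟨{Basis.Z, Basis.X}, by intro B; cases B <;> decide⟩

/-! ### The quantum communication phase -/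

/-- The random choices made for one pulse: Alice's intensity label, the photon number of the
phase-randomised coherent state, Alice's bit, and the bases of Alice and of Bob. -/
structure Pulse where
  label : Fin 3
  photons : ℕ
  bit : Bool
  basisA : Basis
  basisB : Basis

/-- What the channel (Eve and the detectors) may react to for one pulse. The intensity label is
never available (phase randomisation), and the bases are available for every pulse that is not a
single photon, but for no single-photon pulse. -/
structure Signal where
  photons : ℕ
  bit : Bool
  bases : Option (Basis × Basis)

/-- The signal carried by a pulse. -/
def Pulse.signal (x : Pulse) : Signal where
  photons := x.photons
  bit := x.bit
  bases := if x.photons = 1 then none else some (x.basisA, x.basisB)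

/-- The effect of the channel on one pulse: whether Bob detects it, and its error class
`I, X, Z, Y`, written as a pair of flags: a bit flip shows as an error of a Z-basis measurement,
a phase flip as an error of an X-basis measurement. Both flags are defined whichever basis is
measured, so that counterfactual errors make sense. -/
structure Response where
  detected : Bool
  bitFlip : Bool
  phaseFlip : Bool

/-- A general (coherent, i.e. jointly acting on all pulses) attack: given all the signals, an
arbitrary joint distribution of the responses. -/
abbrev Attack (N : ℕ) : Type := (Fin N → Signal) → PMF (Fin N → Response)

/-- The error flag shown by a measurement in the given basis. -/
def Response.flip (r : Response) : Basis → Bool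
  | .Z => r.bitFlip
  | .X => r.phaseFlip

/-! ### A run of the protocol and its counts -/

/-- Everything that happens in a run, except for the random order in which the key bits are put
before they are divided into blocks. -/
structure Run (N : ℕ) where
  pulse : Fin N → Pulse
  response : Fin N → Response
  /-- the test positions among the sifted Z-basis positions -/
  test : Finset (Fin N)

/-- The positions that are detected and in which both parties used basis `B`. -/
def sifted {N : ℕ} (pulse : Fin N → Pulse) (response : Fin N → Response) (B : Basis) :
    Finset (Fin N) :=
  Finset.univ.filter fun i =>
    (response i).detected = true ∧ (pulse i).basisA = B ∧ (pulse i).basisB = B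

/-- The names of the key-generation candidates `Z` and the two test sets `X`, `T`. -/
inductive SetName
  | Z
  | X
  | T

namespace Run

variable {N : ℕ} (ω : Run N)

/-- Alice's bit. -/
def aliceBit (i : Fin N) : Bool := (ω.pulse i).bit

/-- Bob's bit, in positions where the bases agree. -/
def bobBit (i : Fin N) : Bool :=
  xor (ω.pulse i).bit ((ω.response i).flip (ω.pulse i).basisB)

/-- The sets `Z`, `X`, `T`: `T` is the test part of the sifted Z-basis positions, `Z` the rest of
them, `X` the sifted X-basis positions. -/
def pos : SetName → Finset (Fin N)
  | .Z => sifted ω.pulse ω.response .Z \ ω.test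
  | .X => sifted ω.pulse ω.response .X
  | .T => sifted ω.pulse ω.response .Z ∩ ω.test

/-- `n_{f,μ}`: the number of positions in the set `f` with intensity label `l`. -/
def n (f : SetName) (l : Fin 3) : ℕ :=
  ((ω.pos f).filter fun i => (ω.pulse i).label = l).card

/-- `n_f`. -/
def nTot (f : SetName) : ℕ := ∑ l, ω.n f l

/-- `m_{f,μ}`: the number of errors in the set `f` with intensity label `l`. -/
def m (f : SetName) (l : Fin 3) : ℕ :=
  ((ω.pos f).filter fun i => (ω.pulse i).label = l ∧ ω.aliceBit i ≠ ω.bobBit i).card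

/-- `m_f`. -/
def mTot (f : SetName) : ℕ := ∑ l, ω.m f l

/-- The key-generation set `K`: the positions of `Z` whose intensity is not `μ₃`. -/
def key : Finset (Fin N) := (ω.pos .Z).filter fun i => (ω.pulse i).label ≠ 2

/-- `n_K`. -/
def nK : ℕ := ω.key.card

/-- The single-photon positions of `K`. -/
def single : Finset (Fin N) := ω.key.filter fun i => (ω.pulse i).photons = 1

/-- `s_K`. -/
def sK : ℕ := ω.single.card

/-- The number of single-photon positions of `K` with the given bit-flip and phase-flip flags:
`m_I, m_X, m_Z, m_Y` are `cls false false`, `cls true false`, `cls false true`,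
`cls true true`. -/
def cls (bitFlip phaseFlip : Bool) : ℕ :=
  (ω.single.filter fun i =>
    (ω.response i).bitFlip = bitFlip ∧ (ω.response i).phaseFlip = phaseFlip).card

/-- `r_Z`: the number of single-photon bit-flip errors in `K`. -/
def rZ : ℕ := (ω.single.filter fun i => (ω.response i).bitFlip = true).card

/-- `s_K - r_Z`, the number of single-photon positions of `K` without a bit-flip error. -/
def rNotZ : ℕ := (ω.single.filter fun i => (ω.response i).bitFlip = false).card

/-- `r_X`: the number of single-photon phase-flip errors in `K`, i.e. of the errors that X-basis
measurements would have shown. -/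
def rX : ℕ := (ω.single.filter fun i => (ω.response i).phaseFlip = true).card

/-- The error rate `φ_Z = r_Z / s_K`. -/
noncomputable def phiZ : ℝ := (ω.rZ : ℝ) / ω.sK

/-- The error rate `φ_X = r_X / s_K`. -/
noncomputable def phiX : ℝ := (ω.rX : ℝ) / ω.sK

/-! ### Advantage distillation

A permutation `σ` of all positions orders the key bits. They are cut into blocks of `b`
consecutive bits; incomplete blocks are dropped. -/

/-- The place `0, 1, …` of position `i` in the key reordered by `σ`. -/
def rank (σ : Equiv.Perm (Fin N)) (i : Fin N) : ℕ :=
  (ω.key.filter fun j => σ j < σ i).card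

/-- The `j`-th block of the reordered key. -/
def block (b : ℕ) (σ : Equiv.Perm (Fin N)) (j : ℕ) : Finset (Fin N) :=
  ω.key.filter fun i => ω.rank σ i / b = j

/-- The AD acceptance test `c_A = c_B` in block `j`: for adjacent bits of the block, Alice's and
Bob's parities agree. -/
def Accepted (b : ℕ) (σ : Equiv.Perm (Fin N)) (j : ℕ) : Prop :=
  ∀ i ∈ ω.block b σ j, ∀ i' ∈ ω.block b σ j, ω.rank σ i' = ω.rank σ i + 1 →
    xor (ω.aliceBit i) (ω.aliceBit i') = xor (ω.bobBit i) (ω.bobBit i')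

/-- All the bits of block `j` come from single photons. -/
def AllSingle (b : ℕ) (σ : Equiv.Perm (Fin N)) (j : ℕ) : Prop :=
  ∀ i ∈ ω.block b σ j, (ω.pulse i).photons = 1

/-- Block `j` has a logical X-basis error: an odd number of phase flips. -/
def LogicalXError (b : ℕ) (σ : Equiv.Perm (Fin N)) (j : ℕ) : Prop :=
  Odd ((ω.block b σ j).filter fun i => (ω.response i).phaseFlip = true).card

open Classical in
/-- `S_K̄`: the number of accepted blocks that consist of single-photon events only. -/
noncomputable def S (b : ℕ) (σ : Equiv.Perm (Fin N)) : ℕ :=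
  ((Finset.range (ω.nK / b)).filter fun j => ω.AllSingle b σ j ∧ ω.Accepted b σ j).card

open Classical in
/-- `R_X̄`: the number of those blocks that have a logical X-basis error. -/
noncomputable def R (b : ℕ) (σ : Equiv.Perm (Fin N)) : ℕ :=
  ((Finset.range (ω.nK / b)).filter fun j =>
    (ω.AllSingle b σ j ∧ ω.Accepted b σ j) ∧ ω.LogicalXError b σ j).card

/-- The logical X-error rate `Φ_X̄ = R_X̄ / S_K̄`. -/
noncomputable def Phi (b : ℕ) (σ : Equiv.Perm (Fin N)) : ℝ := (ω.R b σ : ℝ) / ω.S b σ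

end Run

/-! ### The law of the protocol -/

/-- `n` independent draws from `q`. -/
noncomputable def iid {α : Type} (q : PMF α) : (n : ℕ) → PMF (Fin n → α)
  | 0 => PMF.pure Fin.elim0
  | n + 1 => q.bind fun a => (iid q n).map fun v => Fin.cons a v

namespace Params

variable (P : Params)

theorem sum_ofReal_p : ∑ l, ENNReal.ofReal (P.p l) = 1 := by
  rw [← ENNReal.ofReal_sum_of_nonneg fun l _ => (P.p_pos l).le, P.p_sum, ENNReal.ofReal_one]

/-- The law of the intensity label. -/
noncomputable def labelLaw : PMF (Fin 3) :=
  PMF.ofFintype (fun l => ENNReal.ofReal (P.p l)) P.sum_ofReal_p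

/-- The photon number of a phase-randomised coherent state is Poisson distributed. -/
noncomputable def photonLaw (l : Fin 3) : PMF ℕ :=
  (ProbabilityTheory.poissonMeasure (P.mu l).toNNReal).toPMF

/-- The probability of a basis. -/
noncomputable def basisWeight : Basis → ℝ≥0∞
  | .Z => ENNReal.ofReal P.pZ
  | .X => ENNReal.ofReal (1 - P.pZ)

theorem sum_basisWeight : ∑ B, P.basisWeight B = 1 := by
  have h : (Finset.univ : Finset Basis) = {Basis.Z, Basis.X} := rfl
  rw [h, Finset.sum_pair (by decide)]
  simp only [basisWeight]
  rw [← ENNReal.ofReal_add P.pZ_nonneg (sub_nonneg.mpr P.pZ_le_one), add_sub_cancel,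
    ENNReal.ofReal_one]

/-- The law of a basis choice. -/
noncomputable def basisLaw : PMF Basis := PMF.ofFintype P.basisWeight P.sum_basisWeight

/-- The law of the random choices for one pulse. -/
noncomputable def pulseLaw : PMF Pulse :=
  P.labelLaw.bind fun l => (P.photonLaw l).bind fun k =>
    (PMF.uniformOfFintype Bool).bind fun a =>
      P.basisLaw.bind fun B => P.basisLaw.map fun B' => ⟨l, k, a, B, B'⟩

theorem powersetCard_nonempty {α : Type} (s : Finset α) :
    (s.powersetCard ⌈P.qT * (s.card : ℝ)⌉₊).Nonempty := by
  apply Finset.powersetCard_nonempty_of_le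
  exact Nat.ceil_le.mpr (mul_le_of_le_one_left (Nat.cast_nonneg _) P.qT_le_one)

/-- The law of the test set: a uniformly random subset, of size `⌈q_T n⌉`, of the `n` sifted
Z-basis positions. -/
noncomputable def testLaw {α : Type} (s : Finset α) : PMF (Finset α) :=
  PMF.uniformOfFinset (s.powersetCard ⌈P.qT * (s.card : ℝ)⌉₊) (P.powersetCard_nonempty s)

/-- The law of a run of the protocol under the attack `A`: pulses are prepared independently, the
channel responds, the test set is drawn, and the key bits are put in a uniformly random order. -/
noncomputable def law (A : Attack P.N) : PMF (Run P.N × Equiv.Perm (Fin P.N)) :=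
  (iid P.pulseLaw P.N).bind fun pulse =>
    (A fun i => (pulse i).signal).bind fun response =>
      (P.testLaw (sifted pulse response .Z)).bind fun test =>
        (PMF.uniformOfFintype (Equiv.Perm (Fin P.N))).map fun σ => (⟨pulse, response, test⟩, σ)

end Params

/-! ### The statistical estimators -/

/-- Hoeffding deviation `δ_H(N, ε)`. -/
noncomputable def deltaH (N ε : ℝ) : ℝ := √(N / 2 * Real.log (1 / ε))

/-- Chernoff deviation `δ_C⁺(n, ε)`. -/
noncomputable def deltaCPlus (n ε : ℝ) : ℝ :=
  Real.log (1 / ε) + √(2 * n * Real.log (1 / ε) + Real.log (1 / ε) ^ 2)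

/-- Chernoff deviation `δ_C⁻(n, ε)`. -/
noncomputable def deltaCMinus (n ε : ℝ) : ℝ :=
  Real.log (1 / ε) / 2 + √(2 * n * Real.log (1 / ε) + Real.log (1 / ε) ^ 2 / 4)

/-- `δ⁺(N, n, ε)`. -/
noncomputable def deltaPlus (N n ε : ℝ) : ℝ := min (deltaH N ε) (deltaCPlus n ε)

/-- `δ⁻(N, n, ε)`. -/
noncomputable def deltaMinus (N n ε : ℝ) : ℝ := min (deltaH N ε) (deltaCMinus n ε)

/-- `ν(n, k, ε)`. -/
noncomputable def nu (n k ε : ℝ) : ℝ :=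
  √((n + k) * (k + 1) / (2 * n * k ^ 2) * Real.log (1 / ε))

namespace Params

variable (P : Params)

/-- `τ_k`, the probability that a pulse has `k` photons. -/
noncomputable def tau (k : ℕ) : ℝ :=
  ∑ l, P.p l * Real.exp (-P.mu l) * P.mu l ^ k / (k.factorial : ℝ)

/-- `τ₁'`, the probability that a pulse has one photon and intensity `μ₁` or `μ₂`. -/
noncomputable def tauOneKey : ℝ :=
  P.p 0 * P.mu 0 * Real.exp (-P.mu 0) + P.p 1 * P.mu 1 * Real.exp (-P.mu 1)

variable (ε : ℝ) (ω : Run P.N)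

/-- `n_{f,μ}⁺`. -/
noncomputable def nPlus (f : SetName) (l : Fin 3) : ℝ :=
  ω.n f l + deltaPlus (ω.nTot f) (ω.n f l) ε

/-- `n_{f,μ}⁻`. -/
noncomputable def nMinus (f : SetName) (l : Fin 3) : ℝ :=
  ω.n f l - deltaMinus (ω.nTot f) (ω.n f l) ε

/-- `m_{f,μ}⁺`. -/
noncomputable def mPlus (f : SetName) (l : Fin 3) : ℝ :=
  ω.m f l + deltaPlus (ω.mTot f) (ω.m f l) ε

/-- `m_{f,μ}⁻`. -/
noncomputable def mMinus (f : SetName) (l : Fin 3) : ℝ :=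
  ω.m f l - deltaMinus (ω.mTot f) (ω.m f l) ε

/-- `o_f⁻`, the lower estimate of the number of vacuum events in the set `f`. -/
noncomputable def oMinus (f : SetName) : ℝ :=
  P.tau 0 / (P.mu 1 - P.mu 2) *
    (P.mu 1 * Real.exp (P.mu 2) * P.nMinus ε ω f 2 / P.p 2
      - P.mu 2 * Real.exp (P.mu 1) * P.nPlus ε ω f 1 / P.p 1)

/-- `s_f⁻`, the lower estimate of the number of single-photon events in the set `f`. -/
noncomputable def sMinus (f : SetName) : ℝ :=
  P.tau 1 * P.mu 0 / (P.mu 0 * (P.mu 1 - P.mu 2) - (P.mu 1 ^ 2 - P.mu 2 ^ 2)) *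
    (Real.exp (P.mu 1) * P.nMinus ε ω f 1 / P.p 1
      - Real.exp (P.mu 2) * P.nPlus ε ω f 2 / P.p 2
      + (P.mu 1 ^ 2 - P.mu 2 ^ 2) / P.mu 0 ^ 2 *
        (P.oMinus ε ω f / P.tau 0 - Real.exp (P.mu 0) * P.nPlus ε ω f 0 / P.p 0))

/-- `s_K⁻ = (τ₁' / τ₁) s_Z⁻`, the lower estimate of the number of single-photon events in `K`. -/
noncomputable def sKMinus : ℝ := P.tauOneKey / P.tau 1 * P.sMinus ε ω .Z

/-- `e_f⁺`, the upper estimate of the number of single-photon errors in the set `f`. -/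
noncomputable def ePlus (f : SetName) : ℝ :=
  P.tau 1 / (P.mu 1 - P.mu 2) *
    (Real.exp (P.mu 1) * P.mPlus ε ω f 1 / P.p 1
      - Real.exp (P.mu 2) * P.mMinus ε ω f 2 / P.p 2)

/-- `φ_Z⁺`. -/
noncomputable def phiZPlus : ℝ :=
  P.ePlus ε ω .T / P.sMinus ε ω .T + nu (P.sKMinus ε ω) (P.sMinus ε ω .T) ε

/-- `φ_X⁺`. -/
noncomputable def phiXPlus : ℝ :=
  P.ePlus ε ω .X / P.sMinus ε ω .X + nu (P.sKMinus ε ω) (P.sMinus ε ω .X) ε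

end Params

/-! ### The bounds for the AD blocks -/

/-- The lower bound on the number of accepted single-photon blocks,
`⌊n/b⌋ (s/n)^b [(1-φ_Z)^b + φ_Z^b - b(b-1)/s] - 3 δ_H(n, ε)`. -/
noncomputable def blockLower (n b : ℕ) (ε s φZ : ℝ) : ℝ :=
  ((n / b : ℕ) : ℝ) * (s / n) ^ b * ((1 - φZ) ^ b + φZ ^ b - b * (b - 1) / s) - 3 * deltaH n ε

/-- `Δ / s^b = (n/s)^b 3 δ_H(n, ε) / ⌊n/b⌋`. -/
noncomputable def blockDelta (n b : ℕ) (ε s : ℝ) : ℝ :=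
  (n / s) ^ b * (3 * deltaH n ε) / ((n / b : ℕ) : ℝ)

/-- The denominator of the bound on the logical X-error rate. -/
noncomputable def rateDen (n b : ℕ) (ε s φZ : ℝ) : ℝ :=
  (1 - φZ) ^ b + φZ ^ b - b * (b - 1) / s - blockDelta n b ε s

/-- The bound on the logical X-error rate, as a function of `s`, `φ_Z` and `φ_X`. -/
noncomputable def rateUpper (n b : ℕ) (ε s φZ φX : ℝ) : ℝ :=
  (1 / 2 * ((1 - φZ) ^ b - (1 - φZ - 2 * φX) ^ b) + blockDelta n b ε s) / rateDen n b ε s φZ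

namespace Params

variable (P : Params) (ε : ℝ) (ω : Run P.N)

/-- `S_K̄⁻`. -/
noncomputable def SMinus : ℝ :=
  blockLower ω.nK P.b ε (P.sKMinus ε ω) (P.phiZPlus ε ω)

/-- `Φ_X̄⁺`. -/
noncomputable def PhiPlus : ℝ :=
  rateUpper ω.nK P.b ε (P.sKMinus ε ω) (P.phiZPlus ε ω) (P.phiXPlus ε ω)

/-- The observed data are such that the formula for `S_K̄⁻` is meaningful (its denominators are
positive) and decreasing in `φ_Z`. -/
def SRegular : Prop :=
  0 < P.sKMinus ε ω ∧ 0 < P.sMinus ε ω .T ∧ P.phiZPlus ε ω < 1 / 2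

/-- The observed data are such that the formula for `Φ_X̄⁺` is meaningful (its denominators are
positive and there is at least one block) and increasing in `φ_Z` and `φ_X`. -/
def PhiRegular : Prop :=
  P.b ≤ ω.nK ∧ 0 < P.sKMinus ε ω ∧ 0 < P.sMinus ε ω .T ∧ 0 < P.sMinus ε ω .X ∧
    0 < rateDen ω.nK P.b ε (P.sKMinus ε ω) (P.phiZPlus ε ω) ∧
    P.phiZPlus ε ω <
      1 - P.phiXPlus ε ω - √(P.phiXPlus ε ω * (1 - P.phiXPlus ε ω) + 1 / 2)

/-- The bound `S_K̄ ≥ S_K̄⁻` fails. -/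
def SFails (σ : Equiv.Perm (Fin P.N)) : Prop :=
  P.SRegular ε ω ∧ (ω.S P.b σ : ℝ) < P.SMinus ε ω

/-- The bound `Φ_X̄ ≤ Φ_X̄⁺` fails, or `Φ_X̄` is undefined for lack of blocks. -/
def PhiFails (σ : Equiv.Perm (Fin P.N)) : Prop :=
  P.PhiRegular ε ω ∧ ¬ (0 < ω.S P.b σ ∧ ω.Phi P.b σ ≤ P.PhiPlus ε ω)

end Params

/-! ### Random blocks of a fixed key -/

/-- The uniform law of the random order of the bits. -/
noncomputable def orderLaw (N : ℕ) : PMF (Equiv.Perm (Fin N)) := PMF.uniformOfFintype _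

/-- The expectation over the random order of the bits. -/
noncomputable def orderMean {N : ℕ} (f : Equiv.Perm (Fin N) → ℕ) : ℝ :=
  ∑ σ, (orderLaw N σ).toReal * f σ

/-- The function
`½ ⌊n/b⌋ [(r/n)^b - ((r - 2(r_X - y))/n)^b + (r_Z/n)^b - ((r_Z - 2y)/n)^b]` of `y` (in the role
of `m_Y`), where `r = s_K - r_Z`. -/
noncomputable def Run.oddBound {N : ℕ} (ω : Run N) (b : ℕ) (y : ℝ) : ℝ :=
  1 / 2 * ((ω.nK / b : ℕ) : ℝ) *
    (((ω.rNotZ : ℝ) / ω.nK) ^ b - (((ω.rNotZ : ℝ) - 2 * (ω.rX - y)) / ω.nK) ^ b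
      + ((ω.rZ : ℝ) / ω.nK) ^ b - (((ω.rZ : ℝ) - 2 * y) / ω.nK) ^ b)

end ADQKD

open ADQKD

/-! Three independent sources of randomness are treated separately, each with everything else held
fixed: the order of the key, the intensity labels, and the choice of bases and test positions.

Order. Parities of adjacent bits agree exactly when the bit-flip flags do, so a block counts for `S`
iff it consists of single photons sharing one bit-flip flag (`allSingle_and_accepted_iff`). A full
block of the shuffled key is a uniform `b`-subset of `K`, so both means count `b`-subsets
(`orderMean_S`, `orderMean_R`). Comparing falling factorials with powers gives the closed bounds,
and the odd half of the binomial theorem produces `oddBound`. A transposition of two key bits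
affects at most two blocks, so revealing the order one value at a time gives a martingale with
increments of range 2 (`perm_mgf_fin`), and a deviation of 2δ_H has probability at most ε. For `R`
the third δ_H absorbs the factor n^b/(n)_b: with more than 3δ_H blocks it costs at most (b-1)/2 ≤
δ_H, and with fewer blocks the bound is trivial (`R_tail`).

Labels. The attack does not see them, so given the rest they are independent with a law fixed by the
photon number (`label_bound`), and the counts by label obey Hoeffding and Chernoff bounds. The decoy
estimates are linear forms in these counts. At the label law of a `k`-photon pulse the form for
single photons is at most 1_{k=1} (`decoyForm_labelProb_le`), and the form for errors is at least
1_{k=1} (`le_ePlus`). The number s_K depends on the labels too. Its fluctuation needs no additional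
term in the estimator: it is merged with that of the count of label `1`, since subtracting a small
multiple of an indicator containing the counted one worsens neither Hoeffding's nor Chernoff's bound
(`thinned_upper_tail`, `sKMinus_le`).

Bases and tests. The attack sees neither labels nor bases of single photons, so labels, bases and
test membership are exchangeable over the detected single photons (`law_permute`). Serfling's
inequality then carries error rates from the test sets to `K` with excess ν.

Finally the true s_K, φ_Z, φ_X are replaced by their estimates, which requires monotonicity of the
block bounds. The delicate case is the error rate bound as a function of φ_Z, settled by a
derivative whose sign follows from `weighted_pow_ge`.

Failure budget in units of ε: s_K 4; φ_Z 3 + 2 + 1 = 6; `S` 1; together 11 ≤ 14. Then φ_X 6 and `R`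
1 make 18 ≤ 23. -/

namespace ADQKD

/-! ### Tail bounds for finite families of independent choices -/

section Finite

variable {ι κ : Type*}

/-- Hoeffding's lemma for a finitely supported distribution. -/
theorem sum_mul_exp_le_of_range_le [Fintype κ] (w x : κ → ℝ) (hw : ∀ a, 0 ≤ w a)
    (hw1 : ∑ a, w a = 1) {c : ℝ} (hx : ∀ a b, x a - x b ≤ c) (t : ℝ) :
    ∑ a, w a * Real.exp (t * (x a - ∑ b, w b * x b)) ≤ Real.exp (t ^ 2 * c ^ 2 / 8) := by
  classical
  have hne : Nonempty κ := by
    by_contra h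
    rw [not_nonempty_iff] at h
    simp at hw1
  let _ : MeasurableSpace κ := ⊤
  have hs : ∑ a, ENNReal.ofReal (w a) = 1 := by
    rw [← ENNReal.ofReal_sum_of_nonneg fun a _ => hw a, hw1, ENNReal.ofReal_one]
  set p : PMF κ := PMF.ofFintype (fun a => ENNReal.ofReal (w a)) hs with hp
  have hpa : ∀ a, (p a).toReal = w a := fun a => by
    rw [hp, PMF.ofFintype_apply, ENNReal.toReal_ofReal (hw a)]
  obtain ⟨m, -, hm⟩ := Finset.exists_min_image Finset.univ x Finset.univ_nonempty
  have hmem : ∀ a, x a ∈ Set.Icc (x m) (x m + c) := fun a =>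
    ⟨hm a (Finset.mem_univ a), by linarith [hx a m]⟩
  have h := ProbabilityTheory.hasSubgaussianMGF_of_mem_Icc (μ := p.toMeasure) (X := x)
    (a := x m) (b := x m + c) (measurable_of_finite x).aemeasurable (Filter.Eventually.of_forall hmem)
  have h2 := h.mgf_le t
  rw [ProbabilityTheory.mgf, PMF.integral_eq_sum, PMF.integral_eq_sum] at h2
  simp only [hpa, smul_eq_mul] at h2
  refine h2.trans (Real.exp_le_exp.mpr (le_of_eq ?_))
  simp only [NNReal.coe_pow, NNReal.coe_div, coe_nnnorm, NNReal.coe_ofNat, add_sub_cancel_left,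
    div_pow, Real.norm_eq_abs, sq_abs]
  ring

/-- The exponential Markov inequality for a finite weighted sum. -/
theorem sum_ite_le_exp_mul [Fintype κ] (w X : κ → ℝ) (hw : ∀ a, 0 ≤ w a) (t : ℝ) {s : ℝ}
    (hs : 0 ≤ s) :
    (∑ a, if t < X a then w a else 0) ≤
      Real.exp (-(s * t)) * ∑ a, w a * Real.exp (s * X a) := by
  rw [Finset.mul_sum]
  refine Finset.sum_le_sum fun a _ => ?_
  have h0 : 0 ≤ Real.exp (-(s * t)) * (w a * Real.exp (s * X a)) := by
    have := hw a
    positivity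
  split_ifs with h
  · have : 1 ≤ Real.exp (-(s * t)) * Real.exp (s * X a) := by
      rw [← Real.exp_add]
      apply Real.one_le_exp
      nlinarith
    nlinarith [hw a]
  · exact h0

variable [Fintype ι] [DecidableEq ι] [Fintype κ]

/-- Independence makes the moment generating function factorise; coordinates outside `I` sum to 1.
-/
theorem sum_prod_mul_exp (ρ : ι → κ → ℝ) (hρ1 : ∀ i, ∑ a, ρ i a = 1) (I : Finset ι)
    (G : ι → κ → ℝ) :
    ∑ l : ι → κ, (∏ i, ρ i (l i)) * Real.exp (∑ i ∈ I, G i (l i)) =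
      ∏ i ∈ I, ∑ a, ρ i a * Real.exp (G i a) := by
  have h : ∀ l : ι → κ, (∏ i, ρ i (l i)) * Real.exp (∑ i ∈ I, G i (l i)) =
      ∏ i, ρ i (l i) * (if i ∈ I then Real.exp (G i (l i)) else 1) := by
    intro l
    rw [Finset.prod_mul_distrib, Real.exp_sum, Finset.prod_ite_mem, Finset.univ_inter]
  simp only [h]
  rw [← Fintype.prod_sum fun i a => ρ i a * (if i ∈ I then Real.exp (G i a) else 1)]
  rw [← Finset.prod_subset (Finset.subset_univ I)]
  · refine Finset.prod_congr rfl fun i hi => Finset.sum_congr rfl fun a _ => ?_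
    rw [if_pos hi]
  · intro i _ hi
    simp [hi, hρ1]

/-- Chernoff's bound for independent choices, given bounds on the moment generating functions. -/
theorem sum_ite_prod_le_of_mgf (ρ : ι → κ → ℝ) (hρ : ∀ i a, 0 ≤ ρ i a)
    (hρ1 : ∀ i, ∑ a, ρ i a = 1) (I : Finset ι) (G : ι → κ → ℝ) {s : ℝ} (hs : 0 ≤ s) (t : ℝ)
    (ψ : ι → ℝ) (hψ : ∀ i ∈ I, ∑ a, ρ i a * Real.exp (s * G i a) ≤ Real.exp (ψ i)) :
    (∑ l : ι → κ, if t < ∑ i ∈ I, G i (l i) then ∏ i, ρ i (l i) else 0) ≤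
      Real.exp (∑ i ∈ I, ψ i - s * t) := by
  refine (sum_ite_le_exp_mul (fun l : ι → κ => ∏ i, ρ i (l i)) (fun l => ∑ i ∈ I, G i (l i))
    (fun l => Finset.prod_nonneg fun i _ => hρ i _) t hs).trans ?_
  have h := sum_prod_mul_exp ρ hρ1 I fun i a => s * G i a
  simp only [← Finset.mul_sum] at h
  rw [h, sub_eq_neg_add, Real.exp_add, Real.exp_sum]
  refine mul_le_mul_of_nonneg_left (Finset.prod_le_prod (fun i _ => ?_) hψ) (Real.exp_pos _).le
  exact Finset.sum_nonneg fun a _ => mul_nonneg (hρ i a) (Real.exp_pos _).le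

end Finite

/-! ### The deviation functions of the estimators. -/

section Deviations

variable {ε : ℝ}

theorem log_inv_pos (hε : 0 < ε) (hε1 : ε < 1) : 0 < Real.log (1 / ε) := by
  apply Real.log_pos
  rw [lt_div_iff₀ hε]
  linarith

theorem exp_neg_log_inv (hε : 0 < ε) : Real.exp (-Real.log (1 / ε)) = ε := by
  rw [one_div, Real.log_inv, neg_neg, Real.exp_log hε]

/-- Since e³ < 23. Only here does the bound 1/23 matter beyond ε < 1; the consequence δ_H² ≥ 1.5 n
is what `R_tail` needs. -/
theorem three_le_log_inv (hε : 0 < ε) (hε' : ε ≤ 1 / 23) : 3 ≤ Real.log (1 / ε) := by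
  rw [Real.le_log_iff_exp_le (by positivity)]
  have h1 : Real.exp 3 ≤ 23 := by
    have h := Real.exp_one_lt_d9
    have : Real.exp 3 = Real.exp 1 ^ 3 := by rw [← Real.exp_nat_mul]; norm_num
    rw [this]
    have h0 := Real.exp_pos 1
    calc Real.exp 1 ^ 3 ≤ 2.72 ^ 3 := by gcongr; linarith
      _ ≤ 23 := by norm_num
  refine h1.trans ?_
  rw [le_div_iff₀ hε]
  linarith

theorem deltaH_sq {M : ℝ} (hM : 0 ≤ M) (hL : 0 ≤ Real.log (1 / ε)) :
    deltaH M ε ^ 2 = M / 2 * Real.log (1 / ε) := by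
  rw [deltaH, Real.sq_sqrt (by positivity)]

theorem deltaH_nonneg (M : ℝ) : 0 ≤ deltaH M ε := Real.sqrt_nonneg _

theorem deltaCMinus_nonneg (hL : 0 ≤ Real.log (1 / ε)) (n : ℝ) : 0 ≤ deltaCMinus n ε := by
  unfold deltaCMinus; positivity

theorem deltaCPlus_nonneg (hL : 0 ≤ Real.log (1 / ε)) (n : ℝ) : 0 ≤ deltaCPlus n ε := by
  unfold deltaCPlus; positivity

theorem deltaMinus_nonneg (hL : 0 ≤ Real.log (1 / ε)) (M n : ℝ) : 0 ≤ deltaMinus M n ε :=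
  le_min (deltaH_nonneg M) (deltaCMinus_nonneg hL n)

theorem deltaPlus_nonneg (hL : 0 ≤ Real.log (1 / ε)) (M n : ℝ) : 0 ≤ deltaPlus M n ε :=
  le_min (deltaH_nonneg M) (deltaCPlus_nonneg hL n)

theorem deltaCMinus_mono (hL : 0 ≤ Real.log (1 / ε)) {n n' : ℝ} (h : n ≤ n') :
    deltaCMinus n ε ≤ deltaCMinus n' ε := by
  unfold deltaCMinus; gcongr

theorem log_inv_le_deltaCMinus (hL : 0 ≤ Real.log (1 / ε)) {n : ℝ} (hn : 0 ≤ n) :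
    Real.log (1 / ε) ≤ deltaCMinus n ε := by
  have : Real.log (1 / ε) / 2 ≤ √(2 * n * Real.log (1 / ε) + Real.log (1 / ε) ^ 2 / 4) := by
    apply Real.le_sqrt_of_sq_le
    have : 0 ≤ 2 * n * Real.log (1 / ε) := by positivity
    nlinarith
  unfold deltaCMinus
  linarith

/-- With L = log (1/ε), `deltaCMinus` is the positive root of d² = L(2n + d), the form in which the
Chernoff exponent at mean n is evaluated. -/
theorem deltaCMinus_sq (hL : 0 ≤ Real.log (1 / ε)) {n : ℝ} (hn : 0 ≤ n) :
    deltaCMinus n ε ^ 2 = Real.log (1 / ε) * (2 * n + deltaCMinus n ε) := by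
  unfold deltaCMinus
  have := Real.sq_sqrt (show 0 ≤ 2 * n * Real.log (1 / ε) + Real.log (1 / ε) ^ 2 / 4 by positivity)
  nlinarith

/-- `deltaCPlus n` is the positive root of t² = 2L(n + t). The estimator is evaluated at the
observed count n, the tail bound at the mean n + t; this passes from one to the other. -/
theorem sqrt_lt_of_deltaCPlus_lt (hL : 0 < Real.log (1 / ε)) {n t : ℝ}
    (h : deltaCPlus n ε < t) : √(2 * (n + t) * Real.log (1 / ε)) < t := by
  unfold deltaCPlus at h
  set L := Real.log (1 / ε)
  have h0 := Real.sqrt_nonneg (2 * n * L + L ^ 2)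
  have h1 : √(2 * n * L + L ^ 2) < t - L := by linarith
  rw [Real.sqrt_lt' (by linarith)] at h1
  rw [Real.sqrt_lt' (by linarith)]
  nlinarith

/-- For a mean n + t above the observed count n: the deviation scale at the mean is covered by that
at the count plus the gap. -/
theorem sqrt_le_deltaCMinus_add (hL : 0 < Real.log (1 / ε)) {n t : ℝ} (hn : 0 ≤ n)
    (ht : 0 ≤ t) : √(2 * (n + t) * Real.log (1 / ε)) ≤ deltaCMinus n ε + t := by
  unfold deltaCMinus
  set L := Real.log (1 / ε)
  have h0 : L / 2 ≤ √(2 * n * L + L ^ 2 / 4) := by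
    apply Real.le_sqrt_of_sq_le
    have : 0 ≤ 2 * n * L := by positivity
    nlinarith
  have h1 := Real.sq_sqrt (show 0 ≤ 2 * n * L + L ^ 2 / 4 by positivity)
  rw [Real.sqrt_le_left (by positivity)]
  nlinarith [mul_nonneg ht (sub_nonneg.2 h0), mul_nonneg ht hL.le]

theorem nu_anti (hL : 0 ≤ Real.log (1 / ε)) {n n' k k' : ℝ} (hn : 0 < n) (hnn : n ≤ n')
    (hk : 0 < k) (hkk : k ≤ k') : nu n' k' ε ≤ nu n k ε := by
  unfold nu
  apply Real.sqrt_le_sqrt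
  refine mul_le_mul_of_nonneg_right ?_ hL
  have hn' := hn.trans_le hnn
  have hk' := hk.trans_le hkk
  -- Written as a sum, every term is visibly decreasing in both variables.
  have e : ∀ n k : ℝ, 0 < n → 0 < k → (n + k) * (k + 1) / (2 * n * k ^ 2) =
      (1 / k + 1 / k ^ 2 + 1 / n + 1 / (n * k)) / 2 := by
    intro n k hn hk
    field_simp
    ring
  rw [e n k hn hk, e n' k' hn' hk']
  gcongr

end Deviations

section Tails

variable {ι κ : Type*} [Fintype ι] [DecidableEq ι] [Fintype κ]

/-- Hoeffding's inequality. -/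
theorem hoeffding_tail (ρ : ι → κ → ℝ) (hρ : ∀ i a, 0 ≤ ρ i a) (hρ1 : ∀ i, ∑ a, ρ i a = 1)
    (I : Finset ι) {ε : ℝ} (hε : 0 < ε) (hε1 : ε < 1)
    (G : ι → κ → ℝ) (hG : ∀ i ∈ I, ∀ a b, G i a - G i b ≤ 1) :
    (∑ l : ι → κ, if deltaH I.card ε < ∑ i ∈ I, (G i (l i) - ∑ a, ρ i a * G i a)
      then ∏ i, ρ i (l i) else 0) ≤ ε := by
  have hL := log_inv_pos hε hε1
  rcases I.eq_empty_or_nonempty with rfl | hI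
  · simpa [deltaH] using hε.le
  have hM : (0 : ℝ) < I.card := by exact_mod_cast hI.card_pos
  have hd := deltaH_sq hM.le hL.le
  set d := deltaH I.card ε
  have hd0 : 0 ≤ d := deltaH_nonneg _
  -- The parameter 4d/|I| minimises the exponent |I|s²/8 - sd, with minimum -2d²/|I| = -log (1/ε).
  refine (sum_ite_prod_le_of_mgf ρ hρ hρ1 I (fun i a => G i a - ∑ a, ρ i a * G i a)
    (s := 4 * d / I.card) (by positivity) d (fun _ => (4 * d / I.card) ^ 2 * 1 ^ 2 / 8)
    fun i hi => sum_mul_exp_le_of_range_le (ρ i) (G i) (hρ i) (hρ1 i) (hG i hi) _).trans ?_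
  rw [Finset.sum_const, nsmul_eq_mul]
  conv_rhs => rw [← exp_neg_log_inv hε]
  apply le_of_eq
  congr 1
  field_simp
  nlinarith

/-- Chernoff's inequality for the upper tail, given Poisson-type moment generating functions. -/
theorem chernoff_upper_tail (ρ : ι → κ → ℝ) (hρ : ∀ i a, 0 ≤ ρ i a) (hρ1 : ∀ i, ∑ a, ρ i a = 1)
    (I : Finset ι) {ε : ℝ} (hε : 0 < ε) (hε1 : ε < 1)
    (G : ι → κ → ℝ) (v : ι → ℝ) (hv : ∀ i ∈ I, 0 ≤ v i)
    (hG : ∀ i ∈ I, ∀ s, 0 ≤ s →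
      ∑ a, ρ i a * Real.exp (s * G i a) ≤ Real.exp (v i * (Real.exp s - 1 - s))) :
    (∑ l : ι → κ, if deltaCMinus (∑ i ∈ I, v i) ε < ∑ i ∈ I, G i (l i)
      then ∏ i, ρ i (l i) else 0) ≤ ε := by
  have hL := log_inv_pos hε hε1
  have hV : 0 ≤ ∑ i ∈ I, v i := Finset.sum_nonneg hv
  have hd := deltaCMinus_sq hL.le hV
  have key : ∀ s, 0 ≤ s → (∑ i ∈ I, v i) * (Real.exp s - 1 - s) -
      s * deltaCMinus (∑ i ∈ I, v i) ε ≤ -Real.log (1 / ε) →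
      (∑ l : ι → κ, if deltaCMinus (∑ i ∈ I, v i) ε < ∑ i ∈ I, G i (l i)
      then ∏ i, ρ i (l i) else 0) ≤ ε := by
    intro s hs h
    refine (sum_ite_prod_le_of_mgf ρ hρ hρ1 I G hs _ _ fun i hi => hG i hi s hs).trans ?_
    rw [← Finset.sum_mul]
    exact (Real.exp_le_exp.mpr h).trans_eq (exp_neg_log_inv hε)
  have hd0 := deltaCMinus_nonneg hL.le (∑ i ∈ I, v i)
  set V := ∑ i ∈ I, v i
  set d := deltaCMinus V ε
  set L := Real.log (1 / ε)
  have hdL : L ≤ d := log_inv_le_deltaCMinus hL.le hV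
  rcases hV.eq_or_lt with h0 | h0
  -- At V = 0 the exponent is just -sd, and d ≥ L makes s = 1 sufficient.
  · refine key 1 zero_le_one ?_
    rw [← h0]
    linarith
  · have hx : 0 ≤ d / V := by positivity
    -- The optimal parameter for a Poisson-type bound. With log(1+x) ≥ 2x/(x+2), the identity d² =
    -- L(2V + d) makes the lower bound for (V+d)·log(1+d/V) exactly d + L.
    refine key (Real.log (1 + d / V)) (Real.log_nonneg (by linarith)) ?_
    rw [Real.exp_log (by positivity)]
    have h1 := Real.le_log_one_add_of_nonneg hx
    have h2 : 2 * (d / V) / (d / V + 2) = 2 * d / (d + 2 * V) := by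
      field_simp
    rw [h2] at h1
    have h3 : (V + d) * (2 * d / (d + 2 * V)) ≤ (V + d) * Real.log (1 + d / V) :=
      mul_le_mul_of_nonneg_left h1 (by positivity)
    have h4 : (V + d) * (2 * d / (d + 2 * V)) = d + L := by
      have : d + 2 * V ≠ 0 := by positivity
      field_simp
      nlinarith
    have h5 : V * (1 + d / V - 1 - Real.log (1 + d / V)) = d - V * Real.log (1 + d / V) := by
      field_simp
      ring
    rw [h5]
    linarith

/-- Chernoff's inequality for the lower tail of a number of occurrences of independent events. -/
theorem chernoff_lower_tail [DecidableEq κ] (ρ : ι → κ → ℝ) (hρ : ∀ i a, 0 ≤ ρ i a) (hρ1 : ∀ i, ∑ a, ρ i a = 1)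
    (I : Finset ι) {ε : ℝ} (hε : 0 < ε) (hε1 : ε < 1)
    (A : Finset κ) {t : ℝ} (ht : 0 ≤ t)
    (ht2 : 2 * (∑ i ∈ I, ∑ a ∈ A, ρ i a) * Real.log (1 / ε) ≤ t ^ 2) :
    (∑ l : ι → κ, if t < ∑ i ∈ I, ((∑ a ∈ A, ρ i a) - if l i ∈ A then 1 else 0)
      then ∏ i, ρ i (l i) else 0) ≤ ε := by
  have hL := log_inv_pos hε hε1
  have hv : ∀ i, 0 ≤ ∑ a ∈ A, ρ i a := fun i => Finset.sum_nonneg fun a _ => hρ i a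
  have hV : 0 ≤ ∑ i ∈ I, ∑ a ∈ A, ρ i a := Finset.sum_nonneg fun i _ => hv i
  rcases hV.eq_or_lt with h0 | h0
  · have : ∀ l : ι → κ, ¬ t < ∑ i ∈ I, ((∑ a ∈ A, ρ i a) - if l i ∈ A then 1 else 0) := by
      intro l
      rw [not_lt, Finset.sum_sub_distrib, ← h0]
      have : 0 ≤ ∑ i ∈ I, (if l i ∈ A then (1 : ℝ) else 0) :=
        Finset.sum_nonneg fun i _ => by split_ifs <;> norm_num
      linarith
    simp only [this, if_false, Finset.sum_const_zero, hε.le]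
  set V := ∑ i ∈ I, ∑ a ∈ A, ρ i a with hVdef
  have hmgf : ∀ s : ℝ, 0 ≤ s → ∀ i ∈ I,
      ∑ a, ρ i a * Real.exp (s * ((∑ a ∈ A, ρ i a) - if a ∈ A then 1 else 0)) ≤
        Real.exp ((∑ a ∈ A, ρ i a) * (s ^ 2 / 2)) := by
    intro s hs i _
    set p := ∑ a ∈ A, ρ i a
    have h1 : ∀ a, ρ i a * Real.exp (s * (p - if a ∈ A then 1 else 0)) =
        Real.exp (s * p) * (ρ i a + (Real.exp (-s) - 1) * if a ∈ A then ρ i a else 0) := by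
      intro a
      rw [mul_sub, sub_eq_add_neg, Real.exp_add]
      split_ifs
      · rw [mul_one]; ring
      · simp; ring
    simp only [h1]
    rw [← Finset.mul_sum, Finset.sum_add_distrib, hρ1, ← Finset.mul_sum, Finset.sum_ite_mem,
      Finset.univ_inter]
    have h2 : 1 + (Real.exp (-s) - 1) * p ≤ Real.exp ((Real.exp (-s) - 1) * p) := by
      linarith [Real.add_one_le_exp ((Real.exp (-s) - 1) * p)]
    -- Invert e^s ≥ 1 + s + s²/2, using (1 + s + s²/2)(1 - s + s²/2) = 1 + s⁴/4 ≥ 1.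
    have h3 : Real.exp (-s) ≤ 1 - s + s ^ 2 / 2 := by
      have := Real.quadratic_le_exp_of_nonneg hs
      rw [Real.exp_neg, inv_le_comm₀ (Real.exp_pos s) (by nlinarith [sq_nonneg (s - 1)])]
      refine le_trans ?_ this
      rw [inv_le_iff_one_le_mul₀ (by nlinarith [sq_nonneg (s - 1)])]
      nlinarith [sq_nonneg s, sq_nonneg (s ^ 2)]
    calc Real.exp (s * p) * (1 + (Real.exp (-s) - 1) * p)
        ≤ Real.exp (s * p) * Real.exp ((Real.exp (-s) - 1) * p) := by gcongr
      _ = Real.exp (p * (Real.exp (-s) - 1 + s)) := by rw [← Real.exp_add]; ring_nf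
      _ ≤ Real.exp (p * (s ^ 2 / 2)) := by
        apply Real.exp_le_exp.mpr
        exact mul_le_mul_of_nonneg_left (by linarith) (hv i)
  have hs : 0 ≤ t / V := by positivity
  refine (sum_ite_prod_le_of_mgf ρ hρ hρ1 I _ hs t _ (hmgf _ hs)).trans ?_
  rw [← Finset.sum_mul, ← hVdef]
  conv_rhs => rw [← exp_neg_log_inv hε]
  apply Real.exp_le_exp.mpr
  have : V * ((t / V) ^ 2 / 2) - t / V * t = -(t ^ 2 / (2 * V)) := by
    field_simp
    ring
  rw [this, neg_le_neg_iff, le_div_iff₀ (by positivity)]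
  linarith

end Tails

/-- The moment generating function of `1_{a₀} - θ 1_A` is of Poisson type. -/
theorem mgf_indicator_sub_le {κ : Type*} [Fintype κ] [DecidableEq κ] (w : κ → ℝ)
    (hw : ∀ a, 0 ≤ w a) (hw1 : ∑ a, w a = 1) {a₀ : κ} {A : Finset κ} (ha : a₀ ∈ A) {θ : ℝ}
    (hθ : 0 ≤ θ) (hθA : θ * ∑ a ∈ A, w a ≤ w a₀) {s : ℝ} (hs : 0 ≤ s) :
    ∑ a, w a * Real.exp (s * (((if a = a₀ then 1 else 0) - θ * if a ∈ A then 1 else 0) -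
        (w a₀ - θ * ∑ a ∈ A, w a))) ≤
      Real.exp (w a₀ * (Real.exp s - 1 - s)) := by
  set P := ∑ a ∈ A, w a
  set y := Real.exp (-(s * θ)) with hy
  have h1 : ∀ a, w a * Real.exp (s * (((if a = a₀ then 1 else 0) - θ * if a ∈ A then 1 else 0) -
        (w a₀ - θ * P))) = Real.exp (-(s * (w a₀ - θ * P))) *
        (w a + (y - 1) * (if a ∈ A then w a else 0) +
          y * (Real.exp s - 1) * (if a = a₀ then w a else 0)) := by
    intro a
    rw [mul_sub, sub_eq_neg_add, Real.exp_add]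
    by_cases h : a = a₀
    · subst h
      rw [if_pos rfl, if_pos ha, if_pos ha, if_pos rfl, mul_one,
        show s * (1 - θ) = -(s * θ) + s by ring, Real.exp_add _ s, ← hy]
      ring_nf
    · rw [if_neg h, if_neg h]
      split_ifs
      · rw [mul_one, zero_sub, mul_neg, ← hy]; ring
      · simp; ring
  simp only [h1]
  rw [← Finset.mul_sum, Finset.sum_add_distrib, Finset.sum_add_distrib, hw1, ← Finset.mul_sum,
    ← Finset.mul_sum, Finset.sum_ite_mem, Finset.univ_inter, Finset.sum_ite_eq' Finset.univ a₀ w,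
    if_pos (Finset.mem_univ _)]
  have hP : 0 ≤ P := Finset.sum_nonneg fun a _ => hw a
  have hC : s ≤ Real.exp s - 1 := by linarith [Real.add_one_le_exp s]
  have hB : 0 ≤ s * θ := mul_nonneg hs hθ
  have hy0 : 0 < y := Real.exp_pos _
  have hy1 : y * (1 + s * θ) ≤ 1 := by
    have h2 : y * Real.exp (s * θ) = 1 := by rw [hy, ← Real.exp_add]; simp
    have h3 := Real.add_one_le_exp (s * θ)
    nlinarith
  have hyle : y ≤ 1 := by nlinarith
  have hCP : s * θ * P ≤ w a₀ * (Real.exp s - 1) := by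
    calc s * θ * P = s * (θ * P) := by ring
      _ ≤ s * w a₀ := by gcongr
      _ ≤ w a₀ * (Real.exp s - 1) := by nlinarith [hw a₀]
  -- With C = e^s - 1, right minus left is (1 - y)(w a₀·C - sθP) + P(1 - y(1 + sθ)); both terms are
  -- nonnegative, the first because θP ≤ w a₀.
  have h4 : 1 + (y - 1) * P + y * (Real.exp s - 1) * w a₀ ≤
      w a₀ * (Real.exp s - 1) - s * θ * P + 1 := by
    nlinarith [mul_nonneg (sub_nonneg.2 hyle) (sub_nonneg.2 hCP), mul_nonneg hP (sub_nonneg.2 hy1)]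
  calc _ ≤ Real.exp (-(s * (w a₀ - θ * P))) * Real.exp (w a₀ * (Real.exp s - 1) - s * θ * P) := by
        refine mul_le_mul_of_nonneg_left (h4.trans ?_) (Real.exp_pos _).le
        exact Real.add_one_le_exp _
    _ = _ := by rw [← Real.exp_add]; ring_nf

/-! ### Random permutations -/

section Permutations

open Equiv

/-- Right translations preserve the uniform law. A bound for random permutations of a subset,
uniform in the outer permutation, therefore passes to a permutation of everything. -/
theorem sum_sum_mul_right {Γ H : Type*} [Group H] [Fintype H] [Fintype Γ] (φ : Γ → H)
    (F : H → ℝ) : ∑ g, ∑ γ, F (g * φ γ) = Fintype.card Γ * ∑ g, F g := by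
  rw [Finset.sum_comm]
  have : ∀ γ, ∑ g, F (g * φ γ) = ∑ g, F g := fun γ => Equiv.sum_comp (Equiv.mulRight (φ γ)) F
  simp [this]

/-- A coupling: left multiplication by `swap p q` matches the permutations sending 0 to `p` with
those sending 0 to `q`. It shows that the conditional means given the image of 0 differ by at most
the effect of one transposition. -/
theorem exists_decomposeFin_swap_mul {n : ℕ} (p q : Fin (n + 1)) :
    ∃ φ : Perm (Fin n) ≃ Perm (Fin n), ∀ e, Perm.decomposeFin.symm (q, φ e) =
      swap p q * Perm.decomposeFin.symm (p, e) := by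
  have h0 : ∀ e : Perm (Fin n), Perm.decomposeFin.symm (0, e) 0 = 0 := fun e => by simp
  have hs : ∀ (r : Fin (n + 1)) (e : Perm (Fin n)), Perm.decomposeFin.symm (r, e) =
      swap 0 r * Perm.decomposeFin.symm (0, e) := by
    intro r e
    ext x
    refine Fin.cases ?_ (fun y => ?_) x
    · simp
    · simp
  by_cases hp : p = 0
  · subst hp
    exact ⟨Equiv.refl _, fun e => by rw [hs q, Equiv.refl_apply]⟩
  by_cases hq : q = 0
  · subst hq
    refine ⟨Equiv.refl _, fun e => ?_⟩
    rw [hs p, ← mul_assoc, swap_comm p 0, swap_mul_self, one_mul, Equiv.refl_apply]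
  obtain ⟨p', rfl⟩ := Fin.exists_succ_eq_of_ne_zero hp
  obtain ⟨q', rfl⟩ := Fin.exists_succ_eq_of_ne_zero hq
  refine ⟨Equiv.mulLeft (swap p' q'), fun e => ?_⟩
  ext x
  refine Fin.cases ?_ (fun y => ?_) x
  · simp
  · simp only [Equiv.coe_mulLeft, Perm.decomposeFin_symm_apply_succ, Perm.coe_mul,
      Function.comp_apply]
    congr 1
    simp only [swap_apply_def, Fin.ext_iff]
    grind

/-- The bounded-differences inequality for random permutations. -/
theorem perm_mgf_fin (n : ℕ) (f : Perm (Fin n) → ℝ)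
    (hf : ∀ a b π, f (swap a b * π) ≤ f π + 2) (s : ℝ) :
    ∑ π, Real.exp (s * (f π - (∑ τ, f τ) / (n.factorial : ℝ))) ≤
      n.factorial * Real.exp (s ^ 2 * n / 2) := by
  induction n with
  | zero => simp
  | succ n ih =>
    set F : Fin (n + 1) → Perm (Fin n) → ℝ := fun p e => f (Perm.decomposeFin.symm (p, e)) with hF
    set g : Fin (n + 1) → ℝ := fun p => (∑ e, F p e) / (n.factorial : ℝ) with hg
    have hsum : ∀ h : Perm (Fin (n + 1)) → ℝ,
        ∑ π, h π = ∑ p, ∑ e, h (Perm.decomposeFin.symm (p, e)) := by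
      intro h
      rw [← Equiv.sum_comp (Perm.decomposeFin (n := n)).symm h]
      exact Fintype.sum_prod_type _
    have hn0 : (0 : ℝ) < n.factorial := by exact_mod_cast n.factorial_pos
    have hmean : (∑ τ, f τ) / ((n + 1).factorial : ℝ) = ∑ p, 1 / ((n : ℝ) + 1) * g p := by
      rw [hsum, ← Finset.mul_sum, hg, ← Finset.sum_div, Nat.factorial_succ]
      push_cast
      field_simp
      rfl
    set m := ∑ p, 1 / ((n : ℝ) + 1) * g p with hm
    rw [hsum, hmean]
    have hinner : ∀ p, ∑ e, Real.exp (s * (F p e - m)) ≤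
        Real.exp (s * (g p - m)) * (n.factorial * Real.exp (s ^ 2 * n / 2)) := by
      intro p
      -- A transposition acting on the smaller permutation is conjugated by `swap 0 p` into a
      -- transposition of the full one, so the hypothesis is inherited.
      have h := ih (F p) (fun a b e => by
        have h1 := hf (swap 0 p a.succ) (swap 0 p b.succ) (Perm.decomposeFin.symm (p, e))
        convert h1 using 2
        ext x
        rw [swap_apply_apply]
        refine Fin.cases ?_ (fun y => ?_) x
        · simp only [Perm.decomposeFin_symm_apply_zero, Perm.coe_mul, Function.comp_apply]
          simp [swap_apply_def, Fin.ext_iff]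
        · simp only [Perm.decomposeFin_symm_apply_succ, Perm.coe_mul, Function.comp_apply,
            swap_inv, swap_apply_self]
          congr 2
          simp only [swap_apply_def, Fin.ext_iff]
          grind)
      calc ∑ e, Real.exp (s * (F p e - m))
          = Real.exp (s * (g p - m)) * ∑ e, Real.exp (s * (F p e - g p)) := by
            rw [Finset.mul_sum]
            refine Finset.sum_congr rfl fun e _ => ?_
            rw [← Real.exp_add]
            ring_nf
        _ ≤ _ := mul_le_mul_of_nonneg_left h (Real.exp_pos _).le
    -- Revealing one more value moves the conditional mean within a range of 2, so each step
    -- contributes a factor exp(s²·2²/8) = exp(s²/2).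
    have hrange : ∀ p q, g p - g q ≤ 2 := by
      intro p q
      obtain ⟨φ, hφ⟩ := exists_decomposeFin_swap_mul p q
      rw [hg, ← sub_div, div_le_iff₀ hn0, sub_le_iff_le_add, ← Equiv.sum_comp φ (F q)]
      have hc : (2 : ℝ) * n.factorial = ∑ _e : Perm (Fin n), (2 : ℝ) := by
        simp [Fintype.card_perm, mul_comm]
      rw [hc, ← Finset.sum_add_distrib]
      refine Finset.sum_le_sum fun e _ => ?_
      simp only [hF, hφ]
      have h1 := hf p q (swap p q * Perm.decomposeFin.symm (p, e))
      rw [← mul_assoc, swap_mul_self, one_mul] at h1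
      linarith
    have houter := sum_mul_exp_le_of_range_le (fun _ : Fin (n + 1) => 1 / ((n : ℝ) + 1)) g
      (fun _ => by positivity) (by simp; field_simp) hrange s
    rw [← Finset.mul_sum, ← hm] at houter
    calc ∑ p, ∑ e, Real.exp (s * (F p e - m))
        ≤ ∑ p, Real.exp (s * (g p - m)) * (n.factorial * Real.exp (s ^ 2 * n / 2)) :=
          Finset.sum_le_sum fun p _ => hinner p
      _ = (n + 1) * n.factorial * Real.exp (s ^ 2 * n / 2) *
          (1 / ((n : ℝ) + 1) * ∑ p, Real.exp (s * (g p - m))) := by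
          rw [← Finset.sum_mul]
          field_simp
      _ ≤ (n + 1) * n.factorial * Real.exp (s ^ 2 * n / 2) * Real.exp (s ^ 2 * 2 ^ 2 / 8) := by
          gcongr
      _ = _ := by
          rw [mul_assoc, ← Real.exp_add, Nat.factorial_succ]
          push_cast
          ring_nf

variable {α : Type*} [Fintype α] [DecidableEq α]

theorem perm_mgf (f : Perm α → ℝ) (hf : ∀ a b π, f (swap a b * π) ≤ f π + 2) (s : ℝ) :
    ∑ π, Real.exp (s * (f π - (∑ τ, f τ) / ((Fintype.card α).factorial : ℝ))) ≤
      (Fintype.card α).factorial * Real.exp (s ^ 2 * Fintype.card α / 2) := by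
  set e := Fintype.equivFin α
  set Φ : Perm (Fin (Fintype.card α)) ≃ Perm α := e.symm.permCongr with hΦ
  have h := perm_mgf_fin (Fintype.card α) (fun π => f (Φ π)) (fun a b π => by
    have h1 := hf (e.symm a) (e.symm b) (Φ π)
    convert h1 using 2
    ext x
    simp only [hΦ, Equiv.permCongr_apply, Perm.coe_mul, Function.comp_apply, Equiv.symm_symm]
    simp only [swap_apply_def, EmbeddingLike.apply_eq_iff_eq]
    split_ifs <;> rfl) s
  rw [Equiv.sum_comp Φ f] at h
  rwa [Equiv.sum_comp Φ fun π => Real.exp (s * (f π - (∑ τ, f τ) /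
    ((Fintype.card α).factorial : ℝ)))] at h

/-- The bounded-differences inequality for random permutations. -/
theorem perm_upper_tail (f : Perm α → ℝ) (hf : ∀ a b π, f (swap a b * π) ≤ f π + 2)
    {ε t : ℝ} (hε : 0 < ε) (hα : 0 < Fintype.card α) (ht : 0 ≤ t)
    (ht2 : 2 * Fintype.card α * Real.log (1 / ε) ≤ t ^ 2) :
    (∑ π, if (∑ τ, f τ) / ((Fintype.card α).factorial : ℝ) + t < f π then (1 : ℝ) else 0) ≤
      ε * (Fintype.card α).factorial := by
  have hn : (0 : ℝ) < Fintype.card α := by exact_mod_cast hα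
  -- The parameter t/n minimises s²n/2 - st, with minimum -t²/(2n).
  have h1 := sum_ite_le_exp_mul (fun _ : Perm α => (1 : ℝ))
    (fun π => f π - (∑ τ, f τ) / ((Fintype.card α).factorial : ℝ)) (fun _ => zero_le_one) t
    (s := t / Fintype.card α) (by positivity)
  have h2 := perm_mgf f hf (t / Fintype.card α)
  simp only [lt_sub_iff_add_lt', one_mul] at h1
  refine h1.trans ((mul_le_mul_of_nonneg_left h2 (Real.exp_pos _).le).trans ?_)
  rw [mul_left_comm, ← Real.exp_add, mul_comm]
  refine mul_le_mul_of_nonneg_right ?_ (Nat.cast_nonneg _)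
  refine (Real.exp_le_exp.mpr (?_ : _ ≤ -Real.log (1 / ε))).trans_eq (exp_neg_log_inv hε)
  have : -(t / Fintype.card α * t) + (t / Fintype.card α) ^ 2 * Fintype.card α / 2 =
      -(t ^ 2 / (2 * Fintype.card α)) := by
    field_simp
    ring
  rw [this, neg_le_neg_iff, le_div_iff₀ (by positivity)]
  linarith

theorem perm_lower_tail (f : Perm α → ℝ) (hf : ∀ a b π, f (swap a b * π) ≤ f π + 2)
    {ε t : ℝ} (hε : 0 < ε) (hα : 0 < Fintype.card α) (ht : 0 ≤ t)
    (ht2 : 2 * Fintype.card α * Real.log (1 / ε) ≤ t ^ 2) :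
    (∑ π, if f π < (∑ τ, f τ) / ((Fintype.card α).factorial : ℝ) - t then (1 : ℝ) else 0) ≤
      ε * (Fintype.card α).factorial := by
  have h := perm_upper_tail (fun π => -f π) (fun a b π => by
    have h1 := hf a b (swap a b * π)
    rw [← mul_assoc, swap_mul_self, one_mul] at h1
    linarith) hε hα ht ht2
  refine le_trans (Finset.sum_le_sum fun π _ => ?_) h
  rw [Finset.sum_neg_distrib, neg_div]
  split_ifs with h1 h2 h2
  · exact le_rfl
  · exact absurd (by linarith) h2
  · exact zero_le_one
  · exact le_rfl

/-- Under a random permutation, the image of a fixed `b`-subset is a uniform `b`-subset. -/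
theorem sum_map_perm_mul_choose (B : Finset α) (F : Finset α → ℝ) :
    (∑ π : Perm α, F (B.map π.toEmbedding)) * ((Fintype.card α).choose B.card : ℝ) =
      (Fintype.card α).factorial * ∑ C ∈ Finset.univ.powersetCard B.card, F C := by
  have h1 : ∀ C ∈ (Finset.univ : Finset α).powersetCard B.card,
      ∑ π : Perm α, F (C.map π.toEmbedding) = ∑ π : Perm α, F (B.map π.toEmbedding) := by
    intro C hC
    have hcard : C.card = B.card := (Finset.mem_powersetCard.mp hC).2
    obtain ⟨τ, hτ⟩ : ∃ τ : Perm α, B.map τ.toEmbedding = C := by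
      have e : {x // x ∈ B} ≃ {x // x ∈ C} := Finset.equivOfCardEq hcard.symm
      refine ⟨e.extendSubtype, Finset.eq_of_subset_of_card_le ?_ (by simp [hcard])⟩
      intro x hx
      obtain ⟨y, hy, rfl⟩ := Finset.mem_map.mp hx
      exact e.extendSubtype_mem y hy
    rw [← Equiv.sum_comp (Equiv.mulRight τ) fun π : Perm α => F (B.map π.toEmbedding)]
    refine Finset.sum_congr rfl fun π _ => ?_
    rw [← hτ, Finset.map_map]
    rfl
  have h2 : ∀ π : Perm α, ∑ C ∈ Finset.univ.powersetCard B.card, F (C.map π.toEmbedding) =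
      ∑ C ∈ Finset.univ.powersetCard B.card, F C := by
    intro π
    refine Finset.sum_bij' (fun C _ => C.map π.toEmbedding) (fun C _ => C.map π.symm.toEmbedding)
      ?_ ?_ ?_ ?_ ?_
    · intro C hC
      simpa [Finset.mem_powersetCard] using hC
    · intro C hC
      simpa [Finset.mem_powersetCard] using hC
    · intro C _
      ext x; simp
    · intro C _
      ext x; simp
    · intro C _
      rfl
  have h3 : ∑ C ∈ (Finset.univ : Finset α).powersetCard B.card,
      ∑ π : Perm α, F (C.map π.toEmbedding) =
      ((Fintype.card α).choose B.card : ℝ) * ∑ π : Perm α, F (B.map π.toEmbedding) := by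
    rw [Finset.sum_congr rfl h1, Finset.sum_const, Finset.card_powersetCard, nsmul_eq_mul,
      Finset.card_univ]
  rw [mul_comm, ← h3, Finset.sum_comm]
  simp only [h2]
  simp [Fintype.card_perm]

end Permutations

/-! ### Sampling without replacement -/

section Serfling

variable {α : Type*} [DecidableEq α]

/-- Double counting of pairs of a sample and one of its elements: a sample of size `n + 1` is a
first draw followed by a sample of size `n` from the rest. -/
theorem succ_mul_sum_powersetCard (s : Finset α) (n : ℕ) (F : Finset α → ℝ) :
    ((n : ℝ) + 1) * ∑ C ∈ s.powersetCard (n + 1), F C =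
      ∑ x ∈ s, ∑ C ∈ (s.erase x).powersetCard n, F (insert x C) := by
  have h1 : ((n : ℝ) + 1) * ∑ C ∈ s.powersetCard (n + 1), F C =
      ∑ C ∈ s.powersetCard (n + 1), ∑ _x ∈ C, F C := by
    rw [Finset.mul_sum]
    refine Finset.sum_congr rfl fun C hC => ?_
    rw [Finset.sum_const, nsmul_eq_mul, (Finset.mem_powersetCard.mp hC).2]
    push_cast; rfl
  rw [h1, Finset.sum_sigma', Finset.sum_sigma']
  refine Finset.sum_bij' (fun p _ => ⟨p.2, p.1.erase p.2⟩) (fun p _ => ⟨insert p.1 p.2, p.1⟩)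
    ?_ ?_ ?_ ?_ ?_
  · rintro ⟨C, x⟩ h
    simp only [Finset.mem_sigma, Finset.mem_powersetCard] at h ⊢
    refine ⟨h.1.1 h.2, Finset.erase_subset_erase _ h.1.1, ?_⟩
    rw [Finset.card_erase_of_mem h.2, h.1.2, Nat.add_sub_cancel]
  · rintro ⟨x, C⟩ h
    simp only [Finset.mem_sigma, Finset.mem_powersetCard] at h ⊢
    have hx : x ∉ C := fun hx => by simpa using h.2.1 hx
    refine ⟨⟨?_, ?_⟩, Finset.mem_insert_self _ _⟩
    · exact Finset.insert_subset h.1 (h.2.1.trans (Finset.erase_subset _ _))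
    · rw [Finset.card_insert_of_notMem hx, h.2.2]
  · rintro ⟨C, x⟩ h
    simp only [Finset.mem_sigma] at h
    simp [Finset.insert_erase h.2]
  · rintro ⟨x, C⟩ h
    simp only [Finset.mem_sigma, Finset.mem_powersetCard] at h
    have hx : x ∉ C := fun hx => by simpa using h.2.1 hx
    simp [Finset.erase_insert hx]
  · rintro ⟨C, x⟩ h
    simp only [Finset.mem_sigma] at h
    simp [Finset.insert_erase h.2]

/-- Serfling's martingale: reveal the sample one draw at a time. When i + 1 elements remain, of
which `k` will stay unsampled, the conditional mean moves within a range k/i, so Hoeffding's lemma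
contributes t²k²/(8i²). -/
theorem serfling_mgf (E : Finset α) (t : ℝ) {k : ℕ} (hk : 0 < k) (n : ℕ) (s : Finset α)
    (hs : s.card = n + k) :
    ∑ C ∈ s.powersetCard n, Real.exp (t * ((C ∩ E).card : ℝ)) ≤
      ((n + k).choose n : ℝ) * Real.exp (t * (n * ((s ∩ E).card : ℝ) / ((n : ℝ) + k)) +
        t ^ 2 / 8 * (k ^ 2 * ∑ i ∈ Finset.Ico k (n + k), 1 / (i : ℝ) ^ 2)) := by
  induction n generalizing s with
  | zero => simp
  | succ n ih =>
    have hkR : (0 : ℝ) < k := by exact_mod_cast hk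
    set e : ℝ := ((s ∩ E).card : ℝ) with he
    set o : α → ℝ := fun x => if x ∈ E then 1 else 0 with ho
    set Q : ℝ := t ^ 2 / 8 * (k ^ 2 * ∑ i ∈ Finset.Ico k (n + k), 1 / (i : ℝ) ^ 2) with hQ
    -- The conditional mean of the count given the first draw `x`. It depends on `x` only through `o
    -- x`, with slope k/(n+k).
    set y : α → ℝ := fun x => o x + n * (e - o x) / ((n : ℝ) + k) with hy
    have hoe : ∑ x ∈ s, o x = e := by
      simp only [ho, he]
      rw [← Finset.sum_filter, Finset.sum_const, nsmul_eq_mul, mul_one, Finset.filter_mem_eq_inter]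
    have hstep : ∀ x ∈ s, ∑ C ∈ (s.erase x).powersetCard n,
        Real.exp (t * ((insert x C ∩ E).card : ℝ)) ≤
        ((n + k).choose n : ℝ) * Real.exp Q * Real.exp (t * y x) := by
      intro x hx
      have h := ih (s.erase x) (by rw [Finset.card_erase_of_mem hx, hs]; omega)
      have hcard : (((s.erase x) ∩ E).card : ℝ) = e - o x := by
        simp only [he, ho, Finset.erase_inter]
        split_ifs with hE
        · rw [Finset.card_erase_of_mem (Finset.mem_inter.2 ⟨hx, hE⟩), Nat.cast_sub
            (Finset.card_pos.2 ⟨x, Finset.mem_inter.2 ⟨hx, hE⟩⟩)]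
          simp
        · rw [Finset.erase_eq_of_notMem (fun h => hE (Finset.mem_inter.1 h).2), sub_zero]
      rw [hcard] at h
      have h2 : ∀ C ∈ (s.erase x).powersetCard n, Real.exp (t * ((insert x C ∩ E).card : ℝ)) =
          Real.exp (t * o x) * Real.exp (t * ((C ∩ E).card : ℝ)) := by
        intro C hC
        have hxC : x ∉ C := fun h => by
          simpa using (Finset.mem_powersetCard.mp hC).1 h
        rw [← Real.exp_add, ← mul_add]
        congr 2
        simp only [ho]
        split_ifs with hE
        · rw [Finset.insert_inter_of_mem hE, Finset.card_insert_of_notMem (fun h => hxC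
            (Finset.mem_inter.1 h).1)]
          push_cast; ring
        · rw [Finset.insert_inter_of_notMem hE]; ring
      rw [Finset.sum_congr rfl h2, ← Finset.mul_sum]
      refine (mul_le_mul_of_nonneg_left h (Real.exp_pos _).le).trans_eq ?_
      rw [mul_left_comm, mul_assoc, ← Real.exp_add, ← Real.exp_add]
      simp only [hy]
      ring_nf
    have hN : (0 : ℝ) < (n : ℝ) + 1 + k := by positivity
    have hNk : (0 : ℝ) < (n : ℝ) + k := by positivity
    have hsR : (s.card : ℝ) = (n : ℝ) + 1 + k := by rw [hs]; push_cast; ring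
    have hyo : ∀ x, y x = n * e / ((n : ℝ) + k) + o x * (k / ((n : ℝ) + k)) := by
      intro x
      simp only [hy]
      field_simp
      ring
    have hmean : ∑ x : s, 1 / ((n : ℝ) + 1 + k) * y x = (n + 1) * e / ((n : ℝ) + 1 + k) := by
      rw [← Finset.mul_sum, Finset.sum_coe_sort s y]
      simp only [hyo]
      rw [Finset.sum_add_distrib, ← Finset.sum_mul, hoe, Finset.sum_const, nsmul_eq_mul, hsR]
      field_simp
      ring
    have hH := sum_mul_exp_le_of_range_le (fun _ : s => 1 / ((n : ℝ) + 1 + k)) (fun x => y x)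
      (fun _ => by positivity) (by
        rw [Finset.sum_const, Finset.card_univ, Fintype.card_coe, nsmul_eq_mul, hsR]
        field_simp) (c := k / ((n : ℝ) + k)) (fun a b => by
        simp only [hyo]
        have h1 : o a - o b ≤ 1 := by simp only [ho]; split_ifs <;> norm_num
        have h2 : 0 ≤ k / ((n : ℝ) + k) := by positivity
        nlinarith) t
    rw [hmean, ← Finset.mul_sum, Finset.sum_coe_sort s fun x => Real.exp (t * (y x -
      (n + 1) * e / ((n : ℝ) + 1 + k)))] at hH
    have hsumy : ∑ x ∈ s, Real.exp (t * y x) ≤ ((n : ℝ) + 1 + k) *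
        Real.exp (t * ((n + 1) * e / ((n : ℝ) + 1 + k)) + t ^ 2 * (k / ((n : ℝ) + k)) ^ 2 / 8) := by
      rw [Real.exp_add]
      have h1 : ∑ x ∈ s, Real.exp (t * y x) = Real.exp (t * ((n + 1) * e / ((n : ℝ) + 1 + k))) *
          ∑ x ∈ s, Real.exp (t * (y x - (n + 1) * e / ((n : ℝ) + 1 + k))) := by
        rw [Finset.mul_sum]
        refine Finset.sum_congr rfl fun x _ => ?_
        rw [← Real.exp_add]; ring_nf
      rw [h1, mul_left_comm]
      refine mul_le_mul_of_nonneg_left ?_ (Real.exp_pos _).le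
      rw [one_div, inv_mul_le_iff₀ hN] at hH
      exact hH
    have hrec := succ_mul_sum_powersetCard s n fun C => Real.exp (t * ((C ∩ E).card : ℝ))
    have hchoose : ((n : ℝ) + 1 + k) * ((n + k).choose n : ℝ) =
        ((n + 1 + k).choose (n + 1) : ℝ) * (n + 1) := by
      have := Nat.add_one_mul_choose_eq (n + k) n
      rw [show n + k + 1 = n + 1 + k by ring] at this
      exact_mod_cast this
    have hfin : ((n : ℝ) + 1) * ∑ C ∈ s.powersetCard (n + 1), Real.exp (t * ((C ∩ E).card : ℝ)) ≤
        ((n : ℝ) + 1) * (((n + 1 + k).choose (n + 1) : ℝ) *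
          Real.exp (t * ((n + 1) * e / ((n : ℝ) + 1 + k)) +
        t ^ 2 / 8 * (k ^ 2 * ∑ i ∈ Finset.Ico k (n + 1 + k), 1 / (i : ℝ) ^ 2))) := by
      rw [hrec]
      calc _ ≤ ∑ x ∈ s, ((n + k).choose n : ℝ) * Real.exp Q * Real.exp (t * y x) :=
            Finset.sum_le_sum hstep
        _ = ((n + k).choose n : ℝ) * Real.exp Q * ∑ x ∈ s, Real.exp (t * y x) := by
            rw [Finset.mul_sum]
        _ ≤ ((n + k).choose n : ℝ) * Real.exp Q * _ :=
            mul_le_mul_of_nonneg_left hsumy (by positivity)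
        _ = (((n : ℝ) + 1 + k) * ((n + k).choose n : ℝ)) *
          Real.exp (Q + (t * ((n + 1) * e / ((n : ℝ) + 1 + k)) +
            t ^ 2 * (k / ((n : ℝ) + k)) ^ 2 / 8)) := by rw [Real.exp_add Q]; ring
        _ = _ := by
          rw [hchoose, show n + 1 + k = n + k + 1 by ring, Finset.sum_Ico_succ_top (by omega), hQ]
          push_cast
          rw [mul_comm _ ((n : ℝ) + 1), mul_assoc]
          congr 3
          field_simp
          ring
    have := le_of_mul_le_mul_left hfin (by positivity)
    push_cast
    exact this

/-- Each new term k²/(n+k)² is at most the increment k(k+1)/((n+k)(n+k+1)) of the right-hand side.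
-/
theorem sum_Ico_one_div_sq_le {k : ℕ} (hk : 0 < k) (n : ℕ) :
    (k : ℝ) ^ 2 * ∑ i ∈ Finset.Ico k (n + k), 1 / (i : ℝ) ^ 2 ≤ n * (k + 1) / ((n : ℝ) + k) := by
  have hkR : (0 : ℝ) < k := by exact_mod_cast hk
  induction n with
  | zero => simp
  | succ n ih =>
    rw [show n + 1 + k = n + k + 1 by ring, Finset.sum_Ico_succ_top (by omega), mul_add]
    have h : (n : ℝ) * (k + 1) / ((n : ℝ) + k) + (k : ℝ) ^ 2 * (1 / ((n + k : ℕ) : ℝ) ^ 2) ≤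
        ((n + 1 : ℕ) : ℝ) * (k + 1) / (((n + 1 : ℕ) : ℝ) + k) := by
      push_cast
      rw [mul_one_div, div_add_div _ _ (by positivity) (by positivity), div_le_div_iff₀
        (by positivity) (by positivity)]
      have hn : (0 : ℝ) ≤ n := Nat.cast_nonneg n
      have : (n + 1) * ((k : ℝ) + 1) * ((n + k) * (n + k) ^ 2) -
        (n * (k + 1) * (n + k) ^ 2 + (n + k) * k ^ 2) * (n + 1 + k) = k * n * (n + k) := by ring
      nlinarith [mul_nonneg (mul_nonneg hkR.le hn) (add_nonneg hn hkR.le)]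
    linarith

open Equiv in
-- When the two samples exhaust the population, the counts in them have a fixed sum, so the
-- difference of rates is N/(nk) times the deviation of one count from its mean. A gap ν becomes a
-- deviation nkν/N.
theorem serfling_tail_compl [Fintype α] (A E : Finset α) {n k : ℕ} (hA : A.card = n)
    (hcard : Fintype.card α = n + k) (hn : 0 < n) (hk : 0 < k) {ε : ℝ} (hε : 0 < ε)
    (hL : 0 ≤ Real.log (1 / ε)) :
    (∑ π : Perm α, if (((Aᶜ).filter fun x => π x ∈ E).card : ℝ) / k + nu n k ε <
        ((A.filter fun x => π x ∈ E).card : ℝ) / n then (1 : ℝ) else 0) ≤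
      ε * (Fintype.card α).factorial := by
  have hnR : (0 : ℝ) < n := by exact_mod_cast hn
  have hkR : (0 : ℝ) < k := by exact_mod_cast hk
  set N : ℝ := (n : ℝ) + k with hN
  have hN0 : 0 < N := by positivity
  set e : ℝ := (E.card : ℝ) with he
  set T : ℝ := n * k / N * nu n k ε with hT
  have hnu : nu n k ε ^ 2 = (N * (k + 1)) / (2 * n * k ^ 2) * Real.log (1 / ε) := by
    rw [nu, Real.sq_sqrt (by positivity)]
  have hT0 : 0 ≤ T := mul_nonneg (by positivity) (Real.sqrt_nonneg _)
  have hT2 : T ^ 2 = n * (k + 1) / (2 * N) * Real.log (1 / ε) := by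
    rw [hT, mul_pow, hnu]
    field_simp
  set a : Perm α → ℝ := fun π => ((A.filter fun x => π x ∈ E).card : ℝ) with ha
  have hsum : ∀ π : Perm α, (((Aᶜ).filter fun x => π x ∈ E).card : ℝ) = e - a π := by
    intro π
    rw [eq_sub_iff_add_eq, ha, he]
    have h1 : (Finset.univ.filter fun x => π x ∈ E).card = E.card := by
      refine Finset.card_bij (fun x _ => π x) (by simp) (by simp) fun y hy => ⟨π.symm y, ?_⟩
      simpa using hy
    rw [← h1, ← Nat.cast_add, ← Finset.card_union_of_disjoint, ← Finset.filter_union]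
    · rw [Finset.union_comm, Finset.union_compl]
    · exact Finset.disjoint_filter_filter disjoint_compl_left
  have hev : ∀ π : Perm α, ((((Aᶜ).filter fun x => π x ∈ E).card : ℝ) / k + nu n k ε <
      a π / n) ↔ T < a π - n * e / N := by
    intro π
    rw [hsum]
    have h1 : a π / n - ((e - a π) / k) = N / (n * k) * (a π - n * e / N) := by
      field_simp
      rw [hN]; ring
    have h2 : T = n * k / N * nu n k ε := hT
    have h3 : nu n k ε = N / (n * k) * T := by rw [h2]; field_simp
    have h4 : (0 : ℝ) < N / (n * k) := by positivity
    rw [← mul_lt_mul_iff_right₀ (c := a π - n * e / N) h4, ← h1, ← h3]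
    constructor <;> intro h <;> linarith
  refine (Finset.sum_congr rfl fun π _ => if_congr (hev π) rfl rfl).trans_le ?_
  set V : ℝ := n * (k + 1) / N with hV
  have hV0 : 0 < V := by positivity
  have hs0 : 0 ≤ 4 * T / V := by positivity
  refine (sum_ite_le_exp_mul (fun _ : Perm α => (1 : ℝ)) (fun π => a π - n * e / N)
    (fun _ => zero_le_one) T hs0).trans ?_
  -- This minimises s²V/8 - sT; the minimum -2T²/V is -log (1/ε), because ν was chosen so that T² =
  -- V/2 · log (1/ε).
  set s := 4 * T / V with hs
  have hm := sum_map_perm_mul_choose A fun C => Real.exp (s * ((C ∩ E).card : ℝ))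
  have hcardmap : ∀ π : Perm α, (((A.map π.toEmbedding) ∩ E).card : ℝ) = a π := by
    intro π
    rw [← Finset.filter_mem_eq_inter, Finset.filter_map, Finset.card_map]
    rfl
  simp only [hcardmap] at hm
  rw [hA, hcard] at hm
  have hS := serfling_mgf E s hk n Finset.univ (by rw [Finset.card_univ, hcard])
  rw [Finset.univ_inter] at hS
  have hch : (0 : ℝ) < ((n + k).choose n : ℝ) := by
    exact_mod_cast Nat.choose_pos (by omega)
  have hmgf : ∑ π, Real.exp (s * a π) ≤ (n + k).factorial *
      Real.exp (s * (n * e / N) + s ^ 2 / 8 * V) := by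
    rw [← mul_le_mul_iff_left₀ hch, hm, mul_assoc]
    refine mul_le_mul_of_nonneg_left (hS.trans ?_) (Nat.cast_nonneg _)
    rw [mul_comm]
    refine mul_le_mul_of_nonneg_right (Real.exp_le_exp.mpr ?_) hch.le
    have := sum_Ico_one_div_sq_le hk n
    gcongr
  have hfac : ∑ π : Perm α, 1 * Real.exp (s * (a π - n * e / N)) =
      Real.exp (-(s * (n * e / N))) * ∑ π, Real.exp (s * a π) := by
    rw [Finset.mul_sum]
    refine Finset.sum_congr rfl fun π _ => ?_
    rw [one_mul, ← Real.exp_add]; ring_nf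
  rw [hfac, hcard]
  calc _ ≤ Real.exp (-(s * T)) * (Real.exp (-(s * (n * e / N))) * ((n + k).factorial *
      Real.exp (s * (n * e / N) + s ^ 2 / 8 * V))) := by gcongr
    _ = Real.exp (s ^ 2 / 8 * V - s * T) * (n + k).factorial := by
      rw [mul_left_comm _ ((n + k).factorial : ℝ), ← Real.exp_add, mul_left_comm, ← Real.exp_add,
        mul_comm]
      ring_nf
    _ = ε * (n + k).factorial := by
      congr 1
      conv_rhs => rw [← exp_neg_log_inv hε]
      congr 1
      have : T ^ 2 = V / 2 * Real.log (1 / ε) := by rw [hT2, hV]; field_simp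
      rw [hs]
      field_simp
      nlinarith

open Equiv in
/-- Serfling's inequality for two disjoint random samples. -/
theorem serfling_tail [Fintype α] (A B E : Finset α) (hAB : Disjoint A B) (hA : 0 < A.card)
    (hB : 0 < B.card) {ε : ℝ} (hε : 0 < ε) (hL : 0 ≤ Real.log (1 / ε)) :
    (∑ π : Perm α, if ((B.filter fun x => π x ∈ E).card : ℝ) / B.card + nu A.card B.card ε <
        ((A.filter fun x => π x ∈ E).card : ℝ) / A.card then (1 : ℝ) else 0) ≤
      ε * (Fintype.card α).factorial := by
  set U := A ∪ B with hU
  have hcU : Fintype.card U = A.card + B.card := by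
    rw [Fintype.card_coe, hU, Finset.card_union_of_disjoint hAB]
  -- An extra random permutation of `A ∪ B` alone reduces to the case where `B` is the complement of
  -- `A`.
  have key := sum_sum_mul_right (fun τ : Perm U => (Perm.ofSubtype τ : Perm α))
    fun π => if ((B.filter fun x => π x ∈ E).card : ℝ) / B.card + nu A.card B.card ε <
        ((A.filter fun x => π x ∈ E).card : ℝ) / A.card then (1 : ℝ) else 0
  have hinner : ∀ π : Perm α, (∑ τ : Perm U,
      if ((B.filter fun x => (π * Perm.ofSubtype τ) x ∈ E).card : ℝ) / B.card +
        nu A.card B.card ε < ((A.filter fun x => (π * Perm.ofSubtype τ) x ∈ E).card : ℝ) / A.card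
      then (1 : ℝ) else 0) ≤ ε * (Fintype.card U).factorial := by
    intro π
    set A' : Finset U := A.subtype (· ∈ U) with hA'
    set E' : Finset U := Finset.univ.filter fun x => π x ∈ E with hE'
    have hcount : ∀ (D : Finset α) (D' : Finset U) (τ : Perm U),
        D'.map (Function.Embedding.subtype _) = D →
        (D.filter fun x => (π * Perm.ofSubtype τ) x ∈ E).card =
        (D'.filter fun x => τ x ∈ E').card := by
      rintro D D' τ rfl
      rw [Finset.filter_map, Finset.card_map]
      congr 1
      ext x
      refine Finset.mem_filter.trans ?_
      have hx : (π * Perm.ofSubtype τ) (x : α) = π (τ x) :=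
        congrArg π (Perm.ofSubtype_apply_coe τ x)
      simp only [hE', Finset.mem_filter, Finset.mem_univ, true_and, ← hx]
      rfl
    have hAm : A'.map (Function.Embedding.subtype _) = A := by
      rw [hA', Finset.subtype_map, Finset.filter_true_of_mem]
      exact fun x hx => Finset.mem_union_left _ hx
    have hBm : A'ᶜ.map (Function.Embedding.subtype _) = B := by
      ext x
      simp only [hA', Finset.mem_map, Finset.mem_compl, Finset.mem_subtype,
        Function.Embedding.coe_subtype, Subtype.exists, exists_and_left, exists_prop,
        exists_eq_right_right]
      constructor
      · rintro ⟨h1, h2⟩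
        exact (Finset.mem_union.mp h2).resolve_left h1
      · exact fun h => ⟨fun hA => Finset.disjoint_left.mp hAB hA h, Finset.mem_union_right _ h⟩
    have hA'c : A'.card = A.card := by
      rw [← Finset.card_map (Function.Embedding.subtype _), hAm]
    have h := serfling_tail_compl A' E' hA'c hcU hA hB hε hL
    simpa only [hcount B _ _ hBm, hcount A _ _ hAm] using h
  have h0 : (0 : ℝ) < Fintype.card (Perm U) := by exact_mod_cast Fintype.card_pos
  rw [← mul_le_mul_iff_right₀ h0, ← key]
  refine (Finset.sum_le_sum fun π _ => hinner π).trans_eq ?_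
  rw [Finset.sum_const, Finset.card_univ, nsmul_eq_mul, Fintype.card_perm, Fintype.card_perm]
  ring

end Serfling

/-! ### Blocks of a randomly ordered key -/

section Counting

open Equiv

variable {α : Type*} [DecidableEq α]

/-- The sets are disjoint, so at most one image contains `a` and at most one contains `b`; all
others are unchanged by the transposition. -/
theorem card_filter_swap_mul_le {M : ℕ} (B : ℕ → Finset α)
    (hB : ∀ i j, i ≠ j → Disjoint (B i) (B j)) (G : Finset α → Prop) [DecidablePred G] (a b : α)
    (π : Perm α) :
    ((Finset.range M).filter fun j => G ((B j).map (swap a b * π).toEmbedding)).card ≤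
      ((Finset.range M).filter fun j => G ((B j).map π.toEmbedding)).card + 2 := by
  have hone : ∀ x : α, ((Finset.range M).filter fun j => x ∈ (B j).map π.toEmbedding).card ≤ 1 := by
    intro x
    refine Finset.card_le_one.mpr fun i hi j hj => ?_
    by_contra hij
    have h := (Finset.disjoint_map π.toEmbedding).mpr (hB i j hij)
    exact Finset.disjoint_left.mp h (Finset.mem_filter.mp hi).2 (Finset.mem_filter.mp hj).2
  have hsub : ((Finset.range M).filter fun j => G ((B j).map (swap a b * π).toEmbedding)) ⊆
      (((Finset.range M).filter fun j => G ((B j).map π.toEmbedding)) ∪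
        ((Finset.range M).filter fun j => a ∈ (B j).map π.toEmbedding)) ∪
        ((Finset.range M).filter fun j => b ∈ (B j).map π.toEmbedding) := by
    intro j hj
    rw [Finset.mem_filter] at hj
    simp only [Finset.mem_union, Finset.mem_filter, hj.1, true_and]
    by_contra! hcon
    obtain ⟨⟨h1, h2⟩, h3⟩ := hcon
    apply h1
    convert hj.2 using 1
    rw [show (swap a b * π).toEmbedding = π.toEmbedding.trans (swap a b).toEmbedding from rfl,
      ← Finset.map_map]
    ext x
    constructor
    · intro hx
      refine Finset.mem_map.mpr ⟨x, hx, swap_apply_of_ne_of_ne ?_ ?_⟩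
      · rintro rfl; exact h2 hx
      · rintro rfl; exact h3 hx
    · intro hx
      obtain ⟨y, hy, rfl⟩ := Finset.mem_map.mp hx
      have : swap a b y = y := by
        refine swap_apply_of_ne_of_ne ?_ ?_
        · rintro rfl; exact h2 hy
        · rintro rfl; exact h3 hy
      simpa [this] using hy
  refine (Finset.card_le_card hsub).trans ((Finset.card_union_le _ _).trans ?_)
  have := Finset.card_union_le ((Finset.range M).filter fun j => G ((B j).map π.toEmbedding))
    ((Finset.range M).filter fun j => a ∈ (B j).map π.toEmbedding)
  have := hone a
  have := hone b
  omega

theorem card_powersetCard_filter_card_eq (A : Finset α) (p : α → Prop) [DecidablePred p]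
    {b k : ℕ} (hk : k ≤ b) :
    ((A.powersetCard b).filter fun C => (C.filter p).card = k).card =
      (A.filter p).card.choose k * (A.filter fun x => ¬ p x).card.choose (b - k) := by
  rw [← Finset.card_powersetCard, ← Finset.card_powersetCard, ← Finset.card_product]
  refine Finset.card_bij' (fun C _ => (C.filter p, C.filter fun x => ¬ p x))
    (fun D _ => D.1 ∪ D.2) ?_ ?_ ?_ ?_
  · intro C hC
    obtain ⟨h1, h2⟩ := Finset.mem_filter.mp hC
    obtain ⟨h3, h4⟩ := Finset.mem_powersetCard.mp h1
    refine Finset.mem_product.mpr ⟨Finset.mem_powersetCard.mpr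
      ⟨Finset.filter_subset_filter _ h3, h2⟩, Finset.mem_powersetCard.mpr
      ⟨Finset.filter_subset_filter _ h3, ?_⟩⟩
    have := Finset.card_filter_add_card_filter_not (s := C) p
    dsimp only
    omega
  · rintro ⟨D, E⟩ h
    simp only [Finset.mem_product, Finset.mem_powersetCard] at h
    obtain ⟨⟨h1, h2⟩, h3, h4⟩ := h
    have hp : ∀ x ∈ D, p x := fun x hx => (Finset.mem_filter.mp (h1 hx)).2
    have hq : ∀ x ∈ E, ¬ p x := fun x hx => (Finset.mem_filter.mp (h3 hx)).2
    have hd : Disjoint D E := Finset.disjoint_left.mpr fun x hx hx' => hq x hx' (hp x hx)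
    refine Finset.mem_filter.mpr ⟨Finset.mem_powersetCard.mpr ⟨Finset.union_subset
      (h1.trans (Finset.filter_subset _ _)) (h3.trans (Finset.filter_subset _ _)), ?_⟩, ?_⟩
    · rw [Finset.card_union_of_disjoint hd]
      omega
    · rw [Finset.filter_union, Finset.filter_true_of_mem hp, Finset.filter_false_of_mem hq,
        Finset.union_empty, h2]
  · intro C _
    exact Finset.filter_union_filter_not_eq p C
  · rintro ⟨D, E⟩ h
    simp only [Finset.mem_product, Finset.mem_powersetCard] at h
    obtain ⟨⟨h1, h2⟩, h3, h4⟩ := h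
    have hp : ∀ x ∈ D, p x := fun x hx => (Finset.mem_filter.mp (h1 hx)).2
    have hq : ∀ x ∈ E, ¬ p x := fun x hx => (Finset.mem_filter.mp (h3 hx)).2
    refine Prod.ext ?_ ?_
    · dsimp only
      rw [Finset.filter_union, Finset.filter_true_of_mem hp, Finset.filter_false_of_mem hq,
        Finset.union_empty]
    · dsimp only
      rw [Finset.filter_union, Finset.filter_false_of_mem (s := D) (fun x hx h => h (hp x hx)),
        Finset.filter_true_of_mem hq, Finset.empty_union]

end Counting

/-! ### Ranks, blocks, and the number of full blocks with a given property. -/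

namespace Run

open Equiv

variable {N : ℕ} (ω : Run N)

theorem ofSubtype_mem_key_iff (π : Perm ω.key) (i : Fin N) :
    Perm.ofSubtype π i ∈ ω.key ↔ i ∈ ω.key := by
  by_cases h : i ∈ ω.key
  · rw [Perm.ofSubtype_apply_of_mem π h]
    simp [h]
  · rw [Perm.ofSubtype_apply_of_not_mem π h]

/-- A permutation of the key maps the key to itself, so it only exchanges which position has which
rank. -/
theorem rank_mul_ofSubtype (σ : Perm (Fin N)) (π : Perm ω.key) (i : Fin N) :
    ω.rank (σ * Perm.ofSubtype π) i = ω.rank σ (Perm.ofSubtype π i) := by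
  unfold rank
  refine Finset.card_bij' (fun j _ => Perm.ofSubtype π j) (fun j _ => (Perm.ofSubtype π).symm j)
    ?_ ?_ ?_ ?_
  · intro j hj
    simp only [Finset.mem_filter] at hj ⊢
    rwa [ω.ofSubtype_mem_key_iff π]
  · intro j hj
    simp only [Finset.mem_filter] at hj ⊢
    rw [← ω.ofSubtype_mem_key_iff π]
    simpa using hj
  · intro j _; simp
  · intro j _; simp

theorem rank_lt_rank {σ : Perm (Fin N)} {i i' : Fin N} (hi : i ∈ ω.key) (h : σ i < σ i') :
    ω.rank σ i < ω.rank σ i' := by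
  refine Finset.card_lt_card (Finset.ssubset_iff_of_subset ?_ |>.mpr ⟨i, ?_, ?_⟩)
  · intro j hj
    simp only [Finset.mem_filter] at hj ⊢
    exact ⟨hj.1, hj.2.trans h⟩
  · simp [hi, h]
  · simp

theorem rank_injOn (σ : Perm (Fin N)) : Set.InjOn (ω.rank σ) ω.key := by
  intro i hi i' hi' h
  rcases lt_trichotomy (σ i) (σ i') with h1 | h1 | h1
  · exact absurd h (ω.rank_lt_rank hi h1).ne
  · exact σ.injective h1
  · exact absurd h (ω.rank_lt_rank hi' h1).ne'

theorem rank_lt_nK {σ : Perm (Fin N)} {i : Fin N} (hi : i ∈ ω.key) : ω.rank σ i < ω.nK := by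
  refine Finset.card_lt_card (Finset.filter_ssubset.mpr ⟨i, hi, ?_⟩)
  simp

theorem image_rank (σ : Perm (Fin N)) : ω.key.image (ω.rank σ) = Finset.range ω.nK := by
  refine Finset.eq_of_subset_of_card_le ?_ ?_
  · intro r hr
    obtain ⟨i, hi, rfl⟩ := Finset.mem_image.mp hr
    exact Finset.mem_range.mpr (ω.rank_lt_nK hi)
  · rw [Finset.card_image_of_injOn (ω.rank_injOn σ), Finset.card_range, nK]

theorem exists_rank_eq (σ : Perm (Fin N)) {r : ℕ} (hr : r < ω.nK) :
    ∃ i ∈ ω.key, ω.rank σ i = r := by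
  have : r ∈ ω.key.image (ω.rank σ) := by rw [image_rank]; exact Finset.mem_range.mpr hr
  simpa using this

theorem block_subset_key (b : ℕ) (σ : Perm (Fin N)) (j : ℕ) : ω.block b σ j ⊆ ω.key :=
  Finset.filter_subset _ _

theorem card_block {b : ℕ} (hb : 0 < b) (σ : Perm (Fin N)) {j : ℕ} (hj : j < ω.nK / b) :
    (ω.block b σ j).card = b := by
  -- Ranks fill 0, …, n_K - 1 without gaps, so a full block is an interval of `b` ranks.
  have h1 : (ω.block b σ j).image (ω.rank σ) = Finset.Ico (j * b) (j * b + b) := by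
    have hjb : j * b + b ≤ ω.nK := by
      have h := (Nat.le_div_iff_mul_le hb).mp (Nat.succ_le_of_lt hj)
      rwa [Nat.succ_eq_add_one, add_mul, one_mul] at h
    ext r
    simp only [block, Finset.mem_image, Finset.mem_filter, Finset.mem_Ico]
    constructor
    · rintro ⟨i, ⟨-, hi⟩, rfl⟩
      rw [Nat.div_eq_iff hb] at hi
      omega
    · intro hr
      obtain ⟨i, hi, rfl⟩ := ω.exists_rank_eq σ (r := r) (by omega)
      refine ⟨i, ⟨hi, ?_⟩, rfl⟩
      rw [Nat.div_eq_iff hb]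
      omega
  rw [← Finset.card_image_of_injOn ((ω.rank_injOn σ).mono (ω.block_subset_key b σ j)), h1]
  simp

theorem disjoint_block (b : ℕ) (σ : Perm (Fin N)) {i j : ℕ} (h : i ≠ j) :
    Disjoint (ω.block b σ i) (ω.block b σ j) := by
  refine Finset.disjoint_left.mpr fun x hx hx' => h ?_
  rw [← (Finset.mem_filter.mp hx).2, ← (Finset.mem_filter.mp hx').2]

/-- The inverse is taken so that blocks become images under `π`. A transposition multiplied to `π`
from the left then acts on these images, as `card_filter_swap_mul_le` requires. -/
theorem block_mul_ofSubtype_inv (b : ℕ) (σ : Perm (Fin N)) (π : Perm ω.key) (j : ℕ) :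
    ω.block b (σ * Perm.ofSubtype π⁻¹) j =
      (((ω.block b σ j).subtype (· ∈ ω.key)).map π.toEmbedding).map
        (Function.Embedding.subtype _) := by
  ext i
  simp only [block, Finset.mem_filter, rank_mul_ofSubtype, Finset.mem_map, Finset.mem_subtype,
    Function.Embedding.subtype_apply, Equiv.coe_toEmbedding]
  constructor
  · rintro ⟨hi, h⟩
    rw [Perm.ofSubtype_apply_of_mem _ hi] at h
    exact ⟨⟨i, hi⟩, ⟨π⁻¹ ⟨i, hi⟩, ⟨Subtype.prop _, h⟩, by simp⟩, rfl⟩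
  · rintro ⟨x, ⟨y, ⟨hy, h⟩, rfl⟩, rfl⟩
    refine ⟨Subtype.prop _, ?_⟩
    rw [Perm.ofSubtype_apply_coe]
    simpa using h

/-- The number of full blocks with a given property. -/
def blockCount (b : ℕ) (G : Finset (Fin N) → Prop) [DecidablePred G] (σ : Perm (Fin N)) : ℕ :=
  ((Finset.range (ω.nK / b)).filter fun j => G (ω.block b σ j)).card

section Count

variable (b : ℕ) (G : Finset (Fin N) → Prop) [DecidablePred G]

theorem blockCount_le (σ : Perm (Fin N)) : ω.blockCount b G σ ≤ ω.nK / b :=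
  (Finset.card_filter_le _ _).trans (Finset.card_range _).le

theorem card_key_coe : Fintype.card ω.key = ω.nK := by
  rw [Fintype.card_coe, nK]

theorem blockCount_mul (σ : Perm (Fin N)) (π : Perm ω.key) :
    ω.blockCount b G (σ * Perm.ofSubtype π⁻¹) =
      ((Finset.range (ω.nK / b)).filter fun j => (fun C : Finset ω.key =>
        G (C.map (Function.Embedding.subtype _)))
          (((ω.block b σ j).subtype (· ∈ ω.key)).map π.toEmbedding)).card := by
  simp only [blockCount, block_mul_ofSubtype_inv]

theorem blockCount_swap_le (σ : Perm (Fin N)) (x y : ω.key) (π : Perm ω.key) :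
    (ω.blockCount b G (σ * Perm.ofSubtype (swap x y * π)⁻¹) : ℝ) ≤
      ω.blockCount b G (σ * Perm.ofSubtype π⁻¹) + 2 := by
  rw [blockCount_mul, blockCount_mul]
  have h := card_filter_swap_mul_le (M := ω.nK / b)
    (fun j => (ω.block b σ j).subtype (· ∈ ω.key)) (fun i j hij => by
      refine Finset.disjoint_left.mpr fun x hx hx' => ?_
      rw [Finset.mem_subtype] at hx hx'
      exact Finset.disjoint_left.mp (ω.disjoint_block b σ hij) hx hx')
    (fun C : Finset ω.key => G (C.map (Function.Embedding.subtype _))) x y π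
  exact_mod_cast h

/-- The mean of `blockCount`. -/
noncomputable def blockMean : ℝ :=
  ((ω.nK / b : ℕ) : ℝ) * (((ω.key.powersetCard b).filter G).card / (ω.nK.choose b : ℝ))

variable {b}

/-- Already for a fixed `σ`, a random permutation of the key alone makes every full block a uniform
`b`-subset of the key; the mean follows by linearity. -/
theorem sum_blockCount_mul (hb : 0 < b) (σ : Perm (Fin N)) :
    (∑ π : Perm ω.key, (ω.blockCount b G (σ * Perm.ofSubtype π⁻¹) : ℝ)) /
      ((Fintype.card ω.key).factorial : ℝ) = ω.blockMean b G := by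
  have hf : (0 : ℝ) < (Fintype.card ω.key).factorial := by
    exact_mod_cast Nat.factorial_pos _
  rw [div_eq_iff hf.ne']
  set G' : Finset ω.key → Prop := fun C => G (C.map (Function.Embedding.subtype _)) with hG'
  have hcount : ((((Finset.univ : Finset ω.key).powersetCard b).filter G').card : ℝ) =
      ((ω.key.powersetCard b).filter G).card := by
    norm_cast
    refine Finset.card_bij' (fun C _ => C.map (Function.Embedding.subtype _))
      (fun C _ => C.subtype (· ∈ ω.key)) ?_ ?_ ?_ ?_
    · intro C hC
      obtain ⟨h1, h2⟩ := Finset.mem_filter.mp hC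
      refine Finset.mem_filter.mpr ⟨Finset.mem_powersetCard.mpr ⟨?_, ?_⟩, h2⟩
      · intro x hx
        obtain ⟨y, -, rfl⟩ := Finset.mem_map.mp hx
        exact y.2
      · rw [Finset.card_map, (Finset.mem_powersetCard.mp h1).2]
    · intro C hC
      obtain ⟨h1, h2⟩ := Finset.mem_filter.mp hC
      obtain ⟨h3, h4⟩ := Finset.mem_powersetCard.mp h1
      have hm : (C.subtype (· ∈ ω.key)).map (Function.Embedding.subtype _) = C := by
        rw [Finset.subtype_map, Finset.filter_true_of_mem h3]
      refine Finset.mem_filter.mpr ⟨Finset.mem_powersetCard.mpr ⟨Finset.subset_univ _, ?_⟩, ?_⟩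
      · rw [← Finset.card_map (Function.Embedding.subtype _), hm, h4]
      · rw [hG']
        dsimp only
        rwa [hm]
    · intro C _
      ext x
      simp
    · intro C hC
      obtain ⟨h1, h2⟩ := Finset.mem_filter.mp hC
      rw [Finset.subtype_map, Finset.filter_true_of_mem (Finset.mem_powersetCard.mp h1).1]
  have hterm : ∀ j ∈ Finset.range (ω.nK / b), (∑ π : Perm ω.key,
      if G' (((ω.block b σ j).subtype (· ∈ ω.key)).map π.toEmbedding) then (1 : ℝ) else 0) =
      ((Fintype.card ω.key).factorial : ℝ) *
        (((ω.key.powersetCard b).filter G).card / (ω.nK.choose b : ℝ)) := by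
    intro j hj
    have hj' := Finset.mem_range.mp hj
    have hcard : ((ω.block b σ j).subtype (· ∈ ω.key)).card = b := by
      rw [← Finset.card_map (Function.Embedding.subtype _), Finset.subtype_map,
        Finset.filter_true_of_mem (ω.block_subset_key b σ j), ω.card_block hb σ hj']
    have h := sum_map_perm_mul_choose ((ω.block b σ j).subtype (· ∈ ω.key))
      fun C => if G' C then (1 : ℝ) else 0
    have hbool : (∑ C ∈ (Finset.univ : Finset ω.key).powersetCard b,
        if G' C then (1 : ℝ) else 0) = ((ω.key.powersetCard b).filter G).card := by
      rw [Finset.sum_boole, hcount]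
    rw [hcard, hbool] at h
    -- The existence of a full block `j` excludes the degenerate case in which the binomial
    -- coefficient vanishes.
    have hbn : b ≤ ω.nK := by
      by_contra! hlt
      rw [Nat.div_eq_of_lt hlt] at hj'
      omega
    have hc : (0 : ℝ) < (ω.nK.choose b : ℝ) := by exact_mod_cast Nat.choose_pos hbn
    rw [← mul_div_assoc, eq_div_iff hc.ne', ← h, card_key_coe]
  simp only [blockCount_mul, Finset.card_filter]
  push_cast
  rw [Finset.sum_comm, Finset.sum_congr rfl hterm, Finset.sum_const, Finset.card_range,
    nsmul_eq_mul, blockMean]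
  ring

/-- Reduces a tail bound for the order of all positions to one for permutations of the key, where
the number of exchanged bits is n_K and not `N`. -/
theorem sum_perm_le_of_forall {p : Perm (Fin N) → Prop} [DecidablePred p] {ε : ℝ}
    (h : ∀ σ, (∑ π : Perm ω.key, if p (σ * Perm.ofSubtype π⁻¹) then (1 : ℝ) else 0) ≤
      ε * (Fintype.card ω.key).factorial) :
    (∑ σ, if p σ then (1 : ℝ) else 0) ≤ ε * N.factorial := by
  have key := sum_sum_mul_right (fun π : Perm ω.key => (Perm.ofSubtype π⁻¹ : Perm (Fin N)))
    fun σ => if p σ then (1 : ℝ) else 0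
  have h0 : (0 : ℝ) < Fintype.card (Perm ω.key) := by exact_mod_cast Fintype.card_pos
  rw [← mul_le_mul_iff_right₀ h0, ← key]
  refine (Finset.sum_le_sum fun σ _ => h σ).trans_eq ?_
  rw [Finset.sum_const, Finset.card_univ, nsmul_eq_mul, Fintype.card_perm, Fintype.card_perm,
    Fintype.card_fin]
  ring

theorem orderMean_eq (f : Perm (Fin N) → ℕ) :
    orderMean f = (∑ σ, (f σ : ℝ)) / (N.factorial : ℝ) := by
  simp only [orderMean, orderLaw, PMF.uniformOfFintype_apply, Fintype.card_perm, Fintype.card_fin,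
    ENNReal.toReal_inv, ENNReal.toReal_natCast, ← Finset.mul_sum]
  rw [div_eq_inv_mul]

theorem orderMean_blockCount (hb : 0 < b) : orderMean (ω.blockCount b G) = ω.blockMean b G := by
  have key := sum_sum_mul_right (fun π : Perm ω.key => (Perm.ofSubtype π⁻¹ : Perm (Fin N)))
    fun σ => (ω.blockCount b G σ : ℝ)
  have hf : (0 : ℝ) < (Fintype.card ω.key).factorial := by
    exact_mod_cast Nat.factorial_pos _
  have hN : (0 : ℝ) < N.factorial := by exact_mod_cast Nat.factorial_pos _
  have h1 : ∀ σ, (∑ π : Perm ω.key, (ω.blockCount b G (σ * Perm.ofSubtype π⁻¹) : ℝ)) =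
      ω.blockMean b G * ((Fintype.card ω.key).factorial : ℝ) := fun σ => by
    rw [← ω.sum_blockCount_mul G hb σ, div_mul_cancel₀ _ hf.ne']
  simp only [h1] at key
  rw [Finset.sum_const, Finset.card_univ, nsmul_eq_mul, Fintype.card_perm, Fintype.card_fin,
    Fintype.card_perm] at key
  rw [orderMean_eq, div_eq_iff hN.ne']
  have := mul_left_cancel₀ hf.ne' (a := ((Fintype.card ω.key).factorial : ℝ))
    (b := ∑ σ, (ω.blockCount b G σ : ℝ)) (c := ω.blockMean b G * N.factorial)
    (by rw [← key]; ring)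
  exact this

variable {ε t : ℝ}

theorem blockCount_upper_tail (hb : 0 < b) (hε : 0 < ε) (hn : 0 < ω.nK) (ht : 0 ≤ t)
    (ht2 : 2 * ω.nK * Real.log (1 / ε) ≤ t ^ 2) :
    (∑ σ, if ω.blockMean b G + t < ω.blockCount b G σ then (1 : ℝ) else 0) ≤ ε * N.factorial := by
  refine ω.sum_perm_le_of_forall fun σ => ?_
  have h := perm_upper_tail (fun π : Perm ω.key =>
    (ω.blockCount b G (σ * Perm.ofSubtype π⁻¹) : ℝ)) (ω.blockCount_swap_le b G σ) hε
    (by rwa [card_key_coe]) ht (by rwa [card_key_coe])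
  rwa [ω.sum_blockCount_mul G hb σ] at h

theorem blockCount_lower_tail (hb : 0 < b) (hε : 0 < ε) (hn : 0 < ω.nK) (ht : 0 ≤ t)
    (ht2 : 2 * ω.nK * Real.log (1 / ε) ≤ t ^ 2) :
    (∑ σ, if (ω.blockCount b G σ : ℝ) < ω.blockMean b G - t then (1 : ℝ) else 0) ≤
      ε * N.factorial := by
  refine ω.sum_perm_le_of_forall fun σ => ?_
  have h := perm_lower_tail (fun π : Perm ω.key =>
    (ω.blockCount b G (σ * Perm.ofSubtype π⁻¹) : ℝ)) (ω.blockCount_swap_le b G σ) hε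
    (by rwa [card_key_coe]) ht (by rwa [card_key_coe])
  rwa [ω.sum_blockCount_mul G hb σ] at h

end Count

end Run

theorem sum_ite_le_of_imp {κ : Type*} [Fintype κ] {p q : κ → Prop} [DecidablePred p]
    [DecidablePred q] {w : κ → ℝ} (hw : ∀ a, 0 ≤ w a) (h : ∀ a, p a → q a) :
    (∑ a, if p a then w a else 0) ≤ ∑ a, if q a then w a else 0 := by
  refine Finset.sum_le_sum fun a _ => ?_
  split_ifs with h1 h2 h2
  · exact le_rfl
  · exact absurd (h a h1) h2
  · exact hw a
  · exact le_rfl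

/-! ### Inequalities for falling factorials and powers -/

/-- Among the r^(b+1) words of length b+1, each of the (b+1)b/2 pairs of places carries equal
letters in r^b of them; the remaining words are injective. -/
theorem pow_sub_le_descFactorial (r b : ℕ) :
    (r : ℝ) ^ (b + 1) - (b + 1) * b / 2 * (r : ℝ) ^ b ≤ (r.descFactorial (b + 1) : ℝ) := by
  induction b with
  | zero => simp
  | succ b ih =>
    rw [Nat.descFactorial_succ]
    push_cast
    have hr : (0 : ℝ) ≤ r := Nat.cast_nonneg r
    have hb : (0 : ℝ) ≤ b := Nat.cast_nonneg b
    rcases le_or_gt (b + 1) r with h | h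
    · rw [Nat.cast_sub h]
      push_cast
      have hbr : (0 : ℝ) ≤ r - (b + 1) := by
        have : ((b + 1 : ℕ) : ℝ) ≤ r := by exact_mod_cast h
        push_cast at this
        linarith
      have h1 := mul_le_mul_of_nonneg_left ih hbr
      refine le_trans ?_ h1
      have h2 : 0 ≤ (b + 1) * (b + 1) * (b : ℝ) / 2 * (r : ℝ) ^ b := by positivity
      rw [pow_succ _ (b + 1), pow_succ _ b]
      nlinarith
    -- For r ≤ b the truncated difference is 0, and the left side is nonpositive since r is below
    -- (b+2)(b+1)/2.
    · rw [Nat.sub_eq_zero_of_le (by omega)]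
      have h1 : (r : ℝ) ≤ b := by exact_mod_cast Nat.lt_succ_iff.mp h
      rw [pow_succ _ (b + 1)]
      have h2 : (0 : ℝ) ≤ (r : ℝ) ^ (b + 1) := by positivity
      simp only [Nat.cast_zero, zero_mul]
      nlinarith [mul_nonneg h2 (show 0 ≤ ((b : ℝ) + 1 + 1) * (b + 1) / 2 - r by nlinarith)]

/-- Both differences factor as the same step times a geometric sum, and the sums compare term by
term. Absolute values are needed since `v` and `v'` may be negative. -/
theorem pow_sub_pow_le_pow_sub_pow {u u' v v' : ℝ} (huv : |v| ≤ u) (huv' : |v'| ≤ u')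
    (hd : 0 ≤ u' - u) (h : u' - u = v - v') (b : ℕ) : v ^ b - v' ^ b ≤ u' ^ b - u ^ b := by
  rw [← (Commute.all v v').geom_sum₂_mul b, ← (Commute.all u' u).geom_sum₂_mul b, ← h]
  refine mul_le_mul_of_nonneg_right ?_ hd
  rw [← Finset.sum_range_reflect (fun i => u' ^ i * u ^ (b - 1 - i))]
  refine Finset.sum_le_sum fun i hi => ?_
  have hi' : i ≤ b - 1 := by have := Finset.mem_range.mp hi; omega
  rw [Nat.sub_sub_self hi', mul_comm]
  have hu := (abs_nonneg v).trans huv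
  have hu' := (abs_nonneg v').trans huv'
  calc v' ^ (b - 1 - i) * v ^ i ≤ |v' ^ (b - 1 - i) * v ^ i| := le_abs_self _
    _ = |v'| ^ (b - 1 - i) * |v| ^ i := by rw [abs_mul, abs_pow, abs_pow]
    _ ≤ u' ^ (b - 1 - i) * u ^ i := by gcongr

/-- If `m (n)_b ≤ n^b B` and there are many blocks, then `m` is at most slightly larger than `B`. -/
theorem le_add_of_mul_descFactorial_le {n b : ℕ} (hb : 0 < b) (hn : 0 < n) {m M B δ : ℝ}
    (hm0 : 0 ≤ m) (hmM : m ≤ M) (hM : M * b ≤ n) (h : m * (n.descFactorial b : ℝ) ≤ (n : ℝ) ^ b * B)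
    (hδ0 : 0 ≤ δ) (hδM : 3 * δ < M) (hδ : (n : ℝ) * 1.5 ≤ δ ^ 2) : m ≤ B + δ := by
  have hnR : (0 : ℝ) < n := by exact_mod_cast hn
  obtain ⟨c, rfl⟩ : ∃ c, b = c + 1 := ⟨b - 1, by omega⟩
  have h1 := (mul_le_mul_of_nonneg_left (pow_sub_le_descFactorial n c) hm0).trans h
  have hnp : (0 : ℝ) < (n : ℝ) ^ c := by positivity
  have h2 : m * (n - (c + 1) * c / 2) ≤ n * B := by
    refine le_of_mul_le_mul_left ?_ hnp
    calc _ = m * ((n : ℝ) ^ (c + 1) - (c + 1) * c / 2 * (n : ℝ) ^ c) := by ring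
      _ ≤ _ := h1
      _ = _ := by ring
  push_cast at hM
  have hc0 : (0 : ℝ) ≤ c := Nat.cast_nonneg c
  have h3 : m * (c + 1) ≤ n := le_trans (by gcongr) hM
  have h4 : m * ((c + 1) * c / 2) ≤ n * (c / 2) := by
    calc m * ((c + 1) * c / 2) = m * (c + 1) * (c / 2) := by ring
      _ ≤ n * (c / 2) := by gcongr
  have h5 : m ≤ B + c / 2 := by
    refine le_of_mul_le_mul_left ?_ hnR
    linarith
  -- With b = c + 1: from 3δb ≤ n and 1.5 n ≤ δ² follows δ ≥ 4.5 b, far above the loss c/2 in `h5`.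
  have h6 : 3 * δ * (c + 1) ≤ n := le_trans (by gcongr) hM
  have h7 : 0 < δ := by
    rcases hδ0.eq_or_lt with h0 | h0
    · rw [← h0] at hδ
      linarith
    · exact h0
  have h8 : δ * (4.5 * (c + 1)) ≤ δ * δ := by linarith
  have h9 := le_of_mul_le_mul_left h8 h7
  linarith

/-- Subtracting the binomial expansions at x and -x cancels the even terms and doubles the odd ones.
-/
theorem sum_odd_choose_mul_pow (x y : ℝ) (b : ℕ) :
    ∑ k ∈ (Finset.range (b + 1)).filter Odd, (b.choose k : ℝ) * (x ^ k * y ^ (b - k)) =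
      1 / 2 * ((x + y) ^ b - (y - x) ^ b) := by
  have h1 : (y - x) ^ b = ((-x) + y) ^ b := by ring
  rw [h1, add_pow, add_pow, ← Finset.sum_sub_distrib, Finset.mul_sum, Finset.sum_filter]
  refine Finset.sum_congr rfl fun k _ => ?_
  split_ifs with h
  · rw [h.neg_pow]; ring
  · rw [(Nat.not_odd_iff_even.mp h).neg_pow]; ring

theorem factorial_mul_choose_mul_choose {b k : ℕ} (hk : k ≤ b) (x y : ℕ) :
    (b.factorial : ℝ) * ((x.choose k : ℝ) * (y.choose (b - k) : ℝ)) =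
      (b.choose k : ℝ) * ((x.descFactorial k : ℝ) * (y.descFactorial (b - k) : ℝ)) := by
  rw [Nat.descFactorial_eq_factorial_mul_choose, Nat.descFactorial_eq_factorial_mul_choose,
    ← Nat.choose_mul_factorial_mul_factorial hk]
  push_cast
  ring

/-! ### Accepted blocks and logical errors: means and tails over the random order. -/

namespace Run

open Equiv

variable {N : ℕ} (ω : Run N)

/-- The single-photon positions of the key with the given bit-flip flag. -/
def flipSet (v : Bool) : Finset (Fin N) :=
  ω.single.filter fun i => (ω.response i).bitFlip = v

theorem flipSet_subset_single (v : Bool) : ω.flipSet v ⊆ ω.single := Finset.filter_subset _ _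

theorem single_subset_key : ω.single ⊆ ω.key := Finset.filter_subset _ _

theorem disjoint_flipSet : Disjoint (ω.flipSet true) (ω.flipSet false) := by
  refine Finset.disjoint_left.mpr fun x hx hx' => ?_
  have h := (Finset.mem_filter.mp hx).2
  rw [(Finset.mem_filter.mp hx').2] at h
  exact absurd h (by decide)

theorem rZ_add_rNotZ : ω.rZ + ω.rNotZ = ω.sK := by
  have h := Finset.card_filter_add_card_filter_not (s := ω.single)
    fun i => (ω.response i).bitFlip = true
  simp only [Bool.not_eq_true] at h
  exact h

theorem card_flipSet_phase (v f : Bool) :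
    ((ω.flipSet v).filter fun i => (ω.response i).phaseFlip = f).card = ω.cls v f := by
  rw [flipSet, Finset.filter_filter, cls]

theorem cls_add_cls (v : Bool) : ω.cls v true + ω.cls v false = (ω.flipSet v).card := by
  rw [← card_flipSet_phase, ← card_flipSet_phase]
  have h := Finset.card_filter_add_card_filter_not (s := ω.flipSet v)
    fun i => (ω.response i).phaseFlip = true
  simpa only [Bool.not_eq_true] using h

theorem cls_add_cls_phase : ω.cls true true + ω.cls false true = ω.rX := by
  have h := Finset.card_filter_add_card_filter_not
    (s := ω.single.filter fun i => (ω.response i).phaseFlip = true)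
    fun i => (ω.response i).bitFlip = true
  simp only [Bool.not_eq_true, Finset.filter_filter] at h
  simpa only [cls, rX, and_comm] using h

/-- A set of positions that consists of single-photon positions of the key, all with the same
bit-flip flag. -/
def Uniform (C : Finset (Fin N)) : Prop := C ⊆ ω.flipSet true ∨ C ⊆ ω.flipSet false

instance : DecidablePred ω.Uniform := fun C => by unfold Uniform; infer_instance

theorem basisB_of_mem_key {i : Fin N} (hi : i ∈ ω.key) : (ω.pulse i).basisB = Basis.Z := by
  have h1 := (Finset.mem_filter.mp hi).1
  have h2 := (Finset.mem_sdiff.mp h1).1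
  exact (Finset.mem_filter.mp h2).2.2.2

/-- Key bits are measured in the Z basis, where Bob's bit is Alice's plus the bit-flip flag, so
Alice's bits cancel. -/
theorem parity_eq_iff {i i' : Fin N} (hi : i ∈ ω.key) (hi' : i' ∈ ω.key) :
    xor (ω.aliceBit i) (ω.aliceBit i') = xor (ω.bobBit i) (ω.bobBit i') ↔
      (ω.response i).bitFlip = (ω.response i').bitFlip := by
  unfold aliceBit bobBit
  rw [ω.basisB_of_mem_key hi, ω.basisB_of_mem_key hi']
  simp only [Response.flip]
  generalize (ω.pulse i).bit = a
  generalize (ω.pulse i').bit = a'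
  generalize (ω.response i).bitFlip = f
  generalize (ω.response i').bitFlip = f'
  revert a a' f f'
  decide

/-- Acceptance compares neighbours only. Equality propagates along consecutive ranks, all of which
stay in the block because they have the same quotient by `b`. -/
theorem bitFlip_eq_of_accepted {b : ℕ} (hb : 0 < b) {σ : Perm (Fin N)} {j : ℕ}
    (h : ω.Accepted b σ j) (d : ℕ) {i i' : Fin N} (hi : i ∈ ω.block b σ j)
    (hi' : i' ∈ ω.block b σ j) (hd : ω.rank σ i' = ω.rank σ i + d) :
    (ω.response i).bitFlip = (ω.response i').bitFlip := by
  induction d generalizing i' with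
  | zero =>
    rw [ω.rank_injOn σ (ω.block_subset_key b σ j hi) (ω.block_subset_key b σ j hi') hd.symm]
  | succ d ih =>
    have hk' := ω.block_subset_key b σ j hi'
    obtain ⟨k, hk, hkr⟩ := ω.exists_rank_eq σ (r := ω.rank σ i + d)
      (by have := ω.rank_lt_nK (σ := σ) hk'; omega)
    have h1 := (Finset.mem_filter.mp hi).2
    have h2 := (Finset.mem_filter.mp hi').2
    have hkb : k ∈ ω.block b σ j := by
      refine Finset.mem_filter.mpr ⟨hk, ?_⟩
      rw [Nat.div_eq_iff hb] at h1 h2 ⊢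
      omega
    rw [ih hkb hkr, ← ω.parity_eq_iff hk hk']
    exact h k hkb i' hi' (by omega)

/-- This replaces the protocol's test by a property of the block as a set, independent of the order
inside it, so that counting subsets becomes possible. -/
theorem allSingle_and_accepted_iff {b : ℕ} (hb : 0 < b) (σ : Perm (Fin N)) {j : ℕ}
    (hj : j < ω.nK / b) :
    (ω.AllSingle b σ j ∧ ω.Accepted b σ j) ↔ ω.Uniform (ω.block b σ j) := by
  constructor
  · rintro ⟨h1, h2⟩
    obtain ⟨i₀, hi₀⟩ : (ω.block b σ j).Nonempty := by
      rw [← Finset.card_pos, ω.card_block hb σ hj]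
      exact hb
    have hall : ω.block b σ j ⊆ ω.flipSet (ω.response i₀).bitFlip := by
      intro i hi
      refine Finset.mem_filter.mpr ⟨Finset.mem_filter.mpr
        ⟨ω.block_subset_key b σ j hi, h1 i hi⟩, ?_⟩
      rcases le_total (ω.rank σ i₀) (ω.rank σ i) with h | h
      · exact (ω.bitFlip_eq_of_accepted hb h2 _ hi₀ hi (Nat.add_sub_of_le h).symm).symm
      · exact ω.bitFlip_eq_of_accepted hb h2 _ hi hi₀ (Nat.add_sub_of_le h).symm
    cases hv : (ω.response i₀).bitFlip
    · exact Or.inr (hv ▸ hall)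
    · exact Or.inl (hv ▸ hall)
  · intro h
    obtain ⟨v, hv⟩ : ∃ v, ω.block b σ j ⊆ ω.flipSet v := by
      rcases h with h | h
      exacts [⟨_, h⟩, ⟨_, h⟩]
    refine ⟨fun i hi => (Finset.mem_filter.mp (Finset.mem_filter.mp (hv hi)).1).2,
      fun i hi i' hi' _ => ?_⟩
    rw [ω.parity_eq_iff (ω.block_subset_key b σ j hi) (ω.block_subset_key b σ j hi'),
      (Finset.mem_filter.mp (hv hi)).2, (Finset.mem_filter.mp (hv hi')).2]

/-- The parity condition of a logical X-basis error. -/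
def OddPhase (C : Finset (Fin N)) : Prop :=
  Odd (C.filter fun i => (ω.response i).phaseFlip = true).card

instance : DecidablePred ω.OddPhase := fun C => by unfold OddPhase; infer_instance

/-- The trivial conjunct makes `S` and `R` two instances of the pattern counted by
`card_filter_uniform`. -/
theorem S_eq_blockCount {b : ℕ} (hb : 0 < b) :
    ω.S b = ω.blockCount b fun C => ω.Uniform C ∧ True := by
  funext σ
  unfold S blockCount
  congr 1
  ext j
  simp only [Finset.mem_filter, Finset.mem_range, and_true]
  exact and_congr_right fun hj => ω.allSingle_and_accepted_iff hb σ hj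

theorem R_eq_blockCount {b : ℕ} (hb : 0 < b) :
    ω.R b = ω.blockCount b fun C => ω.Uniform C ∧ ω.OddPhase C := by
  funext σ
  unfold R blockCount
  congr 1
  ext j
  simp only [Finset.mem_filter, Finset.mem_range]
  refine and_congr_right fun hj => and_congr (ω.allSingle_and_accepted_iff hb σ hj) ?_
  rfl

/-- The two flip classes are disjoint; `b > 0` matters because the empty set lies in both. -/
theorem card_filter_uniform {b : ℕ} (hb : 0 < b) (q : Finset (Fin N) → Prop) [DecidablePred q] :
    ((ω.key.powersetCard b).filter fun C => ω.Uniform C ∧ q C).card =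
      (((ω.flipSet true).powersetCard b).filter q).card +
        (((ω.flipSet false).powersetCard b).filter q).card := by
  rw [← Finset.card_union_of_disjoint]
  · congr 1
    ext C
    have hk : ∀ v, C ⊆ ω.flipSet v → C ⊆ ω.key := fun v h =>
      h.trans ((ω.flipSet_subset_single v).trans ω.single_subset_key)
    have h1 := hk true
    have h2 := hk false
    simp only [Finset.mem_filter, Finset.mem_powersetCard, Finset.mem_union]
    unfold Uniform
    tauto
  · refine Finset.disjoint_left.mpr fun C hC hC' => ?_
    obtain ⟨h1, h2⟩ := Finset.mem_powersetCard.mp (Finset.mem_filter.mp hC).1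
    have h3 := (Finset.mem_powersetCard.mp (Finset.mem_filter.mp hC').1).1
    obtain ⟨x, hx⟩ : C.Nonempty := Finset.card_pos.mp (by omega)
    exact Finset.disjoint_left.mp ω.disjoint_flipSet (h1 hx) (h3 hx)

theorem div_choose_eq (n b : ℕ) (x : ℝ) :
    x / (n.choose b : ℝ) = (b.factorial : ℝ) * x / (n.descFactorial b : ℝ) := by
  rw [Nat.descFactorial_eq_factorial_mul_choose]
  push_cast
  rw [mul_div_mul_left]
  exact_mod_cast b.factorial_ne_zero

theorem orderMean_S {b : ℕ} (hb : 0 < b) :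
    orderMean (fun σ => ω.S b σ) = ((ω.nK / b : ℕ) : ℝ) *
      (((ω.rNotZ.descFactorial b : ℝ) + (ω.rZ.descFactorial b : ℝ)) /
        (ω.nK.descFactorial b : ℝ)) := by
  have h : orderMean (fun σ => ω.S b σ) = _ :=
    (congrArg orderMean (ω.S_eq_blockCount hb)).trans
      (ω.orderMean_blockCount (fun C => ω.Uniform C ∧ True) hb)
  rw [h, blockMean, ω.card_filter_uniform hb (fun _ => True), div_choose_eq]
  congr 2
  rw [Nat.descFactorial_eq_factorial_mul_choose, Nat.descFactorial_eq_factorial_mul_choose]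
  simp only [Finset.filter_true, Finset.card_powersetCard]
  push_cast
  rw [show ω.rZ = (ω.flipSet true).card from rfl, show ω.rNotZ = (ω.flipSet false).card from rfl]
  ring

theorem card_filter_oddPhase (v : Bool) (b : ℕ) :
    (((ω.flipSet v).powersetCard b).filter ω.OddPhase).card =
      ∑ k ∈ (Finset.range (b + 1)).filter Odd,
        (ω.cls v true).choose k * (ω.cls v false).choose (b - k) := by
  set p : Fin N → Prop := fun i => (ω.response i).phaseFlip = true with hp
  rw [Finset.card_eq_sum_card_fiberwise (f := fun C => (C.filter p).card)
    (t := (Finset.range (b + 1)).filter Odd)]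
  · refine Finset.sum_congr rfl fun k hk => ?_
    obtain ⟨hk1, hk2⟩ := Finset.mem_filter.mp hk
    have h := card_powersetCard_filter_card_eq (ω.flipSet v) p
      (Nat.lt_succ_iff.mp (Finset.mem_range.mp hk1))
    have h1 : ((ω.flipSet v).filter p).card = ω.cls v true := ω.card_flipSet_phase v true
    have h2 : ((ω.flipSet v).filter fun x => ¬ p x).card = ω.cls v false := by
      rw [← ω.card_flipSet_phase v false]
      simp only [hp, Bool.not_eq_true]
    rw [h1, h2] at h
    rw [← h, Finset.filter_filter]
    congr 1
    refine Finset.filter_congr fun C _ => ?_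
    constructor
    · exact fun h => h.2
    · intro h
      refine ⟨?_, h⟩
      change Odd (C.filter p).card
      rwa [h]
  · intro C hC
    obtain ⟨h1, h2⟩ := Finset.mem_filter.mp hC
    refine Finset.mem_filter.mpr ⟨Finset.mem_range.mpr ?_, h2⟩
    rw [← (Finset.mem_powersetCard.mp h1).2, Nat.lt_succ_iff]
    exact Finset.card_filter_le _ _

theorem orderMean_R {b : ℕ} (hb : 0 < b) :
    orderMean (fun σ => ω.R b σ) = ((ω.nK / b : ℕ) : ℝ) *
      ((∑ k ∈ (Finset.range (b + 1)).filter Odd, (b.choose k : ℝ) *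
        (((ω.cls false true).descFactorial k : ℝ) *
            ((ω.cls false false).descFactorial (b - k) : ℝ) +
          ((ω.cls true true).descFactorial k : ℝ) *
            ((ω.cls true false).descFactorial (b - k) : ℝ))) /
        (ω.nK.descFactorial b : ℝ)) := by
  have h : orderMean (fun σ => ω.R b σ) = _ :=
    (congrArg orderMean (ω.R_eq_blockCount hb)).trans
      (ω.orderMean_blockCount (fun C => ω.Uniform C ∧ ω.OddPhase C) hb)
  rw [h, blockMean, ω.card_filter_uniform hb ω.OddPhase, div_choose_eq]
  congr 2
  rw [card_filter_oddPhase, card_filter_oddPhase, ← Finset.sum_add_distrib]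
  push_cast
  rw [Finset.mul_sum]
  refine Finset.sum_congr rfl fun k hk => ?_
  have hkb := Nat.lt_succ_iff.mp (Finset.mem_range.mp (Finset.mem_filter.mp hk).1)
  rw [mul_add, factorial_mul_choose_mul_choose hkb, factorial_mul_choose_mul_choose hkb]
  ring

/-- Each falling factorial loses at most b(b-1)/2 times the (b-1)-st power of r_Z or r_¬Z, hence of
s_K. The two losses give the term b(b-1)/s_K, and (n)_b ≤ n^b takes care of the denominator. -/
theorem orderMean_S_ge {b : ℕ} (hb : 2 ≤ b) (hs : 0 < ω.sK) :
    ((ω.nK / b : ℕ) : ℝ) * ((ω.sK : ℝ) / ω.nK) ^ b *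
        ((1 - ω.phiZ) ^ b + ω.phiZ ^ b - b * (b - 1) / ω.sK) ≤
      orderMean (fun σ => ω.S b σ) := by
  rw [ω.orderMean_S (by omega)]
  rcases Nat.eq_zero_or_pos (ω.nK / b) with hM | hM
  · simp [hM]
  have hbn : b ≤ ω.nK := by
    by_contra! hlt
    rw [Nat.div_eq_of_lt hlt] at hM
    omega
  have hn : (0 : ℝ) < ω.nK := by exact_mod_cast (by omega : 0 < ω.nK)
  have hs' : (0 : ℝ) < ω.sK := by exact_mod_cast hs
  rw [mul_assoc]
  refine mul_le_mul_of_nonneg_left ?_ (Nat.cast_nonneg _)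
  have hsum : (ω.rZ : ℝ) + ω.rNotZ = ω.sK := by exact_mod_cast ω.rZ_add_rNotZ
  obtain ⟨c, rfl⟩ : ∃ c, b = c + 1 := ⟨b - 1, by omega⟩
  have h1 := pow_sub_le_descFactorial ω.rZ c
  have h2 := pow_sub_le_descFactorial ω.rNotZ c
  have hz : (0 : ℝ) ≤ ω.rZ := Nat.cast_nonneg _
  have hnz : (0 : ℝ) ≤ ω.rNotZ := Nat.cast_nonneg _
  have h3 : (ω.rZ : ℝ) ^ c ≤ (ω.sK : ℝ) ^ c := by
    gcongr
    have := ω.rZ_add_rNotZ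
    omega
  have h4 : (ω.rNotZ : ℝ) ^ c ≤ (ω.sK : ℝ) ^ c := by
    gcongr
    have := ω.rZ_add_rNotZ
    omega
  have hden : (0 : ℝ) < (ω.nK.descFactorial (c + 1) : ℝ) := by
    exact_mod_cast Nat.descFactorial_pos.mpr hbn
  have hden2 : (ω.nK.descFactorial (c + 1) : ℝ) ≤ (ω.nK : ℝ) ^ (c + 1) := by
    exact_mod_cast Nat.descFactorial_le_pow _ _
  have hlhs : ((ω.sK : ℝ) / ω.nK) ^ (c + 1) * ((1 - ω.phiZ) ^ (c + 1) + ω.phiZ ^ (c + 1) -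
      ((c + 1 : ℕ) : ℝ) * (((c + 1 : ℕ) : ℝ) - 1) / ω.sK) =
      ((ω.rNotZ : ℝ) ^ (c + 1) + (ω.rZ : ℝ) ^ (c + 1) - (c + 1) * c * (ω.sK : ℝ) ^ c) /
        (ω.nK : ℝ) ^ (c + 1) := by
    have e1 : 1 - ω.phiZ = ω.rNotZ / ω.sK := by
      rw [phiZ]
      field_simp
      linarith
    rw [e1, phiZ, div_pow, div_pow, div_pow]
    push_cast
    field_simp
    ring
  rw [hlhs]
  have hnum : (ω.rNotZ : ℝ) ^ (c + 1) + (ω.rZ : ℝ) ^ (c + 1) - (c + 1) * c * (ω.sK : ℝ) ^ c ≤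
      (ω.rNotZ.descFactorial (c + 1) : ℝ) + (ω.rZ.descFactorial (c + 1) : ℝ) := by
    have hc : (0 : ℝ) ≤ (c + 1) * c / 2 := by positivity
    nlinarith [mul_le_mul_of_nonneg_left h3 hc, mul_le_mul_of_nonneg_left h4 hc]
  calc _ ≤ ((ω.rNotZ.descFactorial (c + 1) : ℝ) + (ω.rZ.descFactorial (c + 1) : ℝ)) /
        (ω.nK : ℝ) ^ (c + 1) := by gcongr
    _ ≤ _ := by gcongr

theorem sK_le_nK : ω.sK ≤ ω.nK := Finset.card_filter_le _ _

/-- Falling factorials are bounded by powers term by term; the odd binomial sums over the two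
bit-flip classes then close up to `oddBound` at m_Y, since m_Z = r_X - m_Y. -/
theorem orderMean_R_le {b : ℕ} (hb : 0 < b) :
    orderMean (fun σ => ω.R b σ) ≤
      (ω.nK : ℝ) ^ b / (ω.nK.descFactorial b : ℝ) * ω.oddBound b (ω.cls true true) := by
  rw [ω.orderMean_R hb]
  rcases Nat.eq_zero_or_pos (ω.nK / b) with hM | hM
  · simp [hM, oddBound]
  have hbn : b ≤ ω.nK := by
    by_contra! hlt
    rw [Nat.div_eq_of_lt hlt] at hM
    omega
  have hn : (0 : ℝ) < ω.nK := by exact_mod_cast (by omega : 0 < ω.nK)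
  have hden : (0 : ℝ) < (ω.nK.descFactorial b : ℝ) := by
    exact_mod_cast Nat.descFactorial_pos.mpr hbn
  have e1 : (ω.rNotZ : ℝ) = ω.cls false true + ω.cls false false := by
    exact_mod_cast (ω.cls_add_cls false).symm
  have e2 : (ω.rZ : ℝ) = ω.cls true true + ω.cls true false := by
    exact_mod_cast (ω.cls_add_cls true).symm
  have e3 : (ω.rX : ℝ) = ω.cls true true + ω.cls false true := by
    exact_mod_cast ω.cls_add_cls_phase.symm
  have hsum : ∑ k ∈ (Finset.range (b + 1)).filter Odd, (b.choose k : ℝ) *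
        (((ω.cls false true).descFactorial k : ℝ) *
            ((ω.cls false false).descFactorial (b - k) : ℝ) +
          ((ω.cls true true).descFactorial k : ℝ) *
            ((ω.cls true false).descFactorial (b - k) : ℝ)) ≤
      1 / 2 * (((ω.cls false true : ℝ) + ω.cls false false) ^ b -
          ((ω.cls false false : ℝ) - ω.cls false true) ^ b) +
        1 / 2 * (((ω.cls true true : ℝ) + ω.cls true false) ^ b -
          ((ω.cls true false : ℝ) - ω.cls true true) ^ b) := by
    rw [← sum_odd_choose_mul_pow, ← sum_odd_choose_mul_pow, ← Finset.sum_add_distrib]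
    refine Finset.sum_le_sum fun k _ => ?_
    rw [← mul_add]
    have hp : ∀ x k : ℕ, (x.descFactorial k : ℝ) ≤ (x : ℝ) ^ k := fun x k => by
      exact_mod_cast Nat.descFactorial_le_pow _ _
    gcongr <;> exact hp _ _
  calc _ ≤ ((ω.nK / b : ℕ) : ℝ) * ((1 / 2 * (((ω.cls false true : ℝ) + ω.cls false false) ^ b -
          ((ω.cls false false : ℝ) - ω.cls false true) ^ b) +
        1 / 2 * (((ω.cls true true : ℝ) + ω.cls true false) ^ b -
          ((ω.cls true false : ℝ) - ω.cls true true) ^ b)) / (ω.nK.descFactorial b : ℝ)) := by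
        gcongr
    _ = _ := by
      rw [oddBound, e1, e2, e3]
      simp only [div_pow]
      field_simp
      ring_nf

/-- Moving a phase flip from the unflipped to the flipped class raises r_¬Z - 2(r_X - y) and lowers
r_Z - 2y by the same amount. The hypothesis keeps the first at least the absolute value of the
second, so its power changes more. -/
theorem oddBound_antitoneOn (b : ℕ) (h : ω.rZ + 2 * ω.rX < ω.rNotZ) :
    AntitoneOn (ω.oddBound b) (Set.Icc 0 (min (ω.rX : ℝ) ω.rZ)) := by
  intro y hy y' hy' hyy
  have h' : (ω.rZ : ℝ) + 2 * ω.rX < ω.rNotZ := by exact_mod_cast h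
  have hz : (0 : ℝ) ≤ ω.rZ := Nat.cast_nonneg _
  have hx : (0 : ℝ) ≤ ω.rX := Nat.cast_nonneg _
  have a1 := hy.1
  have a2 := hy.2.trans (min_le_right _ _)
  have a3 := hy'.1
  have a4 := hy'.2.trans (min_le_right _ _)
  unfold oddBound
  have key := pow_sub_pow_le_pow_sub_pow (u := (ω.rNotZ : ℝ) - 2 * (ω.rX - y))
    (u' := (ω.rNotZ : ℝ) - 2 * (ω.rX - y')) (v := (ω.rZ : ℝ) - 2 * y)
    (v' := (ω.rZ : ℝ) - 2 * y') (by rw [abs_le]; constructor <;> linarith)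
    (by rw [abs_le]; constructor <;> linarith) (by linarith) (by ring) b
  have hnp : (0 : ℝ) ≤ (ω.nK : ℝ) ^ b := by positivity
  have key2 := div_le_div_of_nonneg_right key hnp
  simp only [sub_div, ← div_pow] at key2
  simp only [sub_div] at *
  refine mul_le_mul_of_nonneg_left ?_ (by positivity)
  linarith

theorem oddBound_zero (b : ℕ) (hs : 0 < ω.sK) :
    ω.oddBound b 0 = 1 / 2 * ((ω.nK / b : ℕ) : ℝ) * ((ω.sK : ℝ) / ω.nK) ^ b *
      ((1 - ω.phiZ) ^ b - (1 - ω.phiZ - 2 * ω.phiX) ^ b) := by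
  have hs' : (0 : ℝ) < ω.sK := by exact_mod_cast hs
  have hsum : (ω.rZ : ℝ) + ω.rNotZ = ω.sK := by exact_mod_cast ω.rZ_add_rNotZ
  have e1 : 1 - ω.phiZ = ω.rNotZ / ω.sK := by
    rw [phiZ]
    field_simp
    linarith
  have e2 : 1 - ω.phiZ - 2 * ω.phiX = (ω.rNotZ - 2 * ω.rX) / ω.sK := by
    rw [e1, phiX]
    ring
  have e : ∀ x : ℝ, (x / ω.nK) ^ b = ((ω.sK : ℝ) / ω.nK) ^ b * (x / ω.sK) ^ b := fun x => by
    rw [← mul_pow]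
    congr 1
    field_simp
  rw [e2, e1, oddBound, e (ω.rNotZ : ℝ), e ((ω.rNotZ : ℝ) - 2 * (ω.rX - 0))]
  simp only [sub_zero, mul_zero]
  ring

theorem orderMean_R_le_oddBound_zero {b : ℕ} (hb : 0 < b) (h : ω.rZ + 2 * ω.rX < ω.rNotZ) :
    orderMean (fun σ => ω.R b σ) ≤
      (ω.nK : ℝ) ^ b / (ω.nK.descFactorial b : ℝ) * ω.oddBound b 0 := by
  refine (ω.orderMean_R_le hb).trans (mul_le_mul_of_nonneg_left ?_ (by positivity))
  have h1 : (ω.cls true true : ℝ) ≤ ω.rX := by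
    exact_mod_cast (Nat.le_add_right _ _).trans ω.cls_add_cls_phase.le
  have h2 : (ω.cls true true : ℝ) ≤ ω.rZ := by
    exact_mod_cast (Nat.le_add_right _ _).trans (ω.cls_add_cls true).le
  have h0 : (0 : ℝ) ≤ ω.cls true true := Nat.cast_nonneg _
  exact ω.oddBound_antitoneOn b h ⟨le_rfl, le_min (h0.trans h1) (h0.trans h2)⟩
    ⟨h0, le_min h1 h2⟩ h0

variable {ε : ℝ}

theorem S_tail {b : ℕ} (hb : 2 ≤ b) (hε : 0 < ε) (hε1 : ε < 1) (hs : 0 < ω.sK) :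
    (∑ σ, if (ω.S b σ : ℝ) < blockLower ω.nK b ε ω.sK ω.phiZ then (1 : ℝ) else 0) ≤
      ε * N.factorial := by
  have hL := log_inv_pos hε hε1
  have hn : 0 < ω.nK := hs.trans_le ω.sK_le_nK
  have hd := deltaH_nonneg (ε := ε) (ω.nK : ℝ)
  have h := ω.blockCount_lower_tail (fun C => ω.Uniform C ∧ True) (b := b) (by omega) hε hn
    -- Twice δ_H meets the requirement t² ≥ 2n·log (1/ε) with equality.
    (t := 2 * deltaH ω.nK ε) (by positivity)
    (by rw [mul_pow, deltaH_sq (Nat.cast_nonneg _) hL.le]; apply le_of_eq; ring)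
  refine le_trans (sum_ite_le_of_imp (fun _ => zero_le_one) fun σ hσ => ?_) h
  rw [ω.S_eq_blockCount (by omega)] at hσ
  refine hσ.trans_le ?_
  rw [← ω.orderMean_blockCount (fun C => ω.Uniform C ∧ True) (by omega : 0 < b),
    ← ω.S_eq_blockCount (by omega)]
  have := ω.orderMean_S_ge hb hs
  unfold blockLower
  linarith

theorem oddBound_zero_nonneg (b : ℕ) (h : ω.rZ + 2 * ω.rX < ω.rNotZ) : 0 ≤ ω.oddBound b 0 := by
  have h' : (ω.rZ : ℝ) + 2 * ω.rX < ω.rNotZ := by exact_mod_cast h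
  have hz : (0 : ℝ) ≤ ω.rZ := Nat.cast_nonneg _
  have hx : (0 : ℝ) ≤ ω.rX := Nat.cast_nonneg _
  unfold oddBound
  simp only [sub_zero, mul_zero, add_sub_cancel_right]
  refine mul_nonneg (by positivity) (sub_nonneg.mpr ?_)
  have h1 : 0 ≤ (ω.rNotZ : ℝ) - 2 * ω.rX := by linarith
  gcongr
  linarith

theorem R_tail {b : ℕ} (hb : 2 ≤ b) (hε : 0 < ε) (hε' : ε ≤ 1 / 23)
    (h : ω.rZ + 2 * ω.rX < ω.rNotZ) :
    (∑ σ, if ω.oddBound b 0 + 3 * deltaH ω.nK ε < (ω.R b σ : ℝ) then (1 : ℝ) else 0) ≤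
      ε * N.factorial := by
  have hε1 : ε < 1 := by linarith
  have hL := log_inv_pos hε hε1
  have hL3 := three_le_log_inv hε hε'
  have hs : 0 < ω.sK := by have := ω.rZ_add_rNotZ; omega
  have hn : 0 < ω.nK := hs.trans_le ω.sK_le_nK
  have hnR : (0 : ℝ) < ω.nK := by exact_mod_cast hn
  have hd := deltaH_nonneg (ε := ε) (ω.nK : ℝ)
  have hd2 := deltaH_sq (ε := ε) hnR.le hL.le
  have hB := ω.oddBound_zero_nonneg b h
  have hbR : (2 : ℝ) ≤ b := by exact_mod_cast hb
  rw [ω.R_eq_blockCount (by omega)]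
  -- With at most 3δ_H blocks `R` cannot exceed the bound at all. Otherwise n_K is large compared
  -- with `b`, and replacing n^b/(n)_b by 1 in the mean costs at most one δ_H.
  rcases le_or_gt ((ω.nK / b : ℕ) : ℝ) (3 * deltaH ω.nK ε) with hM | hM
  · have : ∀ σ, ¬ ω.oddBound b 0 + 3 * deltaH ω.nK ε <
        (ω.blockCount b (fun C => ω.Uniform C ∧ ω.OddPhase C) σ : ℝ) := by
      intro σ
      have h1 : (ω.blockCount b (fun C => ω.Uniform C ∧ ω.OddPhase C) σ : ℝ) ≤
        ((ω.nK / b : ℕ) : ℝ) := by exact_mod_cast ω.blockCount_le b _ σ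
      linarith
    simp only [this, if_false, Finset.sum_const_zero]
    positivity
  have htail := ω.blockCount_upper_tail (fun C => ω.Uniform C ∧ ω.OddPhase C) (b := b) (by omega)
    hε hn (t := 2 * deltaH ω.nK ε) (by positivity)
    (by rw [mul_pow, deltaH_sq (Nat.cast_nonneg _) hL.le]; apply le_of_eq; ring)
  refine le_trans (sum_ite_le_of_imp (fun _ => zero_le_one) fun σ hσ => ?_) htail
  refine lt_of_le_of_lt ?_ hσ
  have hmean := ω.orderMean_R_le_oddBound_zero (b := b) (by omega) h
  have hmM : orderMean (fun σ => ω.R b σ) ≤ ((ω.nK / b : ℕ) : ℝ) := by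
    rw [orderMean_eq, div_le_iff₀ (by exact_mod_cast Nat.factorial_pos _)]
    calc (∑ σ, (ω.R b σ : ℝ)) ≤ ∑ _σ : Perm (Fin N), ((ω.nK / b : ℕ) : ℝ) := by
          refine Finset.sum_le_sum fun σ _ => ?_
          rw [ω.R_eq_blockCount (by omega)]
          exact_mod_cast ω.blockCount_le b _ σ
      _ = _ := by simp [Fintype.card_perm, mul_comm]
  rw [← ω.orderMean_blockCount (fun C => ω.Uniform C ∧ ω.OddPhase C) (by omega : 0 < b),
    ← ω.R_eq_blockCount (by omega)]
  generalize hm : orderMean (ω.R b) = m at hmM hmean ⊢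
  have hbn : b ≤ ω.nK := by
    by_contra! hlt
    rw [Nat.div_eq_of_lt hlt, Nat.cast_zero] at hM
    linarith
  have hMn : ((ω.nK / b : ℕ) : ℝ) * b ≤ ω.nK := by exact_mod_cast Nat.div_mul_le_self ω.nK b
  have hm0 : 0 ≤ m := by
    rw [← hm, orderMean_eq]
    exact div_nonneg (Finset.sum_nonneg fun _ _ => Nat.cast_nonneg _) (Nat.cast_nonneg _)
  have hden : (0 : ℝ) < (ω.nK.descFactorial b : ℝ) := by
    exact_mod_cast Nat.descFactorial_pos.mpr hbn
  rw [div_mul_eq_mul_div, le_div_iff₀ hden] at hmean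
  have := le_add_of_mul_descFactorial_le (by omega) hn hm0 hmM hMn hmean hd hM
    (by rw [hd2]; nlinarith)
  linarith

/-- The bound on the logical X-error rate, from bounds on the two numbers of blocks. -/
theorem phi_le_rateUpper {b : ℕ} (hb : 0 < b) (h : ω.rZ + 2 * ω.rX < ω.rNotZ) (hbn : b ≤ ω.nK)
    (hD : 0 < rateDen ω.nK b ε ω.sK ω.phiZ) {σ : Perm (Fin N)}
    (hS : blockLower ω.nK b ε ω.sK ω.phiZ ≤ ω.S b σ)
    (hR : (ω.R b σ : ℝ) ≤ ω.oddBound b 0 + 3 * deltaH ω.nK ε) :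
    0 < ω.S b σ ∧ ω.Phi b σ ≤ rateUpper ω.nK b ε ω.sK ω.phiZ ω.phiX := by
  have hs : 0 < ω.sK := by have := ω.rZ_add_rNotZ; omega
  have hs' : (0 : ℝ) < ω.sK := by exact_mod_cast hs
  have hn : (0 : ℝ) < ω.nK := by exact_mod_cast (by omega : 0 < ω.nK)
  have hM : (0 : ℝ) < ((ω.nK / b : ℕ) : ℝ) := by exact_mod_cast Nat.div_pos hbn hb
  -- The common scale: dividing the bounds on `S` and `R` by `κ` gives the denominator and the
  -- numerator of `rateUpper`.
  set κ : ℝ := ((ω.nK / b : ℕ) : ℝ) * ((ω.sK : ℝ) / ω.nK) ^ b with hκ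
  have hκ0 : 0 < κ := by positivity
  have hΔ : κ * blockDelta ω.nK b ε ω.sK = 3 * deltaH ω.nK ε := by
    rw [hκ, blockDelta, div_pow, div_pow]
    field_simp
  have h1 : blockLower ω.nK b ε ω.sK ω.phiZ = κ * rateDen ω.nK b ε ω.sK ω.phiZ := by
    rw [blockLower, rateDen, mul_sub _ _ (blockDelta _ _ _ _), hΔ]
  have h2 : ω.oddBound b 0 + 3 * deltaH ω.nK ε = κ * (1 / 2 * ((1 - ω.phiZ) ^ b -
      (1 - ω.phiZ - 2 * ω.phiX) ^ b) + blockDelta ω.nK b ε ω.sK) := by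
    rw [mul_add, hΔ, ω.oddBound_zero b hs]
    ring
  rw [h1] at hS
  rw [h2] at hR
  have hS0 : (0 : ℝ) < ω.S b σ := lt_of_lt_of_le (by positivity) hS
  refine ⟨by exact_mod_cast hS0, ?_⟩
  rw [Phi, rateUpper, div_le_div_iff₀ hS0 hD]
  have hR0 : (0 : ℝ) ≤ ω.R b σ := Nat.cast_nonneg _
  set A := 1 / 2 * ((1 - ω.phiZ) ^ b - (1 - ω.phiZ - 2 * ω.phiX) ^ b) +
    blockDelta ω.nK b ε ω.sK
  -- A negative numerator would contradict the nonnegativity of `R`.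
  have hA : 0 ≤ A := by
    by_contra! hA
    nlinarith
  calc (ω.R b σ : ℝ) * rateDen ω.nK b ε ω.sK ω.phiZ
      ≤ κ * A * rateDen ω.nK b ε ω.sK ω.phiZ := by gcongr
    _ = A * (κ * rateDen ω.nK b ε ω.sK ω.phiZ) := by ring
    _ ≤ A * ω.S b σ := by gcongr

end Run

theorem orderLaw_le {N : ℕ} {p : Equiv.Perm (Fin N) → Prop} [DecidablePred p] {ε : ℝ}
    (h : (∑ σ, if p σ then (1 : ℝ) else 0) ≤ ε * N.factorial) :
    (orderLaw N).toOuterMeasure {σ | p σ} ≤ ENNReal.ofReal ε := by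
  have hN : (0 : ℝ) < N.factorial := by exact_mod_cast Nat.factorial_pos _
  rw [PMF.toOuterMeasure_apply_fintype]
  have h1 : ∀ σ, Set.indicator {σ | p σ} (⇑(orderLaw N)) σ =
      ENNReal.ofReal ((if p σ then 1 else 0) / N.factorial) := by
    intro σ
    by_cases hp : p σ
    · rw [Set.indicator_of_mem (show σ ∈ {σ | p σ} from hp), if_pos hp, orderLaw, PMF.uniformOfFintype_apply,
        Fintype.card_perm, Fintype.card_fin, one_div, ENNReal.ofReal_inv_of_pos hN,
        ENNReal.ofReal_natCast]
    · rw [Set.indicator_of_notMem (show σ ∉ {σ | p σ} from hp), if_neg hp, zero_div, ENNReal.ofReal_zero]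
  simp only [h1]
  rw [← ENNReal.ofReal_sum_of_nonneg fun σ _ => by split_ifs <;> positivity]
  apply ENNReal.ofReal_le_ofReal
  rwa [← Finset.sum_div, div_le_iff₀ hN]

/-! ### Probabilities of single outcomes -/

section Outcomes

/-- Every random choice is recorded in the outcome, so each mixture collapses to one term and the
law of a run becomes a product. -/
theorem bind_apply_eq {α β : Type*} (p : PMF α) (q : α → PMF β) (a : α) (y : β)
    (h : ∀ a', y ∈ (q a').support → a' = a) : (p.bind q) y = p a * q a y := by
  rw [PMF.bind_apply]
  refine tsum_eq_single a fun a' ha' => ?_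
  rw [(PMF.apply_eq_zero_iff _ _).mpr fun hy => ha' (h a' hy), mul_zero]

theorem map_apply_of_injective {α β : Type*} (p : PMF α) {f : α → β} (hf : Function.Injective f)
    (a : α) : (p.map f) (f a) = p a := by
  have h := bind_apply_eq p (PMF.pure ∘ f) a (f a) fun a' ha' => by
    rw [Function.comp_apply, PMF.mem_support_pure_iff] at ha'
    exact (hf ha').symm
  simpa [PMF.map] using h

theorem iid_apply {α : Type} (q : PMF α) (n : ℕ) (v : Fin n → α) :
    iid q n v = ∏ i, q (v i) := by
  induction n with
  | zero =>
    rw [Subsingleton.elim v Fin.elim0]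
    simp [iid]
  | succ n ih =>
    rw [iid, bind_apply_eq _ _ (v 0), Fin.prod_univ_succ]
    · have h : v = Fin.cons (v 0) (Fin.tail v) := (Fin.cons_self_tail v).symm
      have h2 := map_apply_of_injective (iid q n)
        (f := fun w : Fin n → α => (Fin.cons (v 0) w : Fin (n + 1) → α))
        (Fin.cons_right_injective (α := fun _ => α) (v 0)) (Fin.tail v)
      rw [← h] at h2
      rw [h2, ih]
      rfl
    · intro a ha
      obtain ⟨w, -, hw⟩ := (PMF.mem_support_map_iff _ _ _).mp ha
      rw [← hw, Fin.cons_zero]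

end Outcomes

/-! ### The probability of a run as an explicit product. -/

namespace Params

variable (P : Params)

theorem mu_nonneg (l : Fin 3) : 0 ≤ P.mu l := by
  have h0 := P.mu_three_nonneg
  have h1 := P.mu_two_gt
  have h2 := P.mu_one_gt
  fin_cases l
  · change 0 ≤ P.mu 0; linarith
  · change 0 ≤ P.mu 1; linarith
  · exact h0

/-- The joint probability of an intensity label and a photon number. -/
noncomputable def labelWeight (l : Fin 3) (k : ℕ) : ℝ :=
  P.p l * Real.exp (-P.mu l) * P.mu l ^ k / (k.factorial : ℝ)

theorem labelWeight_nonneg (l : Fin 3) (k : ℕ) : 0 ≤ P.labelWeight l k := by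
  have := P.mu_nonneg l
  have := P.p_pos l
  unfold labelWeight
  positivity

theorem sum_labelWeight (k : ℕ) : ∑ l, P.labelWeight l k = P.tau k := rfl

theorem mu_zero_pos : 0 < P.mu 0 := by
  have h0 := P.mu_three_nonneg
  have h1 := P.mu_two_gt
  have h2 := P.mu_one_gt
  linarith

theorem mu_one_pos : 0 < P.mu 1 := P.mu_three_nonneg.trans_lt P.mu_two_gt

theorem tau_pos (k : ℕ) : 0 < P.tau k := by
  refine Finset.sum_pos' (fun l _ => P.labelWeight_nonneg l k) ⟨0, Finset.mem_univ _, ?_⟩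
  have := P.mu_zero_pos
  have := P.p_pos 0
  positivity

/-- The probability of the part of a pulse that does not concern the label. -/
noncomputable def basesWeight (B B' : Basis) : ℝ≥0∞ :=
  2⁻¹ * P.basisWeight B * P.basisWeight B'

theorem pulseLaw_apply (x : Pulse) : P.pulseLaw x =
    ENNReal.ofReal (P.labelWeight x.label x.photons) * P.basesWeight x.basisA x.basisB := by
  obtain ⟨l, k, a, B, B'⟩ := x
  have hsupp : ∀ l' k' a' B'', (⟨l, k, a, B, B'⟩ : Pulse) ∈
      (P.basisLaw.map fun B' => (⟨l', k', a', B'', B'⟩ : Pulse)).support →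
      l' = l ∧ k' = k ∧ a' = a ∧ B'' = B := by
    intro l' k' a' B'' h
    obtain ⟨B₁, -, h⟩ := (PMF.mem_support_map_iff _ _ _).mp h
    cases h
    exact ⟨rfl, rfl, rfl, rfl⟩
  rw [pulseLaw, bind_apply_eq _ _ l, bind_apply_eq _ _ k, bind_apply_eq _ _ a,
    bind_apply_eq _ _ B]
  · have h1 := map_apply_of_injective P.basisLaw
      (f := fun B' => (⟨l, k, a, B, B'⟩ : Pulse)) (fun B₁ B₂ h => by cases h; rfl) B'
    have hexp : 0 ≤ Real.exp (-P.mu l) * P.mu l ^ k / (k.factorial : ℝ) := by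
      have := P.mu_nonneg l
      positivity
    have h2 : P.photonLaw l k =
        ENNReal.ofReal (Real.exp (-P.mu l) * P.mu l ^ k / (k.factorial : ℝ)) := by
      rw [photonLaw, MeasureTheory.Measure.toPMF_apply, ProbabilityTheory.poissonMeasure_singleton,
        Real.coe_toNNReal _ (P.mu_nonneg l)]
    rw [h1, h2, labelLaw, PMF.ofFintype_apply, PMF.uniformOfFintype_apply, basisLaw,
      PMF.ofFintype_apply, PMF.ofFintype_apply]
    have h3 : P.labelWeight l k =
        P.p l * (Real.exp (-P.mu l) * P.mu l ^ k / (k.factorial : ℝ)) := by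
      rw [labelWeight]; ring
    simp only [h3, basesWeight]
    rw [ENNReal.ofReal_mul (P.p_pos l).le]
    simp only [Fintype.card_bool, Nat.cast_ofNat]
    ring
  · intro B₁ h
    exact (hsupp _ _ _ _ h).2.2.2
  · intro a₁ h
    obtain ⟨B₁, -, h⟩ := (PMF.mem_support_bind_iff _ _ _).mp h
    exact (hsupp _ _ _ _ h).2.2.1
  · intro k₁ h
    obtain ⟨a₁, -, h⟩ := (PMF.mem_support_bind_iff _ _ _).mp h
    obtain ⟨B₁, -, h⟩ := (PMF.mem_support_bind_iff _ _ _).mp h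
    exact (hsupp _ _ _ _ h).2.1
  · intro l₁ h
    obtain ⟨k₁, -, h⟩ := (PMF.mem_support_bind_iff _ _ _).mp h
    obtain ⟨a₁, -, h⟩ := (PMF.mem_support_bind_iff _ _ _).mp h
    obtain ⟨B₁, -, h⟩ := (PMF.mem_support_bind_iff _ _ _).mp h
    exact (hsupp _ _ _ _ h).1

theorem law_apply (A : Attack P.N) (ω : Run P.N) (σ : Equiv.Perm (Fin P.N)) :
    P.law A (ω, σ) = (∏ i, P.pulseLaw (ω.pulse i)) * (A (fun i => (ω.pulse i).signal) ω.response *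
      (P.testLaw (sifted ω.pulse ω.response .Z) ω.test * (P.N.factorial : ℝ≥0∞)⁻¹)) := by
  obtain ⟨pl, re, te⟩ := ω
  have hsupp : ∀ pl' re' te', ((⟨pl, re, te⟩, σ) : Run P.N × Equiv.Perm (Fin P.N)) ∈
      ((PMF.uniformOfFintype (Equiv.Perm (Fin P.N))).map
        fun σ => ((⟨pl', re', te'⟩, σ) : Run P.N × Equiv.Perm (Fin P.N))).support →
      pl' = pl ∧ re' = re ∧ te' = te := by
    intro pl' re' te' h
    obtain ⟨σ₁, -, h⟩ := (PMF.mem_support_map_iff _ _ _).mp h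
    cases h
    exact ⟨rfl, rfl, rfl⟩
  rw [law, bind_apply_eq _ _ pl, bind_apply_eq _ _ re, bind_apply_eq _ _ te, iid_apply]
  · have h1 := map_apply_of_injective (PMF.uniformOfFintype (Equiv.Perm (Fin P.N)))
      (f := fun σ => ((⟨pl, re, te⟩, σ) : Run P.N × Equiv.Perm (Fin P.N)))
      (fun σ₁ σ₂ h => by cases h; rfl) σ
    rw [h1, PMF.uniformOfFintype_apply, Fintype.card_perm, Fintype.card_fin]
  · intro te' h
    exact (hsupp _ _ _ h).2.2
  · intro re' h
    obtain ⟨te', -, h⟩ := (PMF.mem_support_bind_iff _ _ _).mp h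
    exact (hsupp _ _ _ h).2.1
  · intro pl' h
    obtain ⟨re', -, h⟩ := (PMF.mem_support_bind_iff _ _ _).mp h
    obtain ⟨te', -, h⟩ := (PMF.mem_support_bind_iff _ _ _).mp h
    exact (hsupp _ _ _ h).1

end Params

/-! ### Conditioning on part of a run -/

/-- A conditional probability bound given `r`, stated without division so that fibres of mass zero
need no separate treatment. -/
theorem toOuterMeasure_le_of_fiber {Ω ι R : Type*} [Fintype ι] (μ : PMF Ω) (e : Ω ≃ ι × R)
    (B : Set Ω) (ε : ℝ≥0∞)
    (h : ∀ r, ∑ i, B.indicator μ (e.symm (i, r)) ≤ ε * ∑ i, μ (e.symm (i, r))) :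
    μ.toOuterMeasure B ≤ ε := by
  have hsum : ∀ f : Ω → ℝ≥0∞, ∑' x, f x = ∑' r, ∑ i, f (e.symm (i, r)) := by
    intro f
    rw [← e.symm.tsum_eq f, ENNReal.tsum_prod', ENNReal.tsum_comm]
    simp only [tsum_fintype]
  rw [PMF.toOuterMeasure_apply, hsum]
  calc _ ≤ ∑' r, ε * ∑ i, μ (e.symm (i, r)) := ENNReal.tsum_le_tsum h
    _ = ε * ∑' x, μ x := by rw [ENNReal.tsum_mul_left, hsum μ]
    _ = ε := by rw [μ.tsum_coe, mul_one]

namespace Run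

variable {N : ℕ} (ω : Run N)

/-- The run with other intensity labels. -/
def relabel (l : Fin N → Fin 3) : Run N where
  pulse i := { ω.pulse i with label := l i }
  response := ω.response
  test := ω.test

/-- The single-photon positions that are detected. -/
def detectedSingles : Finset (Fin N) :=
  Finset.univ.filter fun i => (ω.response i).detected = true ∧ (ω.pulse i).photons = 1

/-- The run with permuted labels, bases and test positions. -/
def permute (π : Equiv.Perm (Fin N)) : Run N where
  pulse i :=
    { label := (ω.pulse (π⁻¹ i)).label
      photons := (ω.pulse i).photons
      bit := (ω.pulse i).bit
      basisA := (ω.pulse (π⁻¹ i)).basisA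
      basisB := (ω.pulse (π⁻¹ i)).basisB }
  response := ω.response
  test := ω.test.map π.toEmbedding

/-- Permutation of labels, bases and test positions, as a bijection. -/
def permuteEquiv (π : Equiv.Perm (Fin N)) : Run N ≃ Run N where
  toFun ω := ω.permute π
  invFun ω := ω.permute π⁻¹
  left_inv ω := by
    obtain ⟨pl, re, te⟩ := ω
    simp only [permute, Finset.map_map, inv_inv]
    congr
    · ext i
      simp
    · ext i
      simp
  right_inv ω := by
    obtain ⟨pl, re, te⟩ := ω
    simp only [permute, Finset.map_map, inv_inv]
    congr
    · ext i
      simp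
    · ext i
      simp

/-- A run, split into the labels and the rest. -/
def splitLabels : Run N × Equiv.Perm (Fin N) ≃
    (Fin N → Fin 3) × ((Fin N → ℕ × Bool × Basis × Basis) × (Fin N → Response) ×
      Finset (Fin N) × Equiv.Perm (Fin N)) where
  toFun x := (fun i => (x.1.pulse i).label,
    fun i => ((x.1.pulse i).photons, (x.1.pulse i).bit, (x.1.pulse i).basisA,
      (x.1.pulse i).basisB), x.1.response, x.1.test, x.2)
  invFun y := (⟨fun i => ⟨y.1 i, (y.2.1 i).1, (y.2.1 i).2.1, (y.2.1 i).2.2.1, (y.2.1 i).2.2.2⟩,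
    y.2.2.1, y.2.2.2.1⟩, y.2.2.2.2)
  left_inv _ := rfl
  right_inv _ := rfl

end Run

namespace Params

variable (P : Params)

/-- The conditional probability of an intensity label, given the photon number. -/
noncomputable def labelProb (k : ℕ) (l : Fin 3) : ℝ := P.labelWeight l k / P.tau k

theorem labelProb_nonneg (k : ℕ) (l : Fin 3) : 0 ≤ P.labelProb k l :=
  div_nonneg (P.labelWeight_nonneg l k) (P.tau_pos k).le

theorem sum_labelProb (k : ℕ) : ∑ l, P.labelProb k l = 1 := by
  unfold labelProb
  rw [← Finset.sum_div, P.sum_labelWeight, div_self (P.tau_pos k).ne']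

open Classical in
/-- Given everything else, the intensity labels are independent. -/
theorem label_bound (A : Attack P.N) (B : Set (Run P.N × Equiv.Perm (Fin P.N))) {ε : ℝ}
    (hε : 0 ≤ ε) (h : ∀ (ω : Run P.N) (σ : Equiv.Perm (Fin P.N)), (∑ l : Fin P.N → Fin 3,
      if (ω.relabel l, σ) ∈ B then ∏ i, P.labelProb (ω.pulse i).photons (l i) else 0) ≤ ε) :
    (P.law A).toOuterMeasure B ≤ ENNReal.ofReal ε := by
  refine toOuterMeasure_le_of_fiber _ Run.splitLabels _ _ fun r => ?_
  obtain ⟨r, re, te, σ⟩ := r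
  set ω : (Fin P.N → Fin 3) → Run P.N := fun l =>
    ⟨fun i => ⟨l i, (r i).1, (r i).2.1, (r i).2.2.1, (r i).2.2.2⟩, re, te⟩ with hω
  change ∑ l, B.indicator (P.law A) (ω l, σ) ≤ _ * ∑ l, P.law A (ω l, σ)
  -- Neither the signals nor the sifted positions involve labels, so the remaining factor is the
  -- same for all labellings; the labelling `0` serves as representative.
  obtain ⟨C, hlaw⟩ : ∃ C : ℝ≥0∞, ∀ l, P.law A (ω l, σ) =
      ENNReal.ofReal (∏ i, P.labelWeight (l i) (r i).1) * C := by
    refine ⟨(∏ i, P.basesWeight (r i).2.2.1 (r i).2.2.2) *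
      (A (fun i => ((ω 0).pulse i).signal) re *
        (P.testLaw (sifted (ω 0).pulse re .Z) te * (P.N.factorial : ℝ≥0∞)⁻¹)), fun l => ?_⟩
    have hpulse : ∏ i, P.pulseLaw ((ω l).pulse i) =
        (∏ i, ENNReal.ofReal (P.labelWeight (l i) (r i).1)) *
          ∏ i, P.basesWeight (r i).2.2.1 (r i).2.2.2 :=
      (Finset.prod_congr rfl fun i _ => P.pulseLaw_apply _).trans Finset.prod_mul_distrib
    rw [P.law_apply, hpulse, ENNReal.ofReal_prod_of_nonneg fun i _ => P.labelWeight_nonneg _ _,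
      mul_assoc]
    rfl
  have hw : ∀ l : Fin P.N → Fin 3, ∏ i, P.labelWeight (l i) (r i).1 =
      (∏ i, P.tau (r i).1) * ∏ i, P.labelProb (r i).1 (l i) := by
    intro l
    rw [← Finset.prod_mul_distrib]
    refine Finset.prod_congr rfl fun i _ => ?_
    rw [labelProb, mul_div_cancel₀ _ (P.tau_pos _).ne']
  have hτ : 0 ≤ ∏ i, P.tau (r i).1 := Finset.prod_nonneg fun i _ => (P.tau_pos _).le
  have hp : ∀ l : Fin P.N → Fin 3, 0 ≤ ∏ i, P.labelProb (r i).1 (l i) := fun l =>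
    Finset.prod_nonneg fun i _ => P.labelProb_nonneg _ _
  have hind : ∀ l, B.indicator (P.law A) (ω l, σ) =
      ENNReal.ofReal ((∏ i, P.tau (r i).1) *
        if (ω l, σ) ∈ B then ∏ i, P.labelProb (r i).1 (l i) else 0) * C := by
    intro l
    by_cases hB : (ω l, σ) ∈ B
    · rw [Set.indicator_of_mem hB, if_pos hB, hlaw, hw]
    · rw [Set.indicator_of_notMem hB, if_neg hB]
      simp
  have htot : ∑ l : Fin P.N → Fin 3, ∏ i, P.labelProb (r i).1 (l i) = 1 := by
    rw [← Fintype.prod_sum fun i a => P.labelProb (r i).1 a]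
    simp [P.sum_labelProb]
  simp only [hind, hlaw, hw]
  rw [← Finset.sum_mul, ← Finset.sum_mul, ← ENNReal.ofReal_sum_of_nonneg fun l _ =>
    mul_nonneg hτ (by split_ifs <;> [exact hp l; exact le_rfl]),
    ← ENNReal.ofReal_sum_of_nonneg fun l _ => mul_nonneg hτ (hp l), ← Finset.mul_sum,
    ← Finset.mul_sum, htot, ← mul_assoc, ← ENNReal.ofReal_mul hε]
  gcongr ENNReal.ofReal ?_ * _
  rw [mul_one, mul_comm ε]
  exact mul_le_mul_of_nonneg_left (h (ω 0) σ) hτ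

open Classical in
theorem order_bound (A : Attack P.N) (B : Set (Run P.N × Equiv.Perm (Fin P.N))) {ε : ℝ}
    (h : ∀ ω : Run P.N, (∑ σ, if (ω, σ) ∈ B then (1 : ℝ) else 0) ≤ ε * P.N.factorial) :
    (P.law A).toOuterMeasure B ≤ ENNReal.ofReal ε := by
  refine toOuterMeasure_le_of_fiber _ (Equiv.prodComm _ _) _ _ fun ω => ?_
  change ∑ σ, B.indicator (P.law A) (ω, σ) ≤ _ * ∑ σ, P.law A (ω, σ)
  have hN : (0 : ℝ) < P.N.factorial := by exact_mod_cast Nat.factorial_pos _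
  obtain ⟨C, hlaw⟩ : ∃ C, ∀ σ, P.law A (ω, σ) = C := ⟨_, fun σ => P.law_apply A ω σ⟩
  have hind : ∀ σ, B.indicator (P.law A) (ω, σ) =
      ENNReal.ofReal (if (ω, σ) ∈ B then 1 else 0) * C := by
    intro σ
    by_cases hB : (ω, σ) ∈ B
    · rw [Set.indicator_of_mem hB, if_pos hB, hlaw, ENNReal.ofReal_one, one_mul]
    · rw [Set.indicator_of_notMem hB, if_neg hB, ENNReal.ofReal_zero, zero_mul]
  simp only [hind, hlaw]
  rw [← Finset.sum_mul, ← ENNReal.ofReal_sum_of_nonneg fun σ _ => by split_ifs <;> norm_num,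
    Finset.sum_const, Finset.card_univ, Fintype.card_perm, Fintype.card_fin, nsmul_eq_mul,
    ← mul_assoc, ← ENNReal.ofReal_natCast, ← ENNReal.ofReal_mul' hN.le]
  gcongr ENNReal.ofReal ?_ * _
  exact h ω

end Params

/-! ### Exchangeability of the detected single-photon positions. -/

namespace Run

variable {N : ℕ} (ω : Run N)

section Permute

variable (π : Equiv.Perm ω.detectedSingles)

theorem ofSubtype_inv_mem (i : Fin N) :
    (Equiv.Perm.ofSubtype π)⁻¹ i ∈ ω.detectedSingles ↔ i ∈ ω.detectedSingles := by
  rw [← map_inv]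
  by_cases h : i ∈ ω.detectedSingles
  · rw [Equiv.Perm.ofSubtype_apply_of_mem _ h]
    simp [h]
  · rw [Equiv.Perm.ofSubtype_apply_of_not_mem _ h]

theorem ofSubtype_inv_eq {i : Fin N} (h : i ∉ ω.detectedSingles) :
    (Equiv.Perm.ofSubtype π)⁻¹ i = i := by
  rw [← map_inv, Equiv.Perm.ofSubtype_apply_of_not_mem _ h]

theorem photons_ofSubtype_inv (i : Fin N) :
    (ω.pulse ((Equiv.Perm.ofSubtype π)⁻¹ i)).photons = (ω.pulse i).photons := by
  by_cases h : i ∈ ω.detectedSingles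
  · rw [(Finset.mem_filter.mp h).2.2,
      (Finset.mem_filter.mp ((ω.ofSubtype_inv_mem π i).mpr h)).2.2]
  · rw [ω.ofSubtype_inv_eq π h]

theorem detected_ofSubtype_inv (i : Fin N) :
    (ω.response ((Equiv.Perm.ofSubtype π)⁻¹ i)).detected = (ω.response i).detected := by
  by_cases h : i ∈ ω.detectedSingles
  · rw [(Finset.mem_filter.mp h).2.1,
      (Finset.mem_filter.mp ((ω.ofSubtype_inv_mem π i).mpr h)).2.1]
  · rw [ω.ofSubtype_inv_eq π h]

theorem sifted_permute (B : Basis) :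
    sifted (ω.permute (Equiv.Perm.ofSubtype π)).pulse ω.response B =
      (sifted ω.pulse ω.response B).map (Equiv.Perm.ofSubtype π).toEmbedding := by
  ext i
  rw [Finset.mem_map_equiv, sifted, sifted, Finset.mem_filter, Finset.mem_filter]
  change _ ↔ _ ∧ (ω.response ((Equiv.Perm.ofSubtype π)⁻¹ i)).detected = true ∧ _
  rw [ω.detected_ofSubtype_inv π i]
  simp only [Finset.mem_univ, true_and]
  rfl

end Permute

end Run

namespace Params

variable (P : Params)

/-- Permuted positions all hold one photon, so the pulse weights are merely reordered. The signals
do not change, because they hide label and bases of single photons, and the test law sees the sifted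
set only through its size. -/
theorem law_permute (A : Attack P.N) (ω : Run P.N) (π : Equiv.Perm ω.detectedSingles)
    (σ : Equiv.Perm (Fin P.N)) :
    P.law A (ω.permute (Equiv.Perm.ofSubtype π), σ) = P.law A (ω, σ) := by
  rw [P.law_apply, P.law_apply]
  have hpulse : ∏ i, P.pulseLaw ((ω.permute (Equiv.Perm.ofSubtype π)).pulse i) =
      ∏ i, P.pulseLaw (ω.pulse i) := by
    rw [← Equiv.prod_comp (Equiv.Perm.ofSubtype π)⁻¹ fun i => P.pulseLaw (ω.pulse i)]
    refine Finset.prod_congr rfl fun i _ => ?_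
    rw [P.pulseLaw_apply, P.pulseLaw_apply, ω.photons_ofSubtype_inv π i]
    rfl
  have hsignal : (fun i => ((ω.permute (Equiv.Perm.ofSubtype π)).pulse i).signal) =
      fun i => (ω.pulse i).signal := by
    funext i
    by_cases h : (ω.pulse i).photons = 1
    · simp [Pulse.signal, Run.permute, h]
    · have hi : i ∉ ω.detectedSingles := fun hi => h (Finset.mem_filter.mp hi).2.2
      have e : Equiv.symm (Equiv.Perm.ofSubtype π) i = i := ω.ofSubtype_inv_eq π hi
      simp [Pulse.signal, Run.permute, h, e]
  have htest : P.testLaw (sifted (ω.permute (Equiv.Perm.ofSubtype π)).pulse ω.response .Z)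
      (ω.test.map (Equiv.Perm.ofSubtype π).toEmbedding) =
      P.testLaw (sifted ω.pulse ω.response .Z) ω.test := by
    rw [ω.sifted_permute]
    simp only [testLaw, PMF.uniformOfFinset_apply, Finset.mem_powersetCard,
      Finset.map_subset_map, Finset.card_map, Finset.card_powersetCard]
  rw [hpulse, hsignal]
  congr 3

open Classical in
/-- Given the signals and the responses, the labels, bases and test memberships of the detected
single-photon positions are exchangeable. -/
theorem exchange_bound (A : Attack P.N) (B : Set (Run P.N × Equiv.Perm (Fin P.N))) {ε : ℝ}
    (h : ∀ (ω : Run P.N) (σ : Equiv.Perm (Fin P.N)),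
      (∑ π : Equiv.Perm ω.detectedSingles,
        if (ω.permute (Equiv.Perm.ofSubtype π), σ) ∈ B then (1 : ℝ) else 0) ≤
      ε * (Fintype.card ω.detectedSingles).factorial) :
    (P.law A).toOuterMeasure B ≤ ENNReal.ofReal ε := by
  set μ := P.law A with hμ
  -- The permutation group depends on the run through its detected single photons, so runs are
  -- sorted by this set before averaging.
  have key : ∀ Q : Finset (Fin P.N),
      ∑' x, (if x.1.detectedSingles = Q then B.indicator μ x else 0) ≤
        ENNReal.ofReal ε * ∑' x, (if x.1.detectedSingles = Q then μ x else 0) := by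
    intro Q
    set F : Run P.N × Equiv.Perm (Fin P.N) → ℝ≥0∞ :=
      fun x => if x.1.detectedSingles = Q then B.indicator μ x else 0 with hF
    have hT : ∀ π : Equiv.Perm Q, ∑' x, F x =
        ∑' x, (if x.1.detectedSingles = Q then
          μ x * ENNReal.ofReal (if (x.1.permute (Equiv.Perm.ofSubtype π), x.2) ∈ B
            then 1 else 0) else 0) := by
      intro π
      rw [← Equiv.tsum_eq (Equiv.prodCongr (Run.permuteEquiv (Equiv.Perm.ofSubtype π))
        (Equiv.refl _)) F]
      refine tsum_congr fun x => ?_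
      obtain ⟨ω, σ⟩ := x
      -- Photon numbers and detections are untouched by `permute`, so the permuted run lies in the
      -- same class `Q`.
      change (if ω.detectedSingles = Q then
        B.indicator μ (ω.permute (Equiv.Perm.ofSubtype π), σ) else 0) = _
      by_cases hQ : ω.detectedSingles = Q
      · subst hQ
        rw [if_pos rfl, if_pos rfl, Set.indicator_apply, hμ, P.law_permute]
        split_ifs <;> simp
      · rw [if_neg hQ, if_neg hQ]
    have hfac : ((Fintype.card Q).factorial : ℝ≥0∞) * ∑' x, F x ≤
        ((Fintype.card Q).factorial : ℝ≥0∞) *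
          (ENNReal.ofReal ε * ∑' x, (if x.1.detectedSingles = Q then μ x else 0)) := by
      have h1 : ((Fintype.card Q).factorial : ℝ≥0∞) * ∑' x, F x =
          ∑ π : Equiv.Perm Q, ∑' x, F x := by
        rw [Finset.sum_const, Finset.card_univ, Fintype.card_perm, nsmul_eq_mul]
      rw [h1, Finset.sum_congr rfl fun π _ => hT π, ← tsum_fintype (L := .unconditional _),
        ENNReal.tsum_comm, ← ENNReal.tsum_mul_left, ← ENNReal.tsum_mul_left]
      refine ENNReal.tsum_le_tsum fun x => ?_
      rw [tsum_fintype]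
      obtain ⟨ω, σ⟩ := x
      by_cases hQ : ω.detectedSingles = Q
      · subst hQ
        simp only [if_true]
        rw [← Finset.mul_sum, ← ENNReal.ofReal_sum_of_nonneg fun π _ => by split_ifs <;> norm_num]
        have h2 := ENNReal.ofReal_le_ofReal (h ω σ)
        rw [ENNReal.ofReal_mul' (Nat.cast_nonneg _), ENNReal.ofReal_natCast] at h2
        calc _ ≤ μ (ω, σ) * (ENNReal.ofReal ε *
              ((Fintype.card ω.detectedSingles).factorial : ℝ≥0∞)) := by gcongr
          _ = _ := by ring
      · simp [hQ]
    rwa [ENNReal.mul_le_mul_iff_right (by exact_mod_cast Nat.factorial_ne_zero _)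
      (ENNReal.natCast_ne_top _)] at hfac
  have hsplit : ∀ f : Run P.N × Equiv.Perm (Fin P.N) → ℝ≥0∞, ∑' x, f x =
      ∑ Q : Finset (Fin P.N), ∑' x, (if x.1.detectedSingles = Q then f x else 0) := by
    intro f
    rw [← tsum_fintype (L := .unconditional _), ENNReal.tsum_comm]
    refine tsum_congr fun x => ?_
    rw [tsum_fintype, Finset.sum_ite_eq, if_pos (Finset.mem_univ _)]
  rw [PMF.toOuterMeasure_apply, hsplit]
  refine (Finset.sum_le_sum fun Q _ => key Q).trans_eq ?_
  rw [← Finset.mul_sum, ← hsplit, μ.tsum_coe, mul_one]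

/-- Sampling without replacement among the detected single-photon positions. -/
theorem sampling_bound (A : Attack P.N) (F G E : Run P.N → Finset (Fin P.N))
    (hF : ∀ ω, F ω ⊆ ω.detectedSingles) (hG : ∀ ω, G ω ⊆ ω.detectedSingles)
    (hFG : ∀ ω, Disjoint (F ω) (G ω))
    (hFπ : ∀ ω (π : Equiv.Perm ω.detectedSingles), F (ω.permute (Equiv.Perm.ofSubtype π)) =
      (F ω).map (Equiv.Perm.ofSubtype π).toEmbedding)
    (hGπ : ∀ ω (π : Equiv.Perm ω.detectedSingles), G (ω.permute (Equiv.Perm.ofSubtype π)) =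
      (G ω).map (Equiv.Perm.ofSubtype π).toEmbedding)
    (hEπ : ∀ ω (π : Equiv.Perm ω.detectedSingles), E (ω.permute (Equiv.Perm.ofSubtype π)) = E ω)
    {ε : ℝ} (hε : 0 < ε) (hL : 0 ≤ Real.log (1 / ε)) :
    (P.law A).toOuterMeasure {x | 0 < (F x.1).card ∧ 0 < (G x.1).card ∧
      ((G x.1 ∩ E x.1).card : ℝ) / (G x.1).card + nu (F x.1).card (G x.1).card ε <
        ((F x.1 ∩ E x.1).card : ℝ) / (F x.1).card} ≤ ENNReal.ofReal ε := by
  classical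
  refine P.exchange_bound A _ fun ω σ => ?_
  by_cases hpos : 0 < (F ω).card ∧ 0 < (G ω).card
  · have hcount : ∀ (D : Finset (Fin P.N)) (π : Equiv.Perm ω.detectedSingles),
        D ⊆ ω.detectedSingles → (D.map (Equiv.Perm.ofSubtype π).toEmbedding ∩ E ω).card =
          ((D.subtype (· ∈ ω.detectedSingles)).filter
            fun x => π x ∈ (E ω).subtype (· ∈ ω.detectedSingles)).card := by
      intro D π hD
      rw [← Finset.card_map (Function.Embedding.subtype _)
        (s := (D.subtype (· ∈ ω.detectedSingles)).filter _),
        ← Finset.card_map (Equiv.Perm.ofSubtype π).toEmbedding (s := Finset.map _ _)]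
      congr 1
      ext i
      simp only [Finset.mem_inter, Finset.mem_map, Finset.mem_filter, Finset.mem_subtype,
        Equiv.coe_toEmbedding, Function.Embedding.subtype_apply]
      constructor
      · rintro ⟨⟨x, hx, rfl⟩, hE⟩
        refine ⟨x, ⟨⟨x, hD hx⟩, ⟨hx, ?_⟩, rfl⟩, rfl⟩
        rwa [Equiv.Perm.ofSubtype_apply_of_mem π (hD hx)] at hE
      · rintro ⟨x, ⟨y, ⟨hy, hE⟩, rfl⟩, rfl⟩
        refine ⟨⟨y, hy, rfl⟩, ?_⟩
        rwa [Equiv.Perm.ofSubtype_apply_coe]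
    have hcard : ∀ D ⊆ ω.detectedSingles,
        (D.subtype (· ∈ ω.detectedSingles)).card = D.card := by
      intro D hD
      rw [← Finset.card_map (Function.Embedding.subtype _), Finset.subtype_map,
        Finset.filter_true_of_mem hD]
    have h := serfling_tail ((F ω).subtype (· ∈ ω.detectedSingles))
      ((G ω).subtype (· ∈ ω.detectedSingles)) ((E ω).subtype (· ∈ ω.detectedSingles))
      (Finset.disjoint_left.mpr fun x hx hx' => Finset.disjoint_left.mp (hFG ω)
        (Finset.mem_subtype.mp hx) (Finset.mem_subtype.mp hx'))
      (by rw [hcard _ (hF ω)]; exact hpos.1) (by rw [hcard _ (hG ω)]; exact hpos.2) hε hL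
    refine le_trans (Finset.sum_le_sum fun π _ => ?_) h
    split_ifs with hπ hπ'
    · exact le_rfl
    · refine absurd ?_ hπ'
      obtain ⟨-, -, hπ⟩ := hπ
      dsimp only at hπ
      rw [hFπ, hGπ, hEπ, hcount _ π (hF ω), hcount _ π (hG ω), Finset.card_map,
        Finset.card_map] at hπ
      rwa [hcard _ (hF ω), hcard _ (hG ω)]
    · exact zero_le_one
    · exact le_rfl
  · refine (Finset.sum_eq_zero fun π _ => ?_).trans_le (by positivity)
    · refine if_neg fun hπ => hpos ?_
      obtain ⟨h1, h2, -⟩ := hπ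
      dsimp only at h1 h2
      rw [hFπ, Finset.card_map] at h1
      rw [hGπ, Finset.card_map] at h2
      exact ⟨h1, h2⟩

end Params

/-! ### Tail bounds for the number of positions with a given label -/

section LabelTails

theorem sum_ite_sub_eq_card {ι κ : Type*} [DecidableEq κ] (ρ : ι → κ → ℝ) (I : Finset ι) (a : κ) (l : ι → κ) :
    ∑ i ∈ I, ((if l i = a then 1 else 0) - ρ i a) =
      ((I.filter fun i => l i = a).card : ℝ) - ∑ i ∈ I, ρ i a := by
  rw [Finset.sum_sub_distrib, Finset.card_filter]
  push_cast
  rfl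

variable {ι κ : Type*} [Fintype ι] [DecidableEq ι] [Fintype κ] [DecidableEq κ]

theorem sum_mul_indicator_sub (w : κ → ℝ) (a₀ : κ) (A : Finset κ) (θ : ℝ) :
    ∑ a, w a * ((if a = a₀ then 1 else 0) - θ * if a ∈ A then 1 else 0) =
      w a₀ - θ * ∑ a ∈ A, w a := by
  simp only [mul_sub, mul_ite, mul_one, mul_zero, Finset.sum_sub_distrib, Finset.sum_ite_eq',
    Finset.mem_univ, if_true, Finset.sum_ite_mem, Finset.univ_inter]
  rw [Finset.mul_sum]
  simp only [mul_comm]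

/-- Upper tail of the number of positions with label `a₀`, minus a multiple of the number of the
positions of `J` with label in `A`. -/
theorem thinned_upper_tail (ρ : ι → κ → ℝ) (hρ : ∀ i a, 0 ≤ ρ i a) (hρ1 : ∀ i, ∑ a, ρ i a = 1)
    {I J : Finset ι} (hJ : J ⊆ I) {ε : ℝ} (hε : 0 < ε) (hε1 : ε < 1) {a₀ : κ} {A : Finset κ}
    (ha : a₀ ∈ A) {θ : ℝ} (hθ : 0 ≤ θ) (hθ1 : θ ≤ 1)
    (hθA : ∀ i ∈ J, θ * ∑ a ∈ A, ρ i a ≤ ρ i a₀) :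
    (∑ l : ι → κ, if min (deltaH I.card ε) (deltaCMinus (∑ i ∈ I, ρ i a₀) ε) <
        ∑ i ∈ I, ((if l i = a₀ then 1 else 0) - ρ i a₀) +
          θ * ∑ i ∈ J, (∑ a ∈ A, ρ i a - if l i ∈ A then 1 else 0)
      then ∏ i, ρ i (l i) else 0) ≤ ε := by
  set ϑ : ι → ℝ := fun i => if i ∈ J then θ else 0 with hϑ
  have hϑ0 : ∀ i, 0 ≤ ϑ i := fun i => by simp only [hϑ]; split_ifs <;> [exact hθ; exact le_rfl]
  have hϑ1 : ∀ i, ϑ i ≤ 1 := fun i => by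
    simp only [hϑ]; split_ifs <;> [exact hθ1; exact zero_le_one]
  have hϑA : ∀ i, ϑ i * ∑ a ∈ A, ρ i a ≤ ρ i a₀ := fun i => by
    simp only [hϑ]
    split_ifs with h
    · exact hθA i h
    · rw [zero_mul]; exact hρ i a₀
  set G : ι → κ → ℝ := fun i a => (if a = a₀ then 1 else 0) - ϑ i * if a ∈ A then 1 else 0 with hG
  have hsum : ∀ l : ι → κ, ∑ i ∈ I, ((if l i = a₀ then 1 else 0) - ρ i a₀) +
      θ * ∑ i ∈ J, (∑ a ∈ A, ρ i a - if l i ∈ A then 1 else 0) =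
      ∑ i ∈ I, (G i (l i) - ∑ a, ρ i a * G i a) := by
    intro l
    have h1 : θ * ∑ i ∈ J, (∑ a ∈ A, ρ i a - if l i ∈ A then 1 else 0) =
        ∑ i ∈ I, ϑ i * (∑ a ∈ A, ρ i a - if l i ∈ A then 1 else 0) := by
      simp only [hϑ, ite_mul, zero_mul]
      rw [Finset.sum_ite_mem, Finset.inter_eq_right.mpr hJ, Finset.mul_sum]
    rw [h1, ← Finset.sum_add_distrib]
    refine Finset.sum_congr rfl fun i _ => ?_
    simp only [hG]
    rw [sum_mul_indicator_sub]
    ring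
  simp only [hsum]
  rcases le_total (deltaH I.card ε) (deltaCMinus (∑ i ∈ I, ρ i a₀) ε) with h | h
  · simp only [min_eq_left h]
    refine hoeffding_tail ρ hρ hρ1 I hε hε1 G fun i _ a b => ?_
    have h0 := hϑ0 i
    have h1 := hϑ1 i
    -- The values stay in an interval of length 1, so the thinning costs nothing in Hoeffding's
    -- bound.
    have hlow : ∀ c, -ϑ i ≤ G i c ∧ G i c ≤ 1 - ϑ i := by
      intro c
      simp only [hG]
      by_cases hc : c = a₀
      · rw [hc, if_pos rfl, if_pos ha]
        constructor <;> linarith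
      · rw [if_neg hc]
        split_ifs <;> constructor <;> linarith
    linarith [(hlow a).2, (hlow b).1]
  · simp only [min_eq_right h]
    refine chernoff_upper_tail ρ hρ hρ1 I hε hε1 (fun i a => G i a - ∑ a, ρ i a * G i a)
      (fun i => ρ i a₀) (fun i _ => hρ i a₀) fun i _ s hs => ?_
    have := mgf_indicator_sub_le (ρ i) (hρ i) (hρ1 i) ha (hϑ0 i) (hϑA i) hs
    simpa only [hG, sum_mul_indicator_sub] using this

/-- The case θ = 0. A positive deviation means that the mean is below the count, so the deviation at
the mean may be replaced by that at the count. -/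
theorem count_upper_tail (ρ : ι → κ → ℝ) (hρ : ∀ i a, 0 ≤ ρ i a)
    (hρ1 : ∀ i, ∑ a, ρ i a = 1) (I : Finset ι) {ε : ℝ} (hε : 0 < ε) (hε1 : ε < 1) (a₀ : κ) :
    (∑ l : ι → κ, if deltaMinus I.card ((I.filter fun i => l i = a₀).card : ℝ) ε <
        ((I.filter fun i => l i = a₀).card : ℝ) - ∑ i ∈ I, ρ i a₀
      then ∏ i, ρ i (l i) else 0) ≤ ε := by
  have hL := log_inv_pos hε hε1
  refine le_trans (sum_ite_le_of_imp (fun l => Finset.prod_nonneg fun i _ => hρ i (l i))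
    fun l hl => ?_) (thinned_upper_tail ρ hρ hρ1 (Finset.empty_subset I) hε hε1
      (Finset.mem_singleton_self a₀) le_rfl zero_le_one (by simp))
  rw [zero_mul, add_zero, sum_ite_sub_eq_card]
  have h0 := deltaMinus_nonneg hL.le I.card ((I.filter fun i => l i = a₀).card : ℝ)
  refine lt_of_le_of_lt (min_le_min_left _ (deltaCMinus_mono hL.le ?_)) hl
  linarith

/-- The Chernoff threshold at the mean n is √(2nL); whichever of it and δ_H is smaller decides which
of the two tail bounds applies, so only one ε is spent. -/
theorem count_lower_tail (ρ : ι → κ → ℝ) (hρ : ∀ i a, 0 ≤ ρ i a)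
    (hρ1 : ∀ i, ∑ a, ρ i a = 1) (I : Finset ι) {ε : ℝ} (hε : 0 < ε) (hε1 : ε < 1) (a₀ : κ) :
    (∑ l : ι → κ, if deltaPlus I.card ((I.filter fun i => l i = a₀).card : ℝ) ε <
        ∑ i ∈ I, ρ i a₀ - ((I.filter fun i => l i = a₀).card : ℝ)
      then ∏ i, ρ i (l i) else 0) ≤ ε := by
  have hL := log_inv_pos hε hε1
  have hn : 0 ≤ ∑ i ∈ I, ρ i a₀ := Finset.sum_nonneg fun i _ => hρ i a₀
  have hcard : ∀ l : ι → κ, ∑ i ∈ I, (∑ a ∈ {a₀}, ρ i a - if l i ∈ ({a₀} : Finset κ) then 1 else 0) =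
      ∑ i ∈ I, ρ i a₀ - ((I.filter fun i => l i = a₀).card : ℝ) := by
    intro l
    simp only [Finset.sum_singleton, Finset.mem_singleton]
    rw [← neg_sub, ← sum_ite_sub_eq_card ρ, ← Finset.sum_neg_distrib]
    simp only [neg_sub]
  rcases le_total (deltaH I.card ε) √(2 * (∑ i ∈ I, ρ i a₀) * Real.log (1 / ε)) with h | h
  · refine le_trans (sum_ite_le_of_imp (fun l => Finset.prod_nonneg fun i _ => hρ i (l i))
      fun l hl => ?_) (hoeffding_tail ρ hρ hρ1 I hε hε1 (fun _ a => -if a = a₀ then 1 else 0)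
        fun i _ a b => by split_ifs <;> norm_num)
    have h1 : ∀ i, ∑ a, ρ i a * -(if a = a₀ then 1 else 0) = - ρ i a₀ := fun i => by simp
    simp only [h1]
    have h2 : ∑ i ∈ I, (-(if l i = a₀ then (1 : ℝ) else 0) - - ρ i a₀) =
        ∑ i ∈ I, ρ i a₀ - ((I.filter fun i => l i = a₀).card : ℝ) := by
      rw [← neg_sub, ← sum_ite_sub_eq_card ρ, ← Finset.sum_neg_distrib]
      exact Finset.sum_congr rfl fun i _ => by ring
    rw [h2]
    rcases min_lt_iff.mp hl with h3 | h3
    · exact h3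
    · have := sqrt_lt_of_deltaCPlus_lt hL h3
      rw [add_sub_cancel] at this
      exact h.trans_lt this
  · refine le_trans (sum_ite_le_of_imp (fun l => Finset.prod_nonneg fun i _ => hρ i (l i))
      fun l hl => ?_) (chernoff_lower_tail ρ hρ hρ1 I hε hε1 {a₀}
        (t := √(2 * (∑ i ∈ I, ρ i a₀) * Real.log (1 / ε))) (Real.sqrt_nonneg _) ?_)
    · rw [hcard]
      rcases min_lt_iff.mp hl with h3 | h3
      · exact h.trans_lt h3
      · have := sqrt_lt_of_deltaCPlus_lt hL h3
        rwa [add_sub_cancel] at this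
    · rw [Real.sq_sqrt (by positivity)]
      simp only [Finset.sum_singleton, le_refl]

/-- The threshold is now evaluated at the observed count. If the count falls below its mean,
monotonicity no longer helps, and a second event controls the thinned term; hence 2ε. -/
theorem thinned_count_upper_tail (ρ : ι → κ → ℝ) (hρ : ∀ i a, 0 ≤ ρ i a)
    (hρ1 : ∀ i, ∑ a, ρ i a = 1) {I J : Finset ι} {ε : ℝ} (hε : 0 < ε) (hε1 : ε < 1) (hJ : J ⊆ I) {a₀ : κ} {A : Finset κ}
    (ha : a₀ ∈ A) {θ : ℝ} (hθ : 0 < θ) (hθ1 : θ ≤ 1)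
    (hθA : ∀ i ∈ J, θ * ∑ a ∈ A, ρ i a ≤ ρ i a₀) :
    (∑ l : ι → κ, if deltaMinus I.card ((I.filter fun i => l i = a₀).card : ℝ) ε <
        ((I.filter fun i => l i = a₀).card : ℝ) - ∑ i ∈ I, ρ i a₀ +
          θ * (∑ i ∈ J, ∑ a ∈ A, ρ i a - ((J.filter fun i => l i ∈ A).card : ℝ))
      then ∏ i, ρ i (l i) else 0) ≤ 2 * ε := by
  have hL := log_inv_pos hε hε1
  have hn : 0 ≤ ∑ i ∈ I, ρ i a₀ := Finset.sum_nonneg fun i _ => hρ i a₀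
  have hprod : ∀ l : ι → κ, 0 ≤ ∏ i, ρ i (l i) := fun l => Finset.prod_nonneg fun i _ => hρ i (l i)
  have h1 := thinned_upper_tail ρ hρ hρ1 hJ hε hε1 ha hθ.le hθ1 hθA
  have h2 := chernoff_lower_tail ρ hρ hρ1 J hε hε1 A
    (t := √(2 * (∑ i ∈ I, ρ i a₀) * Real.log (1 / ε)) / θ) (by positivity) (by
      rw [div_pow, Real.sq_sqrt (by positivity), le_div_iff₀ (by positivity)]
      have h3 : θ * ∑ i ∈ J, ∑ a ∈ A, ρ i a ≤ ∑ i ∈ I, ρ i a₀ := by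
        rw [Finset.mul_sum]
        exact (Finset.sum_le_sum hθA).trans
          (Finset.sum_le_sum_of_subset_of_nonneg hJ fun i _ _ => hρ i a₀)
      have h4 : 0 ≤ ∑ i ∈ J, ∑ a ∈ A, ρ i a :=
        Finset.sum_nonneg fun i _ => Finset.sum_nonneg fun a _ => hρ i a
      calc _ = 2 * (θ * (θ * ∑ i ∈ J, ∑ a ∈ A, ρ i a)) * Real.log (1 / ε) := by ring
        _ ≤ 2 * (1 * (∑ i ∈ I, ρ i a₀)) * Real.log (1 / ε) := by gcongr
        _ = _ := by ring)
  refine le_trans ?_ ((add_le_add h1 h2).trans_eq (two_mul ε).symm)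
  rw [← Finset.sum_add_distrib]
  refine Finset.sum_le_sum fun l _ => ?_
  have hc : ∑ i ∈ J, (∑ a ∈ A, ρ i a - if l i ∈ A then 1 else 0) =
      ∑ i ∈ J, ∑ a ∈ A, ρ i a - ((J.filter fun i => l i ∈ A).card : ℝ) := by
    rw [Finset.sum_sub_distrib, Finset.card_filter]
    push_cast
    rfl
  rw [sum_ite_sub_eq_card, hc]
  set c : ℝ := ((I.filter fun i => l i = a₀).card : ℝ) with hcdef
  set u := ∑ i ∈ J, ∑ a ∈ A, ρ i a - ((J.filter fun i => l i ∈ A).card : ℝ)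
  set n := ∑ i ∈ I, ρ i a₀
  have hc0 : 0 ≤ c := Nat.cast_nonneg _
  split_ifs with hl hm hu hu
  · linarith [hprod l]
  · linarith [hprod l]
  · linarith [hprod l]
  · exfalso
    rw [not_lt, le_div_iff₀ hθ, mul_comm] at hu
    refine hm (lt_of_le_of_lt ?_ hl)
    rcases le_total n c with h | h
    · exact min_le_min_left _ (deltaCMinus_mono hL.le h)
    -- Here c ≤ n. Outside the second event θu ≤ √(2nL) ≤ `deltaCMinus c` + (n - c), so the Chernoff
    -- alternative cannot occur; the Hoeffding alternative already belongs to the first event.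
    · exfalso
      rcases min_lt_iff.mp hl with h3 | h3
      · exact hm ((min_le_left _ _).trans_lt h3)
      · have := sqrt_le_deltaCMinus_add hL hc0 (sub_nonneg.mpr h)
        rw [add_sub_cancel] at this
        linarith
  all_goals linarith [hprod l]

end LabelTails

/-! ### Decoy-state estimates -/

/-- Applied to the two weaker intensities, whose sum is below the strongest one: this makes the
multi-photon contribution to the decoy form nonpositive. -/
theorem pow_sub_pow_le_mul_add_pow {a b : ℝ} (hb : 0 ≤ b) (hab : b ≤ a) (k : ℕ) :
    a ^ (k + 2) - b ^ (k + 2) ≤ (a ^ 2 - b ^ 2) * (a + b) ^ k := by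
  have ha := hb.trans hab
  induction k with
  | zero => simp
  | succ k ih =>
    have h1 : b ^ (k + 1) ≤ a ^ (k + 1) := pow_le_pow_left₀ hb hab _
    have h2 : a ^ (k + 1 + 2) - b ^ (k + 1 + 2) =
        (a + b) * (a ^ (k + 2) - b ^ (k + 2)) - a * b * (a ^ (k + 1) - b ^ (k + 1)) := by ring
    have h3 : 0 ≤ a * b * (a ^ (k + 1) - b ^ (k + 1)) :=
      mul_nonneg (mul_nonneg ha hb) (sub_nonneg.mpr h1)
    calc _ ≤ (a + b) * (a ^ (k + 2) - b ^ (k + 2)) := by linarith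
      _ ≤ (a + b) * ((a ^ 2 - b ^ 2) * (a + b) ^ k) := by gcongr
      _ = _ := by ring

namespace Run

variable {N : ℕ} (ω : Run N)

/-- The positions of `f` where the bits of Alice and Bob differ. -/
def errors (f : SetName) : Finset (Fin N) := (ω.pos f).filter fun i => ω.aliceBit i ≠ ω.bobBit i

/-- The number of positions of `D` with intensity label `l`. -/
def count (D : Finset (Fin N)) (l : Fin 3) : ℕ := (D.filter fun i => (ω.pulse i).label = l).card

/-- The single-photon positions of `D`. -/
def singles (D : Finset (Fin N)) : Finset (Fin N) := D.filter fun i => (ω.pulse i).photons = 1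

theorem n_eq_count (f : SetName) (l : Fin 3) : ω.n f l = ω.count (ω.pos f) l := rfl

theorem m_eq_count (f : SetName) (l : Fin 3) : ω.m f l = ω.count (ω.errors f) l := by
  rw [m, count, errors, Finset.filter_filter]
  simp only [and_comm]

theorem sum_count (D : Finset (Fin N)) : ∑ l, ω.count D l = D.card :=
  (Finset.card_eq_sum_card_fiberwise fun _ _ => Finset.mem_univ _).symm

theorem nTot_eq_card (f : SetName) : ω.nTot f = (ω.pos f).card := ω.sum_count _

theorem mTot_eq_card (f : SetName) : ω.mTot f = (ω.errors f).card := by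
  rw [mTot, ← ω.sum_count]
  exact Finset.sum_congr rfl fun l _ => ω.m_eq_count f l

theorem pos_relabel (l : Fin N → Fin 3) (f : SetName) : (ω.relabel l).pos f = ω.pos f := by
  cases f <;> rfl

theorem errors_relabel (l : Fin N → Fin 3) (f : SetName) :
    (ω.relabel l).errors f = ω.errors f := by
  cases f <;> rfl

theorem sK_eq : ω.sK = ((ω.singles (ω.pos .Z)).filter
    fun i => (ω.pulse i).label ∈ ({0, 1} : Finset (Fin 3))).card := by
  rw [sK, single, key, singles, Finset.filter_filter, Finset.filter_filter]
  congr 1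
  ext i
  rw [Finset.mem_filter, Finset.mem_filter, and_congr_right_iff]
  intro _
  rw [and_comm, and_congr_right_iff]
  intro _
  generalize (ω.pulse i).label = l
  fin_cases l <;> decide

end Run

namespace Params

variable (P : Params)

/-- The conditional expectation of the number of positions of `D` with intensity label `l`. -/
noncomputable def countMean {N : ℕ} (ω : Run N) (D : Finset (Fin N)) (l : Fin 3) : ℝ :=
  ∑ i ∈ D, P.labelProb (ω.pulse i).photons l

/-- The common denominator of `s_f⁻`. -/
noncomputable def decoyDen : ℝ := P.mu 0 * (P.mu 1 - P.mu 2) - (P.mu 1 ^ 2 - P.mu 2 ^ 2)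

theorem decoyDen_eq : P.decoyDen = (P.mu 1 - P.mu 2) * (P.mu 0 - (P.mu 1 + P.mu 2)) := by
  rw [decoyDen]; ring

theorem decoyDen_pos : 0 < P.decoyDen := by
  rw [decoyDen_eq]
  exact mul_pos (sub_pos.mpr P.mu_two_gt) (sub_pos.mpr P.mu_one_gt)

/-- The estimate of the number of single-photon events as a linear function of three counts. -/
noncomputable def decoyForm (x₀ x₁ x₂ : ℝ) : ℝ :=
  P.tau 1 * P.mu 0 / P.decoyDen *
    ((1 - (P.mu 1 + P.mu 2) * P.mu 2 / P.mu 0 ^ 2) * (Real.exp (P.mu 1) / P.p 1) * x₁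
      - (1 - (P.mu 1 + P.mu 2) * P.mu 1 / P.mu 0 ^ 2) * (Real.exp (P.mu 2) / P.p 2) * x₂
      - (P.mu 1 ^ 2 - P.mu 2 ^ 2) / P.mu 0 ^ 2 * (Real.exp (P.mu 0) / P.p 0) * x₀)

theorem mu_facts : 0 < P.mu 0 ∧ 0 < P.mu 1 ∧ 0 ≤ P.mu 2 ∧ P.mu 2 < P.mu 1 ∧
    P.mu 1 + P.mu 2 < P.mu 0 :=
  ⟨P.mu_zero_pos, P.mu_one_pos, P.mu_three_nonneg, P.mu_two_gt, P.mu_one_gt⟩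

theorem decoy_coeff_one_pos : 0 < 1 - (P.mu 1 + P.mu 2) * P.mu 2 / P.mu 0 ^ 2 := by
  obtain ⟨h0, h1, h2, h3, h4⟩ := P.mu_facts
  rw [sub_pos, div_lt_one (by positivity)]
  nlinarith

theorem decoy_coeff_two_pos : 0 < 1 - (P.mu 1 + P.mu 2) * P.mu 1 / P.mu 0 ^ 2 := by
  obtain ⟨h0, h1, h2, h3, h4⟩ := P.mu_facts
  rw [sub_pos, div_lt_one (by positivity)]
  nlinarith

/-- The weight e^μ/p removes all dependence on the label except the power μ^k. -/
theorem exp_div_mul_labelProb (k : ℕ) (l : Fin 3) :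
    Real.exp (P.mu l) / P.p l * P.labelProb k l = P.mu l ^ k / (k.factorial * P.tau k) := by
  have h1 := (P.p_pos l).ne'
  have h2 := (P.tau_pos k).ne'
  have h3 : (k.factorial : ℝ) ≠ 0 := by exact_mod_cast k.factorial_ne_zero
  rw [labelProb, labelWeight, Real.exp_neg]
  have h4 := Real.exp_ne_zero (P.mu l)
  field_simp

theorem decoyForm_mono {x₀ x₁ x₂ y₀ y₁ y₂ : ℝ} (h₀ : y₀ ≤ x₀) (h₁ : x₁ ≤ y₁) (h₂ : y₂ ≤ x₂) :
    P.decoyForm x₀ x₁ x₂ ≤ P.decoyForm y₀ y₁ y₂ := by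
  obtain ⟨m0, m1, m2, m3, m4⟩ := P.mu_facts
  have hp := P.p_pos
  have ht := P.tau_pos 1
  have hd := P.decoyDen_pos
  have hκ : 0 ≤ (P.mu 1 ^ 2 - P.mu 2 ^ 2) / P.mu 0 ^ 2 :=
    div_nonneg (by nlinarith) (by positivity)
  have c1 := P.decoy_coeff_one_pos
  have c2 := P.decoy_coeff_two_pos
  have := hp 0
  have := hp 1
  have := hp 2
  unfold decoyForm
  gcongr

/-- The coefficients cancel the vacuum term and normalise the single-photon term to 1. For k ≥ 2 the
strongest intensity outweighs the difference of the other two. -/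
theorem decoyForm_labelProb_le (k : ℕ) :
    P.decoyForm (P.labelProb k 0) (P.labelProb k 1) (P.labelProb k 2) ≤
      if k = 1 then 1 else 0 := by
  obtain ⟨m0, m1, m2, m3, m4⟩ := P.mu_facts
  have ht := P.tau_pos
  have hd := P.decoyDen_pos
  have hform : P.decoyForm (P.labelProb k 0) (P.labelProb k 1) (P.labelProb k 2) =
      P.tau 1 * P.mu 0 / (P.decoyDen * (k.factorial * P.tau k)) *
    ((1 - (P.mu 1 + P.mu 2) * P.mu 2 / P.mu 0 ^ 2) * P.mu 1 ^ k
      - (1 - (P.mu 1 + P.mu 2) * P.mu 1 / P.mu 0 ^ 2) * P.mu 2 ^ k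
      - (P.mu 1 ^ 2 - P.mu 2 ^ 2) / P.mu 0 ^ 2 * P.mu 0 ^ k) := by
    rw [decoyForm]
    simp only [mul_assoc, exp_div_mul_labelProb]
    rw [← div_div]
    ring
  rw [hform]
  match k with
  | 0 =>
    refine (mul_eq_zero_of_right _ ?_).le
    field_simp
    ring
  | 1 =>
    refine le_of_eq ?_
    rw [if_pos rfl, decoyDen_eq]
    have h1 := (ht 1).ne'
    have h2 := (sub_pos.mpr m3).ne'
    have h3 := (sub_pos.mpr m4).ne'
    field_simp
    simp only [Nat.factorial_one, Nat.cast_one]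
    ring
  | k + 2 =>
    rw [if_neg (by omega)]
    have hC : 0 ≤ P.tau 1 * P.mu 0 / (P.decoyDen * ((k + 2).factorial * P.tau (k + 2))) := by
      have := ht 1
      have := ht (k + 2)
      positivity
    refine mul_nonpos_of_nonneg_of_nonpos hC ?_
    have h1 := pow_sub_pow_le_mul_add_pow m2 m3.le k
    have h2 : (P.mu 1 + P.mu 2) ^ k ≤ P.mu 0 ^ k := pow_le_pow_left₀ (by positivity) m4.le _
    have h3 : 0 ≤ P.mu 1 ^ 2 - P.mu 2 ^ 2 := by nlinarith
    have h4 : 0 ≤ (P.mu 1 + P.mu 2) / P.mu 0 ^ 2 * (P.mu 1 * P.mu 2) *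
        (P.mu 1 ^ (k + 1) - P.mu 2 ^ (k + 1)) :=
      mul_nonneg (by positivity) (sub_nonneg.mpr (pow_le_pow_left₀ m2 m3.le _))
    have h5 := mul_le_mul_of_nonneg_left h2 h3
    have h6 : (P.mu 1 ^ 2 - P.mu 2 ^ 2) / P.mu 0 ^ 2 * P.mu 0 ^ (k + 2) =
        (P.mu 1 ^ 2 - P.mu 2 ^ 2) * P.mu 0 ^ k := by
      field_simp
      ring
    rw [h6]
    have h7 : (1 - (P.mu 1 + P.mu 2) * P.mu 2 / P.mu 0 ^ 2) * P.mu 1 ^ (k + 2)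
      - (1 - (P.mu 1 + P.mu 2) * P.mu 1 / P.mu 0 ^ 2) * P.mu 2 ^ (k + 2) =
      P.mu 1 ^ (k + 2) - P.mu 2 ^ (k + 2) - (P.mu 1 + P.mu 2) / P.mu 0 ^ 2 * (P.mu 1 * P.mu 2) *
        (P.mu 1 ^ (k + 1) - P.mu 2 ^ (k + 1)) := by ring
    rw [h7]
    linarith

theorem decoyForm_countMean_le {N : ℕ} (ω : Run N) (D : Finset (Fin N)) :
    P.decoyForm (P.countMean ω D 0) (P.countMean ω D 1) (P.countMean ω D 2) ≤
      (ω.singles D).card := by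
  have h : P.decoyForm (P.countMean ω D 0) (P.countMean ω D 1) (P.countMean ω D 2) =
      ∑ i ∈ D, P.decoyForm (P.labelProb (ω.pulse i).photons 0)
        (P.labelProb (ω.pulse i).photons 1) (P.labelProb (ω.pulse i).photons 2) := by
    simp only [decoyForm, countMean, Finset.mul_sum, Finset.sum_sub_distrib, mul_sub]
  rw [h, Run.singles, Finset.card_filter]
  push_cast
  exact Finset.sum_le_sum fun i _ => P.decoyForm_labelProb_le _

section Estimates

variable {P}

theorem nMinus_le_nPlus {ε : ℝ} (hL : 0 ≤ Real.log (1 / ε)) (ω : Run P.N) (f : SetName)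
    (l : Fin 3) : P.nMinus ε ω f l ≤ P.nPlus ε ω f l := by
  have h1 := deltaMinus_nonneg hL (ω.nTot f) (ω.n f l)
  have h2 := deltaPlus_nonneg hL (ω.nTot f) (ω.n f l)
  unfold nMinus nPlus
  linarith

/-- In the formula labels `1` and `2` enter twice, with opposite roundings because of the vacuum
estimate. Using one rounding per label only increases the value, so three count events suffice. -/
theorem sMinus_le_decoyForm {ε : ℝ} (hL : 0 ≤ Real.log (1 / ε)) (ω : Run P.N) (f : SetName) :
    P.sMinus ε ω f ≤ P.decoyForm (P.nPlus ε ω f 0) (P.nMinus ε ω f 1) (P.nPlus ε ω f 2) := by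
  obtain ⟨m0, m1, m2, m3, m4⟩ := P.mu_facts
  have h1 := nMinus_le_nPlus hL ω f 1
  have h2 := nMinus_le_nPlus hL ω f 2
  have hd := P.decoyDen_pos
  have ht := P.tau_pos 1
  have hτ := (P.tau_pos 0).ne'
  have h3 : 0 < P.mu 1 - P.mu 2 := sub_pos.mpr m3
  have p1 := P.p_pos 1
  have p2 := P.p_pos 2
  have hdiff : P.decoyForm (P.nPlus ε ω f 0) (P.nMinus ε ω f 1) (P.nPlus ε ω f 2) -
      P.sMinus ε ω f = P.tau 1 * P.mu 0 / P.decoyDen *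
        ((P.mu 1 + P.mu 2) * P.mu 2 / P.mu 0 ^ 2 * (Real.exp (P.mu 1) / P.p 1) *
          (P.nPlus ε ω f 1 - P.nMinus ε ω f 1) +
        (P.mu 1 + P.mu 2) * P.mu 1 / P.mu 0 ^ 2 * (Real.exp (P.mu 2) / P.p 2) *
          (P.nPlus ε ω f 2 - P.nMinus ε ω f 2)) := by
    have h4 : (P.mu 1 ^ 2 - P.mu 2 ^ 2) / P.mu 0 ^ 2 * (P.oMinus ε ω f / P.tau 0) =
        (P.mu 1 + P.mu 2) / P.mu 0 ^ 2 * (P.mu 1 * Real.exp (P.mu 2) * P.nMinus ε ω f 2 / P.p 2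
      - P.mu 2 * Real.exp (P.mu 1) * P.nPlus ε ω f 1 / P.p 1) := by
      rw [oMinus]
      have h5 := h3.ne'
      have h6 := p1.ne'
      have h7 := p2.ne'
      field_simp
      ring
    rw [sMinus, decoyForm, ← decoyDen, mul_sub ((P.mu 1 ^ 2 - P.mu 2 ^ 2) / P.mu 0 ^ 2), h4]
    ring
  rw [← sub_nonneg, hdiff]
  have h4 := sub_nonneg.mpr h1
  have h5 := sub_nonneg.mpr h2
  positivity

theorem sMinus_le {ε : ℝ} (hL : 0 ≤ Real.log (1 / ε)) (ω : Run P.N) (f : SetName)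
    (h₀ : P.countMean ω (ω.pos f) 0 ≤ P.nPlus ε ω f 0)
    (h₁ : P.nMinus ε ω f 1 ≤ P.countMean ω (ω.pos f) 1)
    (h₂ : P.countMean ω (ω.pos f) 2 ≤ P.nPlus ε ω f 2) :
    P.sMinus ε ω f ≤ (ω.singles (ω.pos f)).card :=
  (sMinus_le_decoyForm hL ω f).trans
    ((P.decoyForm_mono h₀ h₁ h₂).trans (P.decoyForm_countMean_le ω _))

/-- Position by position the form is proportional to μ₂^k - μ₃^k: it equals 1 at k = 1 and is
nonnegative for every other k. -/
theorem le_ePlus {ε : ℝ} (ω : Run P.N) (f : SetName)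
    (h₁ : P.countMean ω (ω.errors f) 1 ≤ P.mPlus ε ω f 1)
    (h₂ : P.mMinus ε ω f 2 ≤ P.countMean ω (ω.errors f) 2) :
    ((ω.singles (ω.errors f)).card : ℝ) ≤ P.ePlus ε ω f := by
  obtain ⟨m0, m1, m2, m3, m4⟩ := P.mu_facts
  have ht := P.tau_pos
  have h3 : 0 < P.mu 1 - P.mu 2 := sub_pos.mpr m3
  have p1 := P.p_pos 1
  have p2 := P.p_pos 2
  calc ((ω.singles (ω.errors f)).card : ℝ)
      ≤ ∑ i ∈ ω.errors f, P.tau 1 / (P.mu 1 - P.mu 2) *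
        (Real.exp (P.mu 1) / P.p 1 * P.labelProb (ω.pulse i).photons 1 -
          Real.exp (P.mu 2) / P.p 2 * P.labelProb (ω.pulse i).photons 2) := by
        rw [Run.singles, Finset.card_filter]
        push_cast
        refine Finset.sum_le_sum fun i _ => ?_
        generalize (ω.pulse i).photons = k
        rw [exp_div_mul_labelProb, exp_div_mul_labelProb, ← sub_div]
        split_ifs with hk
        · subst hk
          have := (ht 1).ne'
          have := h3.ne'
          simp only [Nat.factorial_one, Nat.cast_one, one_mul, pow_one]
          field_simp
          exact le_rfl
        · have := ht 1
          have := ht k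
          have := sub_nonneg.mpr (pow_le_pow_left₀ m2 m3.le k)
          positivity
    _ = P.tau 1 / (P.mu 1 - P.mu 2) * (Real.exp (P.mu 1) / P.p 1 * P.countMean ω (ω.errors f) 1 -
          Real.exp (P.mu 2) / P.p 2 * P.countMean ω (ω.errors f) 2) := by
        simp only [countMean, Finset.mul_sum, Finset.sum_sub_distrib, mul_sub]
    _ ≤ P.tau 1 / (P.mu 1 - P.mu 2) * (Real.exp (P.mu 1) / P.p 1 * P.mPlus ε ω f 1 -
          Real.exp (P.mu 2) / P.p 2 * P.mMinus ε ω f 2) := by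
        have := ht 1
        gcongr
    _ = P.ePlus ε ω f := by
        rw [ePlus]
        ring

end Estimates

/-! ### The estimate of s_K. -/

/-- The conditional probability that a single-photon pulse has one of the two larger
intensities. -/
theorem tauOneKey_div : P.tauOneKey / P.tau 1 = P.labelProb 1 0 + P.labelProb 1 1 := by
  simp only [tauOneKey, labelProb, labelWeight, pow_one, Nat.factorial_one, Nat.cast_one, div_one]
  ring

/-- The change of `s_K⁻` per count of label `1`. -/
noncomputable def keySlope : ℝ :=
  P.tauOneKey / P.tau 1 * (P.tau 1 * P.mu 0 / P.decoyDen *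
    ((1 - (P.mu 1 + P.mu 2) * P.mu 2 / P.mu 0 ^ 2) * (Real.exp (P.mu 1) / P.p 1)))

theorem tauOneKey_pos : 0 < P.tauOneKey := by
  obtain ⟨m0, m1, m2, m3, m4⟩ := P.mu_facts
  have := P.p_pos 0
  have := P.p_pos 1
  unfold tauOneKey
  positivity

theorem keySlope_pos : 0 < P.keySlope := by
  have := P.mu_zero_pos
  have := P.p_pos 1
  have := P.decoy_coeff_one_pos
  have := P.tauOneKey_pos
  have := P.tau_pos 1
  have := P.decoyDen_pos
  unfold keySlope
  positivity

/-- With θ = 1/`keySlope` this is the condition θ·P(label in K) ≤ P(label `1`) for single photons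
under which thinning is free of charge. -/
theorem key_prob_le_keySlope_mul :
    P.labelProb 1 0 + P.labelProb 1 1 ≤ P.keySlope * P.labelProb 1 1 := by
  obtain ⟨m0, m1, m2, m3, m4⟩ := P.mu_facts
  have ht := P.tau_pos 1
  have hd := P.decoyDen_pos
  have hq : 0 < P.tauOneKey / P.tau 1 := div_pos P.tauOneKey_pos ht
  have h := P.exp_div_mul_labelProb 1 1
  simp only [Nat.factorial_one, Nat.cast_one, one_mul, pow_one] at h
  have h1 : P.keySlope * P.labelProb 1 1 = P.tauOneKey / P.tau 1 * (P.mu 0 / P.decoyDen *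
      ((1 - (P.mu 1 + P.mu 2) * P.mu 2 / P.mu 0 ^ 2) * P.mu 1)) := by
    calc _ = P.tauOneKey / P.tau 1 * (P.tau 1 * P.mu 0 / P.decoyDen *
      ((1 - (P.mu 1 + P.mu 2) * P.mu 2 / P.mu 0 ^ 2) *
        (Real.exp (P.mu 1) / P.p 1 * P.labelProb 1 1))) := by rw [keySlope]; ring
      _ = _ := by
        rw [h]
        have := ht.ne'
        field_simp
  rw [h1, ← tauOneKey_div]
  refine le_mul_of_one_le_right hq.le ?_
  rw [div_mul_eq_mul_div, one_le_div hd, decoyDen]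
  have h2 : P.mu 0 * ((1 - (P.mu 1 + P.mu 2) * P.mu 2 / P.mu 0 ^ 2) * P.mu 1) =
      P.mu 0 * P.mu 1 - (P.mu 1 + P.mu 2) * P.mu 1 / P.mu 0 * P.mu 2 := by
    field_simp
  have h3 : (P.mu 1 + P.mu 2) * P.mu 1 / P.mu 0 ≤ P.mu 0 := by
    rw [div_le_iff₀ m0]
    nlinarith
  have h4 := mul_le_mul_of_nonneg_right h3 m2
  rw [h2]
  nlinarith

/-- Lowering the mean count of label `1` by u/`keySlope` lowers the estimate by exactly u. Taking u
as the shortfall of s_K from its conditional mean turns a bound on that mean into a bound on s_K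
itself. -/
theorem sKMinus_le {ε : ℝ} (hL : 0 ≤ Real.log (1 / ε)) (ω : Run P.N)
    (h₀ : P.countMean ω (ω.pos .Z) 0 ≤ P.nPlus ε ω .Z 0)
    (h₁ : P.nMinus ε ω .Z 1 ≤ P.countMean ω (ω.pos .Z) 1 -
      1 / P.keySlope * (P.tauOneKey / P.tau 1 * (ω.singles (ω.pos .Z)).card - ω.sK))
    (h₂ : P.countMean ω (ω.pos .Z) 2 ≤ P.nPlus ε ω .Z 2) :
    P.sKMinus ε ω ≤ ω.sK := by
  have ht := P.tau_pos 1
  have hq : 0 < P.tauOneKey / P.tau 1 := div_pos P.tauOneKey_pos ht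
  have hs := P.keySlope_pos.ne'
  have h3 := (sMinus_le_decoyForm hL ω .Z).trans (P.decoyForm_mono h₀ h₁ h₂)
  have h4 := P.decoyForm_countMean_le ω (ω.pos .Z)
  set u := P.tauOneKey / P.tau 1 * (ω.singles (ω.pos .Z)).card - ω.sK with hu
  have h5 : P.tauOneKey / P.tau 1 * P.decoyForm (P.countMean ω (ω.pos .Z) 0)
      (P.countMean ω (ω.pos .Z) 1 - 1 / P.keySlope * u) (P.countMean ω (ω.pos .Z) 2) =
      P.tauOneKey / P.tau 1 * P.decoyForm (P.countMean ω (ω.pos .Z) 0)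
        (P.countMean ω (ω.pos .Z) 1) (P.countMean ω (ω.pos .Z) 2) -
        P.keySlope * (1 / P.keySlope * u) := by
    rw [decoyForm, decoyForm, keySlope]
    ring
  rw [← mul_assoc P.keySlope, mul_one_div_cancel hs, one_mul] at h5
  have h6 := mul_le_mul_of_nonneg_left h3 hq.le
  have h7 := mul_le_mul_of_nonneg_left h4 hq.le
  rw [sKMinus]
  linarith

end Params

/-! ### Monotonicity of the block bounds -/

theorem blockDelta_anti {n b : ℕ} {ε s s' : ℝ} (hs : 0 < s) (hss : s ≤ s') :
    blockDelta n b ε s' ≤ blockDelta n b ε s := by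
  have := deltaH_nonneg (ε := ε) n
  have : 0 < s' := hs.trans_le hss
  unfold blockDelta
  gcongr

theorem blockDelta_nonneg {n b : ℕ} {ε s : ℝ} (hs : 0 ≤ s) : 0 ≤ blockDelta n b ε s := by
  have := deltaH_nonneg (ε := ε) n
  unfold blockDelta
  positivity

/-- `(1 - z)^b + z^b` decreases on `[0, 1/2]`. -/
theorem one_sub_pow_add_pow_anti {b : ℕ} {z z' : ℝ} (hz : 0 ≤ z) (hzz : z ≤ z') (hz' : z' ≤ 1 / 2) :
    (1 - z') ^ b + z' ^ b ≤ (1 - z) ^ b + z ^ b := by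
  induction b with
  | zero => simp
  | succ p ih =>
    have h1 : z' ^ p ≤ (1 - z') ^ p := pow_le_pow_left₀ (hz.trans hzz) (by linarith) p
    have h2 : z' ^ p ≤ (1 - z) ^ p := h1.trans (pow_le_pow_left₀ (by linarith) (by linarith) p)
    have h3 : z ^ p ≤ z' ^ p := pow_le_pow_left₀ hz hzz p
    have h4 : (1 - z') ^ p ≤ (1 - z) ^ p := pow_le_pow_left₀ (by linarith) (by linarith) p
    have e3 : (1 - z) ^ (p + 1) + z ^ (p + 1) - ((1 - z') ^ (p + 1) + z' ^ (p + 1)) =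
        (1 - z') * ((1 - z) ^ p - (1 - z') ^ p) - z' * (z' ^ p - z ^ p) +
          (z' - z) * ((1 - z) ^ p - z ^ p) := by ring
    have h5 : z' * (z' ^ p - z ^ p) ≤ (1 - z') * ((1 - z) ^ p - (1 - z') ^ p) := by
      have h6 : z' ^ p - z ^ p ≤ (1 - z) ^ p - (1 - z') ^ p := by linarith
      have h7 : 0 ≤ z' ^ p - z ^ p := by linarith
      nlinarith
    have h8 : 0 ≤ (z' - z) * ((1 - z) ^ p - z ^ p) := mul_nonneg (by linarith) (by linarith)
    linarith

theorem blockLower_le_of_le {n b : ℕ} {ε s s' z z' S : ℝ} (hb : 1 ≤ b) (hs : 0 < s)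
    (hss : s ≤ s') (hz : 0 ≤ z) (hzz : z ≤ z') (hz' : z' ≤ 1 / 2) (hS : 0 ≤ S)
    (h : blockLower n b ε s' z ≤ S) : blockLower n b ε s z' ≤ S := by
  have hδ := deltaH_nonneg (ε := ε) n
  have hb' : (1 : ℝ) ≤ b := by exact_mod_cast hb
  have hbb : (0 : ℝ) ≤ b * (b - 1) := mul_nonneg (by linarith) (by linarith)
  -- With a nonpositive bracket the bound is at most 0 and trivial; otherwise all factors are
  -- monotone in the right direction.
  rcases le_total ((1 - z') ^ b + z' ^ b - b * (b - 1) / s) 0 with h0 | h0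
  · have : ((n / b : ℕ) : ℝ) * (s / n) ^ b * ((1 - z') ^ b + z' ^ b - b * (b - 1) / s) ≤ 0 :=
      mul_nonpos_of_nonneg_of_nonpos (by positivity) h0
    unfold blockLower
    linarith
  · refine le_trans ?_ h
    have h1 := one_sub_pow_add_pow_anti (b := b) hz hzz hz'
    have h2 : (b * (b - 1) / s' : ℝ) ≤ b * (b - 1) / s := by gcongr
    have h3 : 0 < s' := hs.trans_le hss
    have h4 : 0 ≤ ((n / b : ℕ) : ℝ) * (s' / n) ^ b := by positivity
    unfold blockLower
    gcongr

theorem rateDen_mono {n b : ℕ} {ε s s' z z' : ℝ} (hb : 1 ≤ b) (hs : 0 < s)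
    (hss : s ≤ s') (hz : 0 ≤ z) (hzz : z ≤ z') (hz' : z' ≤ 1 / 2) :
    rateDen n b ε s z' ≤ rateDen n b ε s' z := by
  have hb' : (1 : ℝ) ≤ b := by exact_mod_cast hb
  have hbb : (0 : ℝ) ≤ b * (b - 1) := mul_nonneg (by linarith) (by linarith)
  have h1 := one_sub_pow_add_pow_anti (b := b) hz hzz hz'
  have h2 : (b * (b - 1) / s' : ℝ) ≤ b * (b - 1) / s := by gcongr
  have h3 := blockDelta_anti (n := n) (b := b) (ε := ε) hs hss
  unfold rateDen
  linarith

/-- Weighted power means of `z⁻¹` and `(1 - z)⁻¹`. -/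
theorem weighted_pow_ge {z x : ℝ} (p : ℕ) (hz : 0 < z) (hx : 0 ≤ x) (hw : 0 < 1 - z - 2 * x)
    (h : 0 ≤ 1 - 4 * z - 2 * x + 2 * z ^ 2 + 4 * x * z) :
    (1 - z) ^ p * z ^ p ≤ 2 * x * ((1 - z) ^ p * (1 - z - 2 * x) ^ p) +
      (1 - 2 * x) * ((1 - z - 2 * x) ^ p * z ^ p) := by
  have ha : 0 < 1 - z := by linarith
  -- The case of exponent 1, equivalent to the quadratic hypothesis; convexity of the power then
  -- raises it to exponent `p`.
  have h1 : (1 - z - 2 * x)⁻¹ ≤ 2 * x * z⁻¹ + (1 - 2 * x) * (1 - z)⁻¹ := by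
    have e : 2 * x * z⁻¹ + (1 - 2 * x) * (1 - z)⁻¹ - (1 - z - 2 * x)⁻¹ =
        2 * x * (1 - 4 * z - 2 * x + 2 * z ^ 2 + 4 * x * z) / (z * (1 - z) * (1 - z - 2 * x)) := by
      have := hz.ne'
      have := ha.ne'
      have := hw.ne'
      field_simp
      ring
    rw [← sub_nonneg, e]
    positivity
  have h2 : (2 * x * z⁻¹ + (1 - 2 * x) * (1 - z)⁻¹) ^ p ≤
      2 * x * z⁻¹ ^ p + (1 - 2 * x) * (1 - z)⁻¹ ^ p :=
    (convexOn_pow p).2 (inv_pos.mpr hz).le (inv_pos.mpr ha).le (by positivity) (by linarith)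
      (by ring)
  have h3 : (1 - z - 2 * x)⁻¹ ^ p ≤ 2 * x * z⁻¹ ^ p + (1 - 2 * x) * (1 - z)⁻¹ ^ p :=
    (pow_le_pow_left₀ (inv_pos.mpr hw).le h1 p).trans h2
  have h4 := mul_le_mul_of_nonneg_left h3
    (by positivity : 0 ≤ z ^ p * (1 - z) ^ p * (1 - z - 2 * x) ^ p)
  have e1 : z ^ p * z⁻¹ ^ p = 1 := by rw [← mul_pow, mul_inv_cancel₀ hz.ne', one_pow]
  have e2 : (1 - z) ^ p * (1 - z)⁻¹ ^ p = 1 := by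
    rw [← mul_pow, mul_inv_cancel₀ ha.ne', one_pow]
  have e3 : (1 - z - 2 * x) ^ p * (1 - z - 2 * x)⁻¹ ^ p = 1 := by
    rw [← mul_pow, mul_inv_cancel₀ hw.ne', one_pow]
  calc (1 - z) ^ p * z ^ p
      = z ^ p * (1 - z) ^ p * ((1 - z - 2 * x) ^ p * (1 - z - 2 * x)⁻¹ ^ p) := by rw [e3]; ring
    _ = z ^ p * (1 - z) ^ p * (1 - z - 2 * x) ^ p * (1 - z - 2 * x)⁻¹ ^ p := by ring
    _ ≤ _ := h4
    _ = 2 * x * ((1 - z) ^ p * (1 - z - 2 * x) ^ p) * (z ^ p * z⁻¹ ^ p) +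
      (1 - 2 * x) * ((1 - z - 2 * x) ^ p * z ^ p) * ((1 - z) ^ p * (1 - z)⁻¹ ^ p) := by ring
    _ = _ := by rw [e1, e2, mul_one, mul_one]

/-- The region where the bound on the logical error rate is increasing in both error rates. -/
theorem rate_region {z x : ℝ} (hz : 0 ≤ z) (hx : 0 ≤ x) (h : z < 1 - x - √(x * (1 - x) + 1 / 2)) :
    0 < 1 - z - 2 * x ∧ z + x < 1 / 2 ∧
      0 ≤ 1 - 4 * z - 2 * x + 2 * z ^ 2 + 4 * x * z := by
  have h0 := Real.sqrt_nonneg (x * (1 - x) + 1 / 2)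
  have hx1 : x < 1 := by linarith
  have harg : 0 ≤ x * (1 - x) + 1 / 2 := by nlinarith
  have h1 : x * (1 - x) + 1 / 2 < (1 - x - z) ^ 2 := by
    rw [← Real.sq_sqrt harg]
    exact pow_lt_pow_left₀ (by linarith) h0 two_ne_zero
  have hx2 : x < 1 / 5 := by
    by_contra! hc
    nlinarith
  have h2 : z + x < 1 / 2 := by
    by_contra! hc
    nlinarith
  exact ⟨by linarith, h2, by nlinarith⟩

/-- The numerator of the derivative is `b` times the difference of the two sides in
`weighted_pow_ge` with exponent b - 1. -/
theorem odd_even_ratio_mono {b : ℕ} {z z' x : ℝ} (hz : 0 ≤ z) (hzz : z ≤ z') (hx : 0 ≤ x)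
    (h : z' < 1 - x - √(x * (1 - x) + 1 / 2)) :
    ((1 - z) ^ b - (1 - z - 2 * x) ^ b) / ((1 - z) ^ b + z ^ b) ≤
      ((1 - z') ^ b - (1 - z' - 2 * x) ^ b) / ((1 - z') ^ b + z' ^ b) := by
  have hreg : ∀ y ∈ Set.Icc 0 z', 0 < 1 - y - 2 * x ∧
      0 ≤ 1 - 4 * y - 2 * x + 2 * y ^ 2 + 4 * x * y := fun y hy => by
    have := rate_region hy.1 hx (hy.2.trans_lt h)
    exact ⟨this.1, this.2.2⟩
  have hden : ∀ y ∈ Set.Icc 0 z', 0 < (1 - y) ^ b + y ^ b := fun y hy => by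
    have h1 := (hreg y hy).1
    have h2 : 0 < 1 - y := by linarith
    have := hy.1
    positivity
  have hderiv : ∀ y ∈ Set.Icc 0 z', HasDerivAt
      (fun y : ℝ => ((1 - y) ^ b - (1 - y - 2 * x) ^ b) / ((1 - y) ^ b + y ^ b))
      (((b * (1 - y) ^ (b - 1) * -1 - b * (1 - y - 2 * x) ^ (b - 1) * -1) *
        ((1 - y) ^ b + y ^ b) - ((1 - y) ^ b - (1 - y - 2 * x) ^ b) *
          (b * (1 - y) ^ (b - 1) * -1 + b * y ^ (b - 1) * 1)) / ((1 - y) ^ b + y ^ b) ^ 2) y := by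
    intro y hy
    have d1 : HasDerivAt (fun y : ℝ => 1 - y) (-1) y := by
      simpa using (hasDerivAt_id y).const_sub 1
    exact ((d1.pow b).sub ((d1.sub_const (2 * x)).pow b)).div
      ((d1.pow b).add ((hasDerivAt_id y).pow b)) (hden y hy).ne'
  refine monotoneOn_of_deriv_nonneg (convex_Icc 0 z')
    (fun y hy => (hderiv y hy).continuousAt.continuousWithinAt)
    (fun y hy => (hderiv y (interior_subset hy)).differentiableAt.differentiableWithinAt)
    (fun y hy => ?_) ⟨hz, hzz⟩ ⟨hz.trans hzz, le_rfl⟩ hzz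
  have hy' := interior_subset hy
  rw [interior_Icc] at hy
  rw [(hderiv y hy').deriv]
  refine div_nonneg ?_ (sq_nonneg _)
  cases b with
  | zero => simp
  | succ p =>
    have h1 := weighted_pow_ge p hy.1 hx (hreg y hy').1 (hreg y hy').2
    have h2 : (0 : ℝ) ≤ ((p + 1 : ℕ) : ℝ) := Nat.cast_nonneg _
    simp only [add_tsub_cancel_right]
    have e : ((↑(p + 1) * (1 - y) ^ p * -1 - ↑(p + 1) * (1 - y - 2 * x) ^ p * -1) *
        ((1 - y) ^ (p + 1) + y ^ (p + 1)) - ((1 - y) ^ (p + 1) - (1 - y - 2 * x) ^ (p + 1)) *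
          (↑(p + 1) * (1 - y) ^ p * -1 + ↑(p + 1) * y ^ p * 1)) =
        ((p + 1 : ℕ) : ℝ) * (2 * x * ((1 - y) ^ p * (1 - y - 2 * x) ^ p) +
      (1 - 2 * x) * ((1 - y - 2 * x) ^ p * y ^ p) - (1 - y) ^ p * y ^ p) := by ring
    rw [e]
    exact mul_nonneg h2 (by linarith)

/-- The changes in s and φ_X act on numerator and denominator separately. In φ_Z the numerator need
not be monotone, so there the ratio without corrections is used. -/
theorem rateUpper_mono {n b : ℕ} {ε s s' z z' x x' : ℝ} (hb : 1 ≤ b) (hs : 0 < s) (hss : s ≤ s')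
    (hz : 0 ≤ z) (hzz : z ≤ z') (hx : 0 ≤ x) (hxx : x ≤ x')
    (hreg : z' < 1 - x' - √(x' * (1 - x') + 1 / 2)) (hD : 0 < rateDen n b ε s z') :
    rateUpper n b ε s' z x ≤ rateUpper n b ε s z' x' := by
  have hx' := hx.trans hxx
  have hz' := hz.trans hzz
  obtain ⟨hw, hzx, -⟩ := rate_region hz' hx' hreg
  have hratio := odd_even_ratio_mono (b := b) hz hzz hx' hreg
  have hb' : (1 : ℝ) ≤ b := by exact_mod_cast hb
  have hbb : (0 : ℝ) ≤ b * (b - 1) := mul_nonneg (by linarith) (by linarith)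
  have hG := one_sub_pow_add_pow_anti (b := b) hz hzz (by linarith)
  have hD1 := rateDen_mono (n := n) (ε := ε) hb hs le_rfl hz hzz (by linarith)
  have hD2 := rateDen_mono (n := n) (ε := ε) hb hs hss hz le_rfl (by linarith)
  have hΔ := blockDelta_anti (n := n) (b := b) (ε := ε) hs hss
  have hΔ0 := blockDelta_nonneg (n := n) (b := b) (ε := ε) hs.le
  have hΔ0' := blockDelta_nonneg (n := n) (b := b) (ε := ε) (hs.trans_le hss).le
  set F₁ := (1 - z) ^ b - (1 - z - 2 * x') ^ b with hF₁
  set F₂ := (1 - z') ^ b - (1 - z' - 2 * x') ^ b with hF₂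
  set G₁ := (1 - z) ^ b + z ^ b with hG₁
  set G₂ := (1 - z') ^ b + z' ^ b with hG₂
  have hG₂0 : 0 < G₂ := by
    have : 0 < 1 - z' := by linarith
    positivity
  have hF₁0 : 0 ≤ F₁ := sub_nonneg.mpr (pow_le_pow_left₀ (by linarith) (by linarith) b)
  have hF₂0 : 0 ≤ F₂ := sub_nonneg.mpr (pow_le_pow_left₀ (by linarith) (by linarith) b)
  rw [div_le_div_iff₀ (hG₂0.trans_le hG) hG₂0] at hratio
  have step1 : rateUpper n b ε s' z x ≤ (1 / 2 * F₁ + blockDelta n b ε s) / rateDen n b ε s z := by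
    have h1 : (1 - z - 2 * x') ^ b ≤ (1 - z - 2 * x) ^ b :=
      pow_le_pow_left₀ (by linarith) (by linarith) b
    unfold rateUpper
    refine div_le_div₀ (by positivity) ?_ (hD.trans_le hD1) hD2
    simp only [hF₁]
    linarith
  refine step1.trans ?_
  unfold rateUpper
  rw [div_le_div_iff₀ (hD.trans_le hD1) hD]
  set Δ := blockDelta n b ε s
  have e1 : rateDen n b ε s z = G₁ - (b * (b - 1) / s + Δ) := by rw [rateDen]; ring
  have e2 : rateDen n b ε s z' = G₂ - (b * (b - 1) / s + Δ) := by rw [rateDen]; ring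
  have hc : 0 ≤ b * (b - 1) / s + Δ := by positivity
  rw [← hF₂]
  have h1 : Δ * rateDen n b ε s z' ≤ Δ * rateDen n b ε s z := by gcongr
  have h2 : F₁ * rateDen n b ε s z' ≤ F₂ * rateDen n b ε s z := by
    -- If the numerator grows, the shrinking denominator suffices. If it falls, subtracting the same
    -- c ≥ 0 from both even parts preserves F₁G₂ ≤ F₂G₁.
    rcases le_total F₁ F₂ with h | h
    · exact mul_le_mul h hD1 hD.le hF₂0
    · rw [e1, e2]
      have := mul_le_mul_of_nonneg_right h hc
      linarith
  linarith

theorem toOuterMeasure_le_add {Ω : Type*} (μ : PMF Ω) {s t u : Set Ω} (h : u ⊆ s ∪ t)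
    {a b : ℝ} (ha : 0 ≤ a) (hb : 0 ≤ b) (hs : μ.toOuterMeasure s ≤ ENNReal.ofReal a)
    (ht : μ.toOuterMeasure t ≤ ENNReal.ofReal b) :
    μ.toOuterMeasure u ≤ ENNReal.ofReal (a + b) := by
  rw [ENNReal.ofReal_add ha hb]
  exact (MeasureTheory.measure_mono h).trans
    ((MeasureTheory.measure_union_le s t).trans (add_le_add hs ht))

/-! ### Test sets and key under permutations of positions. -/

namespace Run

variable {N : ℕ} (ω : Run N)

/-- The positions with a flip that shows in basis `B`. -/
def flips (B : Basis) : Finset (Fin N) :=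
  Finset.univ.filter fun i => (ω.response i).flip B = true

theorem inter_flips (D : Finset (Fin N)) (B : Basis) :
    D ∩ ω.flips B = D.filter fun i => (ω.response i).flip B = true := by
  rw [flips, Finset.inter_filter, Finset.inter_univ]

/-- Expresses observed errors through flips, which are defined whatever basis is used and are
therefore fixed while positions are exchanged. -/
theorem singles_errors (f : SetName) (B : Basis)
    (hB : ∀ i ∈ ω.pos f, (ω.pulse i).basisB = B) :
    ω.singles (ω.errors f) = ω.singles (ω.pos f) ∩ ω.flips B := by
  rw [inter_flips, singles, singles, errors, Finset.filter_comm]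
  refine Finset.filter_congr fun i hi => ?_
  rw [bobBit, hB i (Finset.mem_filter.mp hi).1, aliceBit]
  cases (ω.pulse i).bit <;> cases (ω.response i).flip B <;> simp

theorem basisB_of_mem_sifted {B : Basis} {i : Fin N} (h : i ∈ sifted ω.pulse ω.response B) :
    (ω.pulse i).basisB = B := (Finset.mem_filter.mp h).2.2.2

theorem single_subset : ω.single ⊆ ω.singles (ω.pos .Z) :=
  Finset.filter_subset_filter _ (Finset.filter_subset _ _)

theorem singles_pos_subset (f : SetName) : ω.singles (ω.pos f) ⊆ ω.detectedSingles := by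
  intro i hi
  obtain ⟨hi, hp⟩ := Finset.mem_filter.mp hi
  have h : ∃ B, i ∈ sifted ω.pulse ω.response B := by
    cases f
    · exact ⟨_, (Finset.mem_sdiff.mp hi).1⟩
    · exact ⟨_, hi⟩
    · exact ⟨_, (Finset.mem_inter.mp hi).1⟩
  obtain ⟨B, hB⟩ := h
  exact Finset.mem_filter.mpr ⟨Finset.mem_univ _, (Finset.mem_filter.mp hB).2.1, hp⟩

theorem disjoint_pos_Z_T : Disjoint (ω.pos .Z) (ω.pos .T) :=
  Finset.disjoint_left.mpr fun _ h h' => (Finset.mem_sdiff.mp h).2 (Finset.mem_inter.mp h').2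

theorem disjoint_pos_Z_X : Disjoint (ω.pos .Z) (ω.pos .X) :=
  Finset.disjoint_left.mpr fun i h h' => by
    have h1 := ω.basisB_of_mem_sifted (Finset.mem_sdiff.mp h).1
    rw [ω.basisB_of_mem_sifted h'] at h1
    cases h1

theorem pos_permute (π : Equiv.Perm ω.detectedSingles) (f : SetName) :
    (ω.permute (Equiv.Perm.ofSubtype π)).pos f =
      (ω.pos f).map (Equiv.Perm.ofSubtype π).toEmbedding := by
  cases f
  · exact (congrArg (· \ _) (ω.sifted_permute π .Z)).trans (Finset.map_sdiff _ _).symm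
  · exact ω.sifted_permute π .X
  · exact (congrArg (· ∩ _) (ω.sifted_permute π .Z)).trans (Finset.map_inter _ _).symm

theorem singles_permute (π : Equiv.Perm ω.detectedSingles) (D : Finset (Fin N)) :
    (ω.permute (Equiv.Perm.ofSubtype π)).singles (D.map (Equiv.Perm.ofSubtype π).toEmbedding) =
      (ω.singles D).map (Equiv.Perm.ofSubtype π).toEmbedding := by
  rw [singles, singles, Finset.filter_map]
  congr 1
  refine Finset.filter_congr fun i _ => ?_
  have h := ω.photons_ofSubtype_inv π (Equiv.Perm.ofSubtype π i)
  rw [show (Equiv.Perm.ofSubtype π)⁻¹ (Equiv.Perm.ofSubtype π i) = i from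
    Equiv.symm_apply_apply _ _] at h
  rw [h]
  rfl

/-- The key is selected by label, which is why `permute` carries labels along with bases and tests.
-/
theorem single_permute (π : Equiv.Perm ω.detectedSingles) :
    (ω.permute (Equiv.Perm.ofSubtype π)).single =
      ω.single.map (Equiv.Perm.ofSubtype π).toEmbedding := by
  have h : ∀ ω : Run N, ω.single =
      (ω.singles (ω.pos .Z)).filter fun i => (ω.pulse i).label ≠ 2 := fun ω => by
    rw [single, key, singles, Finset.filter_comm]
  rw [h, h, pos_permute, singles_permute, Finset.filter_map]
  congr 1
  refine Finset.filter_congr fun i _ => ?_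
  change (ω.pulse ((Equiv.Perm.ofSubtype π)⁻¹ (Equiv.Perm.ofSubtype π i))).label ≠ 2 ↔ _
  rw [show (Equiv.Perm.ofSubtype π)⁻¹ (Equiv.Perm.ofSubtype π i) = i from
    Equiv.symm_apply_apply _ _]

theorem phiZ_eq : ω.phiZ = ((ω.single ∩ ω.flips .Z).card : ℝ) / ω.single.card := by
  rw [inter_flips]
  rfl

theorem phiX_eq : ω.phiX = ((ω.single ∩ ω.flips .X).card : ℝ) / ω.single.card := by
  rw [inter_flips]
  rfl

end Run

/-! ### Probabilities of the individual failure events. -/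

namespace Params

variable {P : Params} {ε : ℝ}

theorem label_bound_of_imp (A : Attack P.N) (B : Set (Run P.N × Equiv.Perm (Fin P.N)))
    (hε : 0 ≤ ε) (q : Run P.N → (Fin P.N → Fin 3) → Prop) [∀ ω, DecidablePred (q ω)]
    (hB : ∀ ω σ l, (ω.relabel l, σ) ∈ B → q ω l)
    (hq : ∀ ω : Run P.N, (∑ l : Fin P.N → Fin 3,
      if q ω l then ∏ i, P.labelProb (ω.pulse i).photons (l i) else 0) ≤ ε) :
    (P.law A).toOuterMeasure B ≤ ENNReal.ofReal ε := by
  classical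
  exact P.label_bound A B hε fun ω σ => (sum_ite_le_of_imp
    (fun l : Fin P.N → Fin 3 => Finset.prod_nonneg fun i _ => P.labelProb_nonneg _ (l i)) (hB ω σ)).trans (hq ω)

theorem order_bound_of_imp (A : Attack P.N) (B : Set (Run P.N × Equiv.Perm (Fin P.N)))
    (q : Run P.N → Equiv.Perm (Fin P.N) → Prop) [∀ ω, DecidablePred (q ω)]
    (hB : ∀ ω σ, (ω, σ) ∈ B → q ω σ)
    (hq : ∀ ω : Run P.N, (∃ σ, (ω, σ) ∈ B) →
      (∑ σ, if q ω σ then (1 : ℝ) else 0) ≤ ε * P.N.factorial) (hε : 0 ≤ ε) :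
    (P.law A).toOuterMeasure B ≤ ENNReal.ofReal ε := by
  classical
  refine P.order_bound A B fun ω => ?_
  by_cases h : ∃ σ, (ω, σ) ∈ B
  · exact (sum_ite_le_of_imp (fun _ => zero_le_one) (hB ω)).trans (hq ω h)
  · push Not at h
    rw [Finset.sum_eq_zero fun σ _ => if_neg (h σ)]
    positivity

theorem count_upper_bound (A : Attack P.N) {D : Run P.N → Finset (Fin P.N)}
    (hD : ∀ ω l, D (ω.relabel l) = D ω) (l₀ : Fin 3) (hε : 0 < ε) (hε1 : ε < 1) :
    (P.law A).toOuterMeasure {x | P.countMean x.1 (D x.1) l₀ < x.1.count (D x.1) l₀ -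
      deltaMinus (D x.1).card (x.1.count (D x.1) l₀) ε} ≤ ENNReal.ofReal ε := by
  refine label_bound_of_imp A _ hε.le _ (fun ω σ l h => ?_) fun ω =>
    count_upper_tail _ (fun i => P.labelProb_nonneg (ω.pulse i).photons)
      (fun i => P.sum_labelProb _) (D ω) hε hε1 l₀
  rw [Set.mem_ofPred_eq, hD] at h
  exact lt_sub_comm.mp h

theorem count_lower_bound (A : Attack P.N) {D : Run P.N → Finset (Fin P.N)}
    (hD : ∀ ω l, D (ω.relabel l) = D ω) (l₀ : Fin 3) (hε : 0 < ε) (hε1 : ε < 1) :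
    (P.law A).toOuterMeasure {x | x.1.count (D x.1) l₀ +
      deltaPlus (D x.1).card (x.1.count (D x.1) l₀) ε < P.countMean x.1 (D x.1) l₀} ≤
        ENNReal.ofReal ε := by
  refine label_bound_of_imp A _ hε.le _ (fun ω σ l h => ?_) fun ω =>
    count_lower_tail _ (fun i => P.labelProb_nonneg (ω.pulse i).photons)
      (fun i => P.sum_labelProb _) (D ω) hε hε1 l₀
  rw [Set.mem_ofPred_eq, hD] at h
  exact lt_sub_iff_add_lt'.mpr h

/-- Thinning with the single photons of the sifted set `Z`, the labels `0`, `1` that select the key,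
and θ = 1/`keySlope`. -/
theorem thinned_count_upper_bound (A : Attack P.N) (hε : 0 < ε) (hε1 : ε < 1) :
    (P.law A).toOuterMeasure {x | P.countMean x.1 (x.1.pos .Z) 1 -
      1 / P.keySlope * (P.tauOneKey / P.tau 1 * (x.1.singles (x.1.pos .Z)).card - x.1.sK) <
        P.nMinus ε x.1 .Z 1} ≤ ENNReal.ofReal (2 * ε) := by
  have hs := P.keySlope_pos
  have hq := P.key_prob_le_keySlope_mul
  have hp0 := P.labelProb_nonneg 1 0
  have hp1 := P.labelProb_nonneg 1 1
  have hθ : 1 / P.keySlope * (P.labelProb 1 0 + P.labelProb 1 1) ≤ P.labelProb 1 1 := by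
    rwa [one_div_mul_eq_div, div_le_iff₀' hs]
  have hpair : ∀ k, ∑ a ∈ ({0, 1} : Finset (Fin 3)), P.labelProb k a =
      P.labelProb k 0 + P.labelProb k 1 := fun k => Finset.sum_pair (by decide)
  have hθ1 : 1 / P.keySlope ≤ 1 := by
    have h1 : 0 < P.labelProb 1 0 + P.labelProb 1 1 := by
      rw [← tauOneKey_div]
      exact div_pos P.tauOneKey_pos (P.tau_pos 1)
    rw [div_le_one hs]
    nlinarith
  refine label_bound_of_imp A _ (by positivity) _ (fun ω σ l h => ?_) fun ω =>
    thinned_count_upper_tail (fun i => P.labelProb (ω.pulse i).photons)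
      (fun i => P.labelProb_nonneg _) (fun i => P.sum_labelProb _)
      (I := ω.pos .Z) (J := ω.singles (ω.pos .Z)) hε hε1 (Finset.filter_subset _ _)
      (a₀ := 1) (A := {0, 1}) (by decide) (one_div_pos.mpr hs) hθ1 fun i hi => by
        rw [(Finset.mem_filter.mp hi).2, hpair]
        exact hθ
  rw [Set.mem_ofPred_eq, nMinus, Run.nTot_eq_card, Run.n_eq_count, Run.sK_eq,
    Run.pos_relabel] at h
  have hsum : ∑ i ∈ ω.singles (ω.pos .Z), ∑ a ∈ ({0, 1} : Finset (Fin 3)),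
      P.labelProb (ω.pulse i).photons a =
      P.tauOneKey / P.tau 1 * (ω.singles (ω.pos .Z)).card := by
    rw [Finset.sum_congr rfl fun i hi => by rw [(Finset.mem_filter.mp hi).2, hpair],
      Finset.sum_const, nsmul_eq_mul, tauOneKey_div, mul_comm]
  rw [hsum]
  change P.countMean ω (ω.pos .Z) 1 - 1 / P.keySlope * (P.tauOneKey / P.tau 1 *
    (ω.singles (ω.pos .Z)).card -
      (((ω.singles (ω.pos .Z)).filter fun i => l i ∈ ({0, 1} : Finset (Fin 3))).card : ℝ)) <
    (((ω.pos .Z).filter fun i => l i = 1).card : ℝ) - deltaMinus (ω.pos .Z).card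
      ((ω.pos .Z).filter fun i => l i = 1).card ε at h
  unfold countMean at h
  linarith

theorem nPlus_bound (A : Attack P.N) (f : SetName) (l : Fin 3) (hε : 0 < ε) (hε1 : ε < 1) :
    (P.law A).toOuterMeasure {x | P.nPlus ε x.1 f l < P.countMean x.1 (x.1.pos f) l} ≤
      ENNReal.ofReal ε := by
  have h := count_lower_bound A (D := fun ω => ω.pos f) (fun ω l => ω.pos_relabel l f) l hε hε1
  simpa only [nPlus, Run.nTot_eq_card, Run.n_eq_count] using h

theorem nMinus_bound (A : Attack P.N) (f : SetName) (l : Fin 3) (hε : 0 < ε) (hε1 : ε < 1) :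
    (P.law A).toOuterMeasure {x | P.countMean x.1 (x.1.pos f) l < P.nMinus ε x.1 f l} ≤
      ENNReal.ofReal ε := by
  have h := count_upper_bound A (D := fun ω => ω.pos f) (fun ω l => ω.pos_relabel l f) l hε hε1
  simpa only [nMinus, Run.nTot_eq_card, Run.n_eq_count] using h

theorem mPlus_bound (A : Attack P.N) (f : SetName) (l : Fin 3) (hε : 0 < ε) (hε1 : ε < 1) :
    (P.law A).toOuterMeasure {x | P.mPlus ε x.1 f l < P.countMean x.1 (x.1.errors f) l} ≤
      ENNReal.ofReal ε := by
  have h := count_lower_bound A (D := fun ω => ω.errors f) (fun ω l => ω.errors_relabel l f) l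
    hε hε1
  simpa only [mPlus, Run.mTot_eq_card, Run.m_eq_count] using h

theorem mMinus_bound (A : Attack P.N) (f : SetName) (l : Fin 3) (hε : 0 < ε) (hε1 : ε < 1) :
    (P.law A).toOuterMeasure {x | P.countMean x.1 (x.1.errors f) l < P.mMinus ε x.1 f l} ≤
      ENNReal.ofReal ε := by
  have h := count_upper_bound A (D := fun ω => ω.errors f) (fun ω l => ω.errors_relabel l f) l
    hε hε1
  simpa only [mMinus, Run.mTot_eq_card, Run.m_eq_count] using h

theorem sMinus_bound (A : Attack P.N) (f : SetName) (hε : 0 < ε) (hε1 : ε < 1) :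
    (P.law A).toOuterMeasure {x | ((x.1.singles (x.1.pos f)).card : ℝ) < P.sMinus ε x.1 f} ≤
      ENNReal.ofReal (ε + ε + ε) := by
  refine toOuterMeasure_le_add _ (fun x hx => ?_) (by positivity) hε.le
    (toOuterMeasure_le_add _ subset_rfl hε.le hε.le (nPlus_bound A f 0 hε hε1)
      (nMinus_bound A f 1 hε hε1)) (nPlus_bound A f 2 hε hε1)
  by_contra hc
  simp only [Set.mem_union, Set.mem_ofPred_eq, not_or, not_lt] at hc hx
  exact absurd (sMinus_le (log_inv_pos hε hε1).le x.1 f hc.1.1 hc.1.2 hc.2) hx.not_ge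

theorem ePlus_bound (A : Attack P.N) (f : SetName) (hε : 0 < ε) (hε1 : ε < 1) :
    (P.law A).toOuterMeasure {x | P.ePlus ε x.1 f < ((x.1.singles (x.1.errors f)).card : ℝ)} ≤
      ENNReal.ofReal (ε + ε) := by
  refine toOuterMeasure_le_add _ (fun x hx => ?_) hε.le hε.le (mPlus_bound A f 1 hε hε1)
    (mMinus_bound A f 2 hε hε1)
  by_contra hc
  simp only [Set.mem_union, Set.mem_ofPred_eq, not_or, not_lt] at hc hx
  exact absurd (le_ePlus x.1 f hc.1 hc.2) hx.not_ge

theorem sKMinus_bound (A : Attack P.N) (hε : 0 < ε) (hε1 : ε < 1) :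
    (P.law A).toOuterMeasure {x | (x.1.sK : ℝ) < P.sKMinus ε x.1} ≤
      ENNReal.ofReal (ε + 2 * ε + ε) := by
  refine toOuterMeasure_le_add _ (fun x hx => ?_) (by positivity) hε.le
    (toOuterMeasure_le_add _ subset_rfl hε.le (by positivity) (nPlus_bound A .Z 0 hε hε1)
      (thinned_count_upper_bound A hε hε1)) (nPlus_bound A .Z 2 hε hε1)
  by_contra hc
  simp only [Set.mem_union, Set.mem_ofPred_eq, not_or, not_lt] at hc hx
  exact absurd (P.sKMinus_le (log_inv_pos hε hε1).le x.1 hc.1.1 hc.1.2 hc.2) hx.not_ge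

theorem phi_sampling_bound (A : Attack P.N) (f : SetName) (B : Basis)
    (hf : ∀ ω : Run P.N, Disjoint (ω.pos .Z) (ω.pos f)) (hε : 0 < ε) (hε1 : ε < 1) :
    (P.law A).toOuterMeasure {x | 0 < x.1.single.card ∧ 0 < (x.1.singles (x.1.pos f)).card ∧
      ((x.1.singles (x.1.pos f) ∩ x.1.flips B).card : ℝ) / (x.1.singles (x.1.pos f)).card +
        nu x.1.single.card (x.1.singles (x.1.pos f)).card ε <
      ((x.1.single ∩ x.1.flips B).card : ℝ) / x.1.single.card} ≤ ENNReal.ofReal ε :=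
  P.sampling_bound A (fun ω => ω.single) (fun ω => ω.singles (ω.pos f)) (fun ω => ω.flips B)
    (fun ω => ω.single_subset.trans (ω.singles_pos_subset .Z)) (fun ω => ω.singles_pos_subset f)
    (fun ω => (hf ω).mono (ω.single_subset.trans (Finset.filter_subset _ _))
      (Finset.filter_subset _ _))
    (fun ω π => ω.single_permute π)
    (fun ω π => by rw [ω.pos_permute, ω.singles_permute]) (fun _ _ => rfl) hε
    (log_inv_pos hε hε1).le

/-- The estimate of an error rate of `K` from the test set `f` holds, if `s_K⁻ ≤ s_K`. -/
theorem phi_bound (A : Attack P.N) (f : SetName) (B : Basis)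
    (hf : ∀ ω : Run P.N, Disjoint (ω.pos .Z) (ω.pos f))
    (hB : ∀ ω : Run P.N, ∀ i ∈ ω.pos f, (ω.pulse i).basisB = B) (hε : 0 < ε) (hε1 : ε < 1) :
    (P.law A).toOuterMeasure {x | P.sKMinus ε x.1 ≤ x.1.sK ∧ 0 < P.sKMinus ε x.1 ∧
      0 < P.sMinus ε x.1 f ∧
      P.ePlus ε x.1 f / P.sMinus ε x.1 f + nu (P.sKMinus ε x.1) (P.sMinus ε x.1 f) ε <
        ((x.1.single ∩ x.1.flips B).card : ℝ) / x.1.single.card} ≤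
      ENNReal.ofReal (ε + ε + ε + (ε + ε) + ε) := by
  refine toOuterMeasure_le_add _ (fun x hx => ?_) (by positivity) hε.le
    (toOuterMeasure_le_add _ subset_rfl (by positivity) (by positivity) (sMinus_bound A f hε hε1)
      (ePlus_bound A f hε hε1)) (phi_sampling_bound A f B hf hε hε1)
  by_contra hc
  simp only [Set.mem_union, Set.mem_ofPred_eq, not_or, not_lt] at hc hx
  obtain ⟨⟨hs, he⟩, hν⟩ := hc
  obtain ⟨hK, hK0, hs0, hx⟩ := hx
  have hs' := hs0.trans_le hs
  have hK' := hK0.trans_le hK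
  refine hν ⟨by exact_mod_cast hK', by exact_mod_cast hs', lt_of_le_of_lt ?_ hx⟩
  rw [x.1.singles_errors f B (hB x.1)] at he
  -- The estimates sit in denominators and in ν, so smaller values only enlarge the bound; this uses
  -- that both are positive.
  have h1 := nu_anti (log_inv_pos hε hε1).le hK0 hK hs0 hs
  have h2 : ((x.1.singles (x.1.pos f) ∩ x.1.flips B).card : ℝ) /
      (x.1.singles (x.1.pos f)).card ≤ P.ePlus ε x.1 f / P.sMinus ε x.1 f :=
    div_le_div₀ ((Nat.cast_nonneg _).trans he) he hs0 hs
  exact add_le_add h2 h1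

theorem phiZ_bound (A : Attack P.N) (hε : 0 < ε) (hε1 : ε < 1) :
    (P.law A).toOuterMeasure {x | P.sKMinus ε x.1 ≤ x.1.sK ∧ 0 < P.sKMinus ε x.1 ∧
      0 < P.sMinus ε x.1 .T ∧ P.phiZPlus ε x.1 < x.1.phiZ} ≤
      ENNReal.ofReal (ε + ε + ε + (ε + ε) + ε) := by
  have h := phi_bound A .T .Z (fun ω => ω.disjoint_pos_Z_T)
    (fun ω i hi => ω.basisB_of_mem_sifted (Finset.mem_inter.mp hi).1) hε hε1
  simpa only [phiZPlus, Run.phiZ_eq] using h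

theorem phiX_bound (A : Attack P.N) (hε : 0 < ε) (hε1 : ε < 1) :
    (P.law A).toOuterMeasure {x | P.sKMinus ε x.1 ≤ x.1.sK ∧ 0 < P.sKMinus ε x.1 ∧
      0 < P.sMinus ε x.1 .X ∧ P.phiXPlus ε x.1 < x.1.phiX} ≤
      ENNReal.ofReal (ε + ε + ε + (ε + ε) + ε) := by
  have h := phi_bound A .X .X (fun ω => ω.disjoint_pos_Z_X)
    (fun ω i hi => ω.basisB_of_mem_sifted hi) hε hε1
  simpa only [phiXPlus, Run.phiX_eq] using h

theorem S_bound (A : Attack P.N) (hε : 0 < ε) (hε1 : ε < 1) :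
    (P.law A).toOuterMeasure {x | 0 < x.1.sK ∧
      (x.1.S P.b x.2 : ℝ) < blockLower x.1.nK P.b ε x.1.sK x.1.phiZ} ≤ ENNReal.ofReal ε := by
  classical
  exact order_bound_of_imp A _ _ (fun ω σ h => h.2)
    (fun ω ⟨σ, h⟩ => ω.S_tail P.two_le_b hε hε1 h.1) hε.le

theorem R_bound (A : Attack P.N) (hε : 0 < ε) (hε' : ε ≤ 1 / 23) :
    (P.law A).toOuterMeasure {x | x.1.rZ + 2 * x.1.rX < x.1.rNotZ ∧
      x.1.oddBound P.b 0 + 3 * deltaH x.1.nK ε < (x.1.R P.b x.2 : ℝ)} ≤ ENNReal.ofReal ε := by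
  classical
  exact order_bound_of_imp A _ _ (fun ω σ h => h.2)
    (fun ω ⟨σ, h⟩ => ω.R_tail P.two_le_b hε hε' h.1) hε.le

/-- The number of single-photon events in `K`, its bit error rate, or the number of accepted
blocks violates its estimate. -/
def SEventFails (P : Params) (ε : ℝ) (x : Run P.N × Equiv.Perm (Fin P.N)) : Prop :=
  (x.1.sK : ℝ) < P.sKMinus ε x.1 ∨
    (P.sKMinus ε x.1 ≤ x.1.sK ∧ 0 < P.sKMinus ε x.1 ∧ 0 < P.sMinus ε x.1 .T ∧
      P.phiZPlus ε x.1 < x.1.phiZ) ∨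
    (0 < x.1.sK ∧ (x.1.S P.b x.2 : ℝ) < blockLower x.1.nK P.b ε x.1.sK x.1.phiZ)

theorem SEventFails_bound (A : Attack P.N) (hε : 0 < ε) (hε1 : ε < 1) :
    (P.law A).toOuterMeasure {x | SEventFails P ε x} ≤ ENNReal.ofReal (11 * ε) := by
  refine (toOuterMeasure_le_add _ (u := {x | SEventFails P ε x}) (fun x hx => hx)
    (by positivity) (by positivity) (sKMinus_bound A hε hε1)
    (toOuterMeasure_le_add _ subset_rfl (by positivity) hε.le (phiZ_bound A hε hε1)
      (S_bound A hε hε1))).trans (ENNReal.ofReal_le_ofReal (by linarith))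

end Params

/-! ### From the failure events to the bounds in observed data. -/

namespace Run

variable {N : ℕ} (ω : Run N)

theorem phiZ_nonneg : 0 ≤ ω.phiZ := by
  unfold phiZ; positivity

theorem phiX_nonneg : 0 ≤ ω.phiX := by
  unfold phiX; positivity

/-- Since r_¬Z = s_K - r_Z, the condition says that r_Z + r_X is less than s_K/2. -/
theorem rZ_add_two_rX_lt (hs : 0 < ω.sK) (h : ω.phiZ + ω.phiX < 1 / 2) :
    ω.rZ + 2 * ω.rX < ω.rNotZ := by
  have hs' : (0 : ℝ) < ω.sK := by exact_mod_cast hs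
  have hsum : (ω.rZ : ℝ) + ω.rNotZ = ω.sK := by exact_mod_cast ω.rZ_add_rNotZ
  rw [phiZ, phiX, ← add_div, div_lt_iff₀ hs'] at h
  have : (ω.rZ : ℝ) + 2 * ω.rX < ω.rNotZ := by linarith
  exact_mod_cast this

end Run

namespace Params

variable {P : Params} {ε : ℝ}

theorem sEventFails_of_sFails {x : Run P.N × Equiv.Perm (Fin P.N)} (h : P.SFails ε x.1 x.2) :
    SEventFails P ε x := by
  obtain ⟨⟨hK, hT, hz⟩, hS⟩ := h
  by_contra hc
  simp only [SEventFails, not_or, not_and, not_lt] at hc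
  obtain ⟨h1, h2, h3⟩ := hc
  have hK' := hK.trans_le h1
  exact absurd (blockLower_le_of_le (by have := P.two_le_b; omega) hK h1 x.1.phiZ_nonneg
    (h2 h1 hK hT) hz.le (Nat.cast_nonneg _) (h3 (by exact_mod_cast hK'))) hS.not_ge

/-- Outside the listed events the regularity of the data forces φ_Z + φ_X < 1/2 and a positive true
denominator, so the fixed-key bound applies and `rateUpper_mono` transfers it to the estimates. -/
theorem events_of_phiFails {x : Run P.N × Equiv.Perm (Fin P.N)} (h : P.PhiFails ε x.1 x.2) :
    SEventFails P ε x ∨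
      (P.sKMinus ε x.1 ≤ x.1.sK ∧ 0 < P.sKMinus ε x.1 ∧ 0 < P.sMinus ε x.1 .X ∧
        P.phiXPlus ε x.1 < x.1.phiX) ∨
      (x.1.rZ + 2 * x.1.rX < x.1.rNotZ ∧
        x.1.oddBound P.b 0 + 3 * deltaH x.1.nK ε < (x.1.R P.b x.2 : ℝ)) := by
  obtain ⟨⟨hbn, hK, hT, hX, hD, hreg⟩, hΦ⟩ := h
  by_contra hc
  simp only [SEventFails, not_or, not_and, not_lt] at hc
  obtain ⟨⟨h1, h2, h3⟩, h4, h5⟩ := hc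
  have hb : 1 ≤ P.b := by have := P.two_le_b; omega
  have hK' : 0 < x.1.sK := by exact_mod_cast hK.trans_le h1
  have hz := h2 h1 hK hT
  have hx := h4 h1 hK hX
  have hz0 := x.1.phiZ_nonneg
  have hx0 := x.1.phiX_nonneg
  obtain ⟨-, hzx, -⟩ := rate_region (hz0.trans hz) (hx0.trans hx) hreg
  have hr := x.1.rZ_add_two_rX_lt hK' (by linarith)
  have hD' : 0 < rateDen x.1.nK P.b ε x.1.sK x.1.phiZ :=
    hD.trans_le (rateDen_mono hb hK h1 hz0 hz (by linarith))
  obtain ⟨h6, h7⟩ := x.1.phi_le_rateUpper hb hr hbn hD' (h3 hK') (h5 hr)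
  exact hΦ ⟨h6, h7.trans (rateUpper_mono hb hK h1 hz0 hz hx0 hx hreg hD)⟩

/-- The union bound already gives 11ε. -/
theorem sFails_bound (A : Attack P.N) (hε : 0 < ε) (hε1 : ε < 1) :
    (P.law A).toOuterMeasure {x | P.SFails ε x.1 x.2} ≤ ENNReal.ofReal (14 * ε) :=
  ((MeasureTheory.measure_mono fun _ hx => sEventFails_of_sFails hx).trans
    (SEventFails_bound A hε hε1)).trans (ENNReal.ofReal_le_ofReal (by linarith))

/-- Both failures share the events in `SEventFails`; adding φ_X and `R` gives 11 + 6 + 1 = 18 units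
of ε. -/
theorem sFails_or_phiFails_bound (A : Attack P.N) (hε : 0 < ε) (hε' : ε ≤ 1 / 23) :
    (P.law A).toOuterMeasure {x | P.SFails ε x.1 x.2 ∨ P.PhiFails ε x.1 x.2} ≤
      ENNReal.ofReal (23 * ε) := by
  have hε1 : ε < 1 := by linarith
  refine (toOuterMeasure_le_add _ (fun x hx => ?_) (by positivity) (by positivity)
    (SEventFails_bound A hε hε1) (toOuterMeasure_le_add _ subset_rfl (by positivity) hε.le
      (phiX_bound A hε hε1) (R_bound A hε hε'))).trans (ENNReal.ofReal_le_ofReal (by linarith))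
  rcases hx with hx | hx
  · exact Or.inl (sEventFails_of_sFails hx)
  · exact events_of_phiFails hx

end Params

end ADQKD

theorem mainTheorem3 (P : Params) (ε : ℝ) (hε : 0 < ε) (hε' : ε ≤ 1 / 23) :
    -- random blocks, all other data of the run being fixed
    (∀ ω : Run P.N,
      -- the expected numbers of blocks
      orderMean (fun σ => ω.S P.b σ) =
          ((ω.nK / P.b : ℕ) : ℝ) *
            (((ω.rNotZ.descFactorial P.b : ℝ) + (ω.rZ.descFactorial P.b : ℝ)) /
              (ω.nK.descFactorial P.b : ℝ)) ∧
      (0 < ω.sK →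
        ((ω.nK / P.b : ℕ) : ℝ) * ((ω.sK : ℝ) / ω.nK) ^ P.b *
            ((1 - ω.phiZ) ^ P.b + ω.phiZ ^ P.b - P.b * (P.b - 1) / ω.sK) ≤
          orderMean (fun σ => ω.S P.b σ)) ∧
      orderMean (fun σ => ω.R P.b σ) =
          ((ω.nK / P.b : ℕ) : ℝ) *
            ((∑ k ∈ (Finset.range (P.b + 1)).filter Odd, (P.b.choose k : ℝ) *
              (((ω.cls false true).descFactorial k : ℝ) *
                  ((ω.cls false false).descFactorial (P.b - k) : ℝ) +
                ((ω.cls true true).descFactorial k : ℝ) *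
                  ((ω.cls true false).descFactorial (P.b - k) : ℝ))) /
              (ω.nK.descFactorial P.b : ℝ)) ∧
      orderMean (fun σ => ω.R P.b σ) ≤
          (ω.nK : ℝ) ^ P.b / (ω.nK.descFactorial P.b : ℝ) *
            ω.oddBound P.b (ω.cls true true) ∧
      -- the concentration bound for the number of accepted single-photon blocks
      (0 < ω.sK →
        (orderLaw P.N).toOuterMeasure
            {σ | (ω.S P.b σ : ℝ) < blockLower ω.nK P.b ε ω.sK ω.phiZ} ≤ ENNReal.ofReal ε) ∧
      (ω.rZ + 2 * ω.rX < ω.rNotZ →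
        -- the expectation bound is decreasing in `m_Y`, hence maximised at `m_Y = 0`
        AntitoneOn (ω.oddBound P.b) (Set.Icc 0 (min (ω.rX : ℝ) ω.rZ)) ∧
        ω.oddBound P.b 0 =
          1 / 2 * ((ω.nK / P.b : ℕ) : ℝ) * ((ω.sK : ℝ) / ω.nK) ^ P.b *
            ((1 - ω.phiZ) ^ P.b - (1 - ω.phiZ - 2 * ω.phiX) ^ P.b) ∧
        orderMean (fun σ => ω.R P.b σ) ≤
          (ω.nK : ℝ) ^ P.b / (ω.nK.descFactorial P.b : ℝ) * ω.oddBound P.b 0 ∧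
        -- the concentration bounds for the logical errors
        (orderLaw P.N).toOuterMeasure
            {σ | ω.oddBound P.b 0 + 3 * deltaH ω.nK ε < (ω.R P.b σ : ℝ)} ≤ ENNReal.ofReal ε ∧
        (P.b ≤ ω.nK → 0 < rateDen ω.nK P.b ε ω.sK ω.phiZ →
          (orderLaw P.N).toOuterMeasure
              {σ | ¬ (0 < ω.S P.b σ ∧
                ω.Phi P.b σ ≤ rateUpper ω.nK P.b ε ω.sK ω.phiZ ω.phiX)} ≤
            ENNReal.ofReal (2 * ε)))) ∧
    -- the bounds in terms of observed data, for the whole protocol under an arbitrary attack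
    (∀ A : Attack P.N,
      (P.law A).toOuterMeasure {x | P.SFails ε x.1 x.2} ≤ ENNReal.ofReal (14 * ε) ∧
      (P.law A).toOuterMeasure {x | P.SFails ε x.1 x.2 ∨ P.PhiFails ε x.1 x.2} ≤
        ENNReal.ofReal (23 * ε)) := by
  have hε1 : ε < 1 := by linarith
  have hb2 := P.two_le_b
  have hb : 0 < P.b := by omega
  classical
  refine ⟨fun ω => ⟨ω.orderMean_S hb, ω.orderMean_S_ge hb2, ω.orderMean_R hb, ω.orderMean_R_le hb,
    fun hs => orderLaw_le (ω.S_tail hb2 hε hε1 hs), fun h => ?_⟩,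
    fun A => ⟨Params.sFails_bound A hε hε1, Params.sFails_or_phiFails_bound A hε hε'⟩⟩
  have hs : 0 < ω.sK := by have := ω.rZ_add_rNotZ; omega
  have hS := orderLaw_le (ω.S_tail hb2 hε hε1 hs)
  have hR := orderLaw_le (ω.R_tail hb2 hε hε' h)
  refine ⟨ω.oddBound_antitoneOn P.b h, ω.oddBound_zero P.b hs,
    ω.orderMean_R_le_oddBound_zero hb h, hR, fun hbn hD => ?_⟩
  rw [two_mul]
  refine toOuterMeasure_le_add _ (fun σ hσ => ?_) hε.le hε.le hS hR
  by_contra hc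
  simp only [Set.mem_union, Set.mem_ofPred_eq, not_or, not_lt] at hc
  exact hσ (ω.phi_le_rateUpper hb h hbn hD hc.1 hc.2)
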